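/- **Notation.** Let $n\ge 0$, $X=(x_1,\dots,x_n)$, $Y=(y_1,\dots,y_n)$, and $Y_r=(y_1,\dots,y_r)$ for $0\le r\le n$; let $e_m$ denote the $m$-th elementary symmetric polynomial ($e_m=0$ for $m<0$). All polynomials below lie in $\mathbb Z[1/2][X,Y]$. Let $\rho_n=(n,n-1,\dots,1)$ and let $\mathcal D_n$ be the set of strict partitions contained in $\rho_n$, i.e. with distinct nonzero parts taken from $\{1,\dots,n\}$. For $\lambda\in\mathcal D_n$ let $|\lambda|$ be the sum and $\ell(\lambda)$ the number of its nonzero parts $\lambda_1>\lambda_2>\cdots$ (with $\lambda_i=0$ for $i>\ell(\lambda)$), let $\lambda'=\rho_n\smallsetminus\lambda$ be the strict partition whose parts complement those of $\lambda$ in $\{1,\dots,n\}$, and let $e(\lambda)=|\lambda|-\ell(\lambda)(\ell(\lambda)+1)/2$. Unions and intersections of strict partitions are taken on sets of parts, while $\mu\subset\lambda$ means $\mu_i\le\lambda_i$ for all $i$. For $\alpha,\beta\in\mathcal D_n$ with $\alpha\cap\beta=\emptyset$ let $$e(\alpha,\beta)=\sum_{i\ge1} i\cdot\#\{\,j \mid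 \alpha_i>\beta_j>\alpha_{i+1}\,\}.$$ Put $\widetilde Q_{i,j}(X)=e_i(X)e_j(X)+2\sum_{k=1}^{j}(-1)^k e_{i+k}(X)e_{j-k}(X)$ and, for $\lambda\in\mathcal D_n$, $$\widetilde Q_\lambda(X)=\mathrm{Pfaffian}\,[\widetilde Q_{\lambda_i,\lambda_j}(X)]_{1\le i<j\le r},\qquad \widetilde P_\lambda(X)=2^{-\ell(\lambda)}\,\widetilde Q_\lambda(X),$$ where $r$ is the least even integer with $r\ge\ell(\lambda)$. Put $$\widetilde P_n(X,Y)=\sum_{\lambda\in\mathcal D_n}\widetilde P_\lambda(X)\widetilde P_{\lambda'}(Y),\qquad \Delta(X,Y)=\prod_{i+j\le n}(x_i-y_j).$$ The hyperoctahedral group $W_n$ of signed permutations $(u_1,\dots,u_n)$ of $\{1,\dots,n\}$ is generated by $s_0,\dots,s_{n-1}$, where $(u_1,\dots,u_n)s_0=(\overline{u}_1,u_2,\dots,u_n)$ and, for $i\ge1$, $s_i$ is the transposition of $i$ and $i+1$. On polynomials, $s_0$ replaces $x_1$ by $-x_1$ and $s_i$ ($i\ge1$) interchanges $x_i$ and $x_{i+1}$,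 all other variables being fixed. Define $$\partial'_0(f)=\frac{f-s_0f}{x_1},\qquad \partial'_i(f)=-\frac{f-s_if}{x_i-x_{i+1}}\quad(1\le i\le n-1),$$ and $\partial'_w=\partial'_{a_1}\circ\cdots\circ\partial'_{a_r}$ for any reduced decomposition $w=s_{a_1}\cdots s_{a_r}$. With $w_0=(\overline1,\dots,\overline n)$, the type $B$ double Schubert polynomial of $w\in W_n$ is $$\mathfrak B_w(X,Y)=(-1)^{n(n-1)/2}\,\partial'_{w^{-1}w_0}\bigl(\Delta(X,Y)\,\widetilde P_n(X,Y)\bigr).$$ For $\lambda\in\mathcal D_n$, $\ell=\ell(\lambda)$ and $k=n-\ell$, let $w_\lambda=(\overline{\lambda}_1,\dots,\overline{\lambda}_\ell,\lambda'_k,\dots,\lambda'_1)$ and $\mathfrak B_\lambda=\mathfrak B_{w_\lambda}$. **Theorem.** For every $\lambda\in\mathcal D_n$, $$\mathfrak B_\lambda(X,Y)=(-1)^{e(\lambda)+|\lambda'|}\sum_{\alpha}\widetilde P_\alpha(X)\sum_{\beta}(-1)^{e(\alpha,\beta)+|\beta|}\,\widetilde P_{(\alpha\cup\beta)'}(Y)\,\det\bigl(e_{\beta_i-\lambda'_j}(Y_{n-\lambda'_j})\bigr)_{1\le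 i,j\le \ell(\lambda')},$$ where the first sum is over all $\alpha\in\mathcal D_n$ and the second over all $\beta\in\mathcal D_n$ with $\beta\supset\lambda'$, $\ell(\beta)=\ell(\lambda')$ and $\alpha\cap\beta=\emptyset$. -/

import Mathlib

open scoped BigOperators

noncomputable section

namespace SchubertB

/-! ## Strict partitions

A strict partition is identified with the finite set of its nonzero parts. -/

/-- The set `𝒟_n` of strict partitions contained in `ρ_n = (n, n-1, …, 1)`: these are the strict
partitions all of whose nonzero parts lie in `{1, …, n}`. -/
def strictPartitions (n : ℕ) : Finset (Finset ℕ) := (Finset.Icc 1 n).powerset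

/-- The `i`-th largest part of `lam`, where `i` counts from `0`; it is `0` beyond the length. -/
def part (lam : Finset ℕ) (i : ℕ) : ℕ := (lam.sort (· ≥ ·)).getD i 0

/-- The weight `|lam|`, the sum of the parts. -/
def weight (lam : Finset ℕ) : ℕ := ∑ p ∈ lam, p

/-- The length `ℓ(lam)`, the number of nonzero parts. -/
def length (lam : Finset ℕ) : ℕ := lam.card

/-- The dual partition `ρ_n ∖ lam`, whose parts complement those of `lam` in `{1, …, n}`. -/
def dual (n : ℕ) (lam : Finset ℕ) : Finset ℕ := Finset.Icc 1 n \ lam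

/-- Containment `mu ⊂ lam` of Young diagrams. -/
def Contained (mu lam : Finset ℕ) : Prop := ∀ i, part mu i ≤ part lam i

instance (mu lam : Finset ℕ) : Decidable (Contained mu lam) := Classical.dec _

/-- The excess `e(lam) = |lam| - ℓ(ℓ+1)/2`. No truncation occurs for strict partitions, see
`length_mul_le_weight`. -/
def excess (lam : Finset ℕ) : ℕ := weight lam - length lam * (length lam + 1) / 2

/-- `m_i(α, β) = #{j | α_i > β_j > α_{i+1}}`, with `i` counting from `0`. -/
def intertwiningCount (al be : Finset ℕ) (i : ℕ) : ℕ :=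
  (be.filter (fun b => b < part al i ∧ part al (i + 1) < b)).card

/-- The intertwining number `e(α, β) = ∑_{i ≥ 1} i m_i(α, β)`; the summands with `i > ℓ(α)`
vanish. -/
def intertwining (al be : Finset ℕ) : ℕ :=
  ∑ i ∈ Finset.range (length al), (i + 1) * intertwiningCount al be i

theorem length_mul_le_weight {n : ℕ} {lam : Finset ℕ} (h : lam ∈ strictPartitions n) :
    length lam * (length lam + 1) / 2 ≤ weight lam := by
  have h0 : (0 : ℕ) ∉ lam := fun h' => by
    simpa using Finset.mem_powerset.1 h h'
  have key : ∀ (k : ℕ) (s : Finset ℕ), s.card = k → 0 ∉ s →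
      k * (k + 1) ≤ 2 * ∑ p ∈ s, p := by
    intro k
    induction k with
    | zero => intro s _ _; simp
    | succ k ih =>
      intro s hs hs0
      have hne : s.Nonempty := Finset.card_pos.1 (by omega)
      have hmem := s.max'_mem hne
      have hsub : s ⊆ Finset.Icc 1 (s.max' hne) := fun a ha =>
        Finset.mem_Icc.2 ⟨Nat.one_le_iff_ne_zero.2 (fun h => hs0 (h ▸ ha)), s.le_max' a ha⟩
      have hcard : k + 1 ≤ s.max' hne := by
        simpa [hs] using Finset.card_le_card hsub
      have := ih (s.erase (s.max' hne)) (by rw [Finset.card_erase_of_mem hmem, hs]; rfl)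
        (fun h => hs0 (Finset.mem_of_mem_erase h))
      rw [← Finset.add_sum_erase s _ hmem]
      nlinarith
  have := key lam.card lam rfl h0
  unfold length weight
  omega

/-! ## The hyperoctahedral group -/

/-- The hyperoctahedral group `W_n = (ℤ/2)^n ⋊ S_n`. The pair `(v, σ)` is the signed permutation
that sends `i` to `σ i`, with a bar exactly when `v (σ i) = -1`; the product is composition of
signed permutations. The set `{1, …, n}` is modelled by `Fin n`, so that `j : Fin n` stands for
`j + 1`. -/
abbrev SignedPerm (n : ℕ) : Type :=
  (Fin n → ℤˣ) ⋊[mulAutArrow (G := Equiv.Perm (Fin n)) (A := Fin n) (M := ℤˣ)]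
    Equiv.Perm (Fin n)

/-- The one-line notation `(w_1, …, w_n)` of a signed permutation, a barred entry `a` being
written as `-a`. -/
def oneLine {n : ℕ} (w : SignedPerm n) (i : Fin n) : ℤ :=
  (w.left (w.right i) : ℤ) * ((w.right i : ℕ) + 1 : ℤ)

/-- The position before `i` (and `0` if `i = 0`). -/
def prev {n : ℕ} (i : Fin n) : Fin n := ⟨(i : ℕ) - 1, by omega⟩

/-- The generators `s_0, …, s_{n-1}` of `W_n`: `s_0` changes the sign of the first entry, and
`s_i`, for `i ≥ 1`, is the transposition of the letters `i` and `i + 1`, which are the elements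
`i - 1` and `i` of `Fin n`. -/
def simple {n : ℕ} (i : Fin n) : SignedPerm n :=
  if (i : ℕ) = 0 then SemidirectProduct.inl (Pi.mulSingle i (-1))
  else SemidirectProduct.inr (Equiv.swap (prev i) i)

theorem left_mul_apply {n : ℕ} (u w : SignedPerm n) (j : Fin n) :
    (u * w).left j = u.left j * w.left (u.right⁻¹ j) := rfl

/-- Right multiplication by `s_0` changes the sign of the first entry. -/
theorem oneLine_mul_simple_zero {n : ℕ} (u : SignedPerm n) (i : Fin n) (hi : (i : ℕ) = 0)
    (j : Fin n) :
    oneLine (u * simple i) j = if j = i then - oneLine u j else oneLine u j := by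
  have h1 : (simple i).right = 1 := by simp [simple, hi]
  have h2 : (simple i).left = Pi.mulSingle i (-1) := by simp [simple, hi]
  unfold oneLine
  rw [left_mul_apply, SemidirectProduct.mul_right, h1, h2]
  by_cases h : j = i
  · subst h
    simp
  · simp [h]

/-- Right multiplication by `s_i`, `i ≥ 1`, swaps two adjacent entries. -/
theorem oneLine_mul_simple_pos {n : ℕ} (u : SignedPerm n) (i : Fin n) (hi : (i : ℕ) ≠ 0)
    (j : Fin n) :
    oneLine (u * simple i) j = oneLine u (Equiv.swap (prev i) i j) := by
  simp [oneLine, simple, hi]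

/-- The longest element `w_0`, all of whose entries `1, …, n` are barred. -/
def longest (n : ℕ) : SignedPerm n := SemidirectProduct.inl (fun _ => -1)

/-- The entries of `w_λ` without their bars: `(λ_1, …, λ_ℓ, λ'_k, …, λ'_1)`. -/
def maxGrassmannianEntries (n : ℕ) (lam : Finset ℕ) : List ℕ :=
  lam.sort (· ≥ ·) ++ (dual n lam).sort (· ≤ ·)

theorem length_maxGrassmannianEntries {n : ℕ} {lam : Finset ℕ} (h : lam ∈ strictPartitions n) :
    (maxGrassmannianEntries n lam).length = n := by
  have h' := Finset.mem_powerset.1 h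
  have := Finset.card_sdiff_add_card_eq_card h'
  simp only [maxGrassmannianEntries, List.length_append, Finset.length_sort, dual]
  simp at this
  omega

theorem mem_maxGrassmannianEntries {n : ℕ} {lam : Finset ℕ} (h : lam ∈ strictPartitions n)
    {p : ℕ} (hp : p ∈ maxGrassmannianEntries n lam) : 1 ≤ p ∧ p ≤ n := by
  simp only [maxGrassmannianEntries, List.mem_append, Finset.mem_sort, dual,
    Finset.mem_sdiff] at hp
  rcases hp with hp | hp
  · exact Finset.mem_Icc.1 (Finset.mem_powerset.1 h hp)
  · exact Finset.mem_Icc.1 hp.1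

theorem nodup_maxGrassmannianEntries (n : ℕ) (lam : Finset ℕ) :
    (maxGrassmannianEntries n lam).Nodup := by
  refine List.Nodup.append (Finset.sort_nodup _ _) (Finset.sort_nodup _ _) ?_
  intro a ha hb
  simp only [Finset.mem_sort, dual, Finset.mem_sdiff] at ha hb
  exact hb.2 ha

/-- The underlying permutation of `w_λ`; an entry `p` is the element `p - 1` of `Fin n`. -/
def maxGrassmannianPerm (n : ℕ) (lam : Finset ℕ) (h : lam ∈ strictPartitions n) :
    Equiv.Perm (Fin n) :=
  Equiv.ofBijective
    (fun i => ⟨(maxGrassmannianEntries n lam)[(i : ℕ)]'(by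
        rw [length_maxGrassmannianEntries h]; exact i.2) - 1, by
      have := mem_maxGrassmannianEntries h (List.getElem_mem
        (l := maxGrassmannianEntries n lam) (n := (i : ℕ)) (by
          rw [length_maxGrassmannianEntries h]; exact i.2))
      omega⟩)
    (Finite.injective_iff_bijective.1 (by
      intro i j hij
      have hi := mem_maxGrassmannianEntries h (List.getElem_mem
        (l := maxGrassmannianEntries n lam) (n := (i : ℕ)) (by
          rw [length_maxGrassmannianEntries h]; exact i.2))
      have hj := mem_maxGrassmannianEntries h (List.getElem_mem
        (l := maxGrassmannianEntries n lam) (n := (j : ℕ)) (by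
          rw [length_maxGrassmannianEntries h]; exact j.2))
      simp only [Fin.mk.injEq] at hij
      exact Fin.ext ((nodup_maxGrassmannianEntries n lam).getElem_inj_iff.1 (by omega))))

/-- The maximal Grassmannian element
`w_λ = (λ̄_1, …, λ̄_ℓ, λ'_k, …, λ'_1)`: exactly the values that are parts of `lam` are barred. -/
def maxGrassmannian (n : ℕ) (lam : Finset ℕ) (h : lam ∈ strictPartitions n) : SignedPerm n where
  left j := if (j : ℕ) + 1 ∈ lam then -1 else 1
  right := maxGrassmannianPerm n lam h

theorem oneLine_maxGrassmannian {n : ℕ} {lam : Finset ℕ} (h : lam ∈ strictPartitions n)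
    (i : Fin n) :
    oneLine (maxGrassmannian n lam h) i =
      if (i : ℕ) < length lam then -(part lam i : ℤ)
      else (part (dual n lam) (n - 1 - i) : ℤ) := by
  have hlen := length_maxGrassmannianEntries h
  have hi : (i : ℕ) < (maxGrassmannianEntries n lam).length := by rw [hlen]; exact i.2
  have hval : (((maxGrassmannianPerm n lam h) i : Fin n) : ℕ) + 1 =
      (maxGrassmannianEntries n lam)[(i : ℕ)]'hi := by
    have := mem_maxGrassmannianEntries h (List.getElem_mem hi)
    change (maxGrassmannianEntries n lam)[(i : ℕ)]'hi - 1 + 1 = _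
    omega
  have hcard : (maxGrassmannianEntries n lam).length = lam.card + (dual n lam).card := by
    simp [maxGrassmannianEntries]
  have hrev : (dual n lam).sort (· ≤ ·) = ((dual n lam).sort (· ≥ ·)).reverse := by
    refine List.Perm.eq_of_pairwise' (r := (· ≤ ·)) (Finset.pairwise_sort _ _) ?_ ?_
    · rw [List.pairwise_reverse]
      exact Finset.pairwise_sort _ _
    · exact (Finset.sort_perm_toList _ _).trans
        ((Finset.sort_perm_toList _ _).symm.trans (List.reverse_perm _).symm)
  have hone : oneLine (maxGrassmannian n lam h) i =
      ((if (maxGrassmannianEntries n lam)[(i : ℕ)]'hi ∈ lam then (-1 : ℤˣ) else 1 : ℤˣ) : ℤ) *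
        ((maxGrassmannianEntries n lam)[(i : ℕ)]'hi : ℤ) := by
    rw [← hval]
    simp [oneLine, maxGrassmannian]
  rw [hone]
  by_cases hil : (i : ℕ) < lam.card
  · have he : (maxGrassmannianEntries n lam)[(i : ℕ)]'hi = part lam i := by
      simp only [maxGrassmannianEntries, part]
      rw [List.getElem_append_left (by simpa using hil), List.getD_eq_getElem]
    have hm : part lam i ∈ lam := by
      rw [part, List.getD_eq_getElem _ _ (by simpa using hil)]
      exact (Finset.mem_sort _).1 (List.getElem_mem _)
    rw [he, if_pos hm, length, if_pos hil]
    simp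
  · have hb : n - 1 - (i : ℕ) < (dual n lam).card := by omega
    have he : (maxGrassmannianEntries n lam)[(i : ℕ)]'hi = part (dual n lam) (n - 1 - i) := by
      simp only [maxGrassmannianEntries, part]
      rw [List.getElem_append_right (by simpa using hil),
        List.getD_eq_getElem _ _ (by simpa using hb)]
      simp only [hrev, List.getElem_reverse, Finset.length_sort]
      congr 1
      omega
    have hm : part (dual n lam) (n - 1 - i) ∉ lam := by
      rw [part, List.getD_eq_getElem _ _ (by simpa using hb)]
      have := (Finset.mem_sort _).1 (List.getElem_mem
        (l := (dual n lam).sort (· ≥ ·)) (n := n - 1 - (i : ℕ)) (by simpa using hb))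
      exact (Finset.mem_sdiff.1 this).2
    rw [he, if_neg hm, length, if_neg hil]
    simp

/-- `a` is a reduced decomposition of `w`: `w = s_{a_1} ⋯ s_{a_r}` with `r` as small as
possible. -/
def IsReducedWord {n : ℕ} (a : List (Fin n)) (w : SignedPerm n) : Prop :=
  (a.map simple).prod = w ∧ ∀ b : List (Fin n), (b.map simple).prod = w → a.length ≤ b.length

theorem exists_word {n : ℕ} (w : SignedPerm n) :
    ∃ a : List (Fin n), (a.map simple).prod = w := by
  have hrange : ∀ l : List (SignedPerm n), (∀ u ∈ l, u ∈ Set.range (simple (n := n))) →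
      ∃ a : List (Fin n), a.map simple = l := by
    intro l
    induction l with
    | nil => intro _; exact ⟨[], rfl⟩
    | cons u l ih =>
      intro hl
      obtain ⟨i, hi⟩ := hl u (by simp)
      obtain ⟨a, ha⟩ := ih (fun v hv => hl v (by simp [hv]))
      exact ⟨i :: a, by simp [hi, ha]⟩
  suffices hw : w ∈ Submonoid.closure (Set.range (simple (n := n))) by
    obtain ⟨l, hl, hp⟩ := Submonoid.exists_list_of_mem_closure hw
    obtain ⟨a, rfl⟩ := hrange l hl
    exact ⟨a, hp⟩
  have hinr : ∀ σ : Equiv.Perm (Fin n), (SemidirectProduct.inr σ : SignedPerm n) ∈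
      Submonoid.closure (Set.range (simple (n := n))) := by
    cases n with
    | zero =>
      intro σ
      rw [Subsingleton.elim σ 1, map_one]
      exact one_mem _
    | succ m =>
      intro σ
      have hσ : σ ∈ Submonoid.closure
          (Set.range fun i : Fin m => Equiv.swap i.castSucc i.succ) := by
        rw [Equiv.Perm.mclosure_swap_castSucc_succ]; trivial
      induction hσ using Submonoid.closure_induction with
      | mem s hs =>
        obtain ⟨i, rfl⟩ := hs
        refine Submonoid.subset_closure ⟨i.succ, ?_⟩
        have : prev i.succ = i.castSucc := Fin.ext (by simp [prev])
        simp [simple, this]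
      | one => rw [map_one]; exact one_mem _
      | mul s t _ _ hs ht => rw [map_mul]; exact mul_mem hs ht
  have hinl : ∀ v : Fin n → ℤˣ, (SemidirectProduct.inl v : SignedPerm n) ∈
      Submonoid.closure (Set.range (simple (n := n))) := by
    intro v
    refine Pi.mulSingle_induction
      (fun v => (SemidirectProduct.inl v : SignedPerm n) ∈
        Submonoid.closure (Set.range (simple (n := n)))) v ?_ ?_ ?_
    · rw [map_one]; exact one_mem _
    · intro f g hf hg
      rw [map_mul]; exact mul_mem hf hg
    · intro j e
      rcases Int.units_eq_one_or e with rfl | rfl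
      · rw [Pi.mulSingle_one, map_one]; exact one_mem _
      · let z : Fin n := ⟨0, j.pos⟩
        have hconj : (Pi.mulSingle j (-1) : Fin n → ℤˣ) =
            mulAutArrow (Equiv.swap z j) (Pi.mulSingle z (-1) : Fin n → ℤˣ) := by
          funext a
          change _ = (Pi.mulSingle z (-1) : Fin n → ℤˣ) ((Equiv.swap z j)⁻¹ a)
          by_cases ha : a = j
          · subst ha
            simp
          · have : (Equiv.swap z j)⁻¹ a ≠ z := by
              intro h
              apply ha
              rw [Equiv.Perm.inv_eq_iff_eq] at h
              simpa using h
            rw [Pi.mulSingle_eq_of_ne ha, Pi.mulSingle_eq_of_ne this]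
        rw [hconj, SemidirectProduct.inl_aut]
        refine mul_mem (mul_mem (hinr _) (Submonoid.subset_closure ⟨z, ?_⟩)) (hinr _)
        simp [simple, z]
  rw [← SemidirectProduct.inl_left_mul_inr_right w]
  exact mul_mem (hinl _) (hinr _)

theorem exists_isReducedWord {n : ℕ} (w : SignedPerm n) :
    ∃ a : List (Fin n), IsReducedWord a w := by
  classical
  have hex : ∃ r, ∃ a : List (Fin n), (a.map simple).prod = w ∧ a.length = r := by
    obtain ⟨a, ha⟩ := exists_word w
    exact ⟨_, a, ha, rfl⟩
  obtain ⟨a, ha, hr⟩ := Nat.find_spec hex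
  exact ⟨a, ha, fun b hb => hr ▸ Nat.find_min' hex ⟨b, hb, rfl⟩⟩

/-- A reduced decomposition of `w`. -/
def reducedWord {n : ℕ} (w : SignedPerm n) : List (Fin n) := (exists_isReducedWord w).choose

/-! ## Polynomials and divided differences -/

/-- The coefficient ring `ℤ[1/2]`. -/
def ZHalf : Type := Localization.Away (2 : ℤ)

instance : CommRing ZHalf := inferInstanceAs (CommRing (Localization.Away (2 : ℤ)))

instance : IsLocalization.Away (2 : ℤ) ZHalf := by
  let A : Algebra ℤ ZHalf := inferInstanceAs (Algebra ℤ (Localization.Away (2 : ℤ)))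
  have h : @IsLocalization.Away ℤ _ 2 ZHalf _ A :=
    inferInstanceAs (IsLocalization.Away (2 : ℤ) (Localization.Away (2 : ℤ)))
  have hA : Ring.toIntAlgebra ZHalf = A := Subsingleton.elim _ _
  rw [hA]
  exact h

instance : IsDomain ZHalf := by
  have h : Submonoid.powers (2 : ℤ) ≤ nonZeroDivisors ℤ :=
    powers_le_nonZeroDivisors_of_noZeroDivisors (by norm_num)
  have h2 : IsLocalization (Submonoid.powers (2 : ℤ)) ZHalf :=
    inferInstanceAs (IsLocalization.Away (2 : ℤ) ZHalf)
  exact IsLocalization.isDomain_of_le_nonZeroDivisors ZHalf h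

/-- The element `1/2` of `ℤ[1/2]`. -/
def half : ZHalf := IsLocalization.Away.invSelf (2 : ℤ)

theorem two_mul_half : (2 : ZHalf) * half = 1 := by
  have := IsLocalization.Away.mul_invSelf (S := ZHalf) (2 : ℤ)
  simpa [half] using this

/-- The ring `ℤ[1/2][X, Y]` in the variables `x_1, …, x_n` and `y_1, …, y_n`. -/
abbrev Poly (n : ℕ) : Type := MvPolynomial (Fin n ⊕ Fin n) ZHalf

/-- The variable `x_{i+1}`. -/
def x {n : ℕ} (i : Fin n) : Poly n := MvPolynomial.X (Sum.inl i)

/-- The variable `y_{j+1}`. -/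
def y {n : ℕ} (j : Fin n) : Poly n := MvPolynomial.X (Sum.inr j)

/-- The action of the generators on polynomials: `s_0` replaces `x_1` by `-x_1`, and `s_i`
interchanges `x_i` and `x_{i+1}` for `i ≥ 1`; all other variables are fixed. -/
def act {n : ℕ} (i : Fin n) : Poly n →ₐ[ZHalf] Poly n :=
  MvPolynomial.aeval (Sum.elim
    (fun j => if (i : ℕ) = 0 then (if j = i then -x j else x j)
      else x (Equiv.swap (prev i) i j))
    y)

/-- The denominators of the type `B` divided differences: `x_1` for `i = 0`, and `x_i - x_{i+1}`
for `i ≥ 1`. -/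
def denom {n : ℕ} (i : Fin n) : Poly n := if (i : ℕ) = 0 then x i else x (prev i) - x i

theorem denom_dvd {n : ℕ} (i : Fin n) (f : Poly n) : denom i ∣ f - act i f := by
  rw [← Ideal.mem_span_singleton, ← Ideal.Quotient.eq]
  have hd : Ideal.Quotient.mkₐ ZHalf (Ideal.span {denom i}) (denom i) = 0 :=
    Ideal.Quotient.eq_zero_iff_mem.2 (Ideal.mem_span_singleton_self _)
  have key : Ideal.Quotient.mkₐ ZHalf (Ideal.span {denom i}) =
      (Ideal.Quotient.mkₐ ZHalf (Ideal.span {denom i})).comp (act i) := by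
    refine MvPolynomial.algHom_ext fun v => ?_
    rw [AlgHom.comp_apply]
    rcases v with j | j
    · by_cases hi : (i : ℕ) = 0
      · by_cases hj : j = i
        · subst hj
          have hx : Ideal.Quotient.mkₐ ZHalf (Ideal.span {denom j}) (x j) = 0 := by
            simpa only [denom, hi, if_true] using hd
          have : act j (MvPolynomial.X (Sum.inl j)) = -x j := by simp [act, hi]
          rw [this, map_neg, hx, neg_zero]
          exact hx
        · have : act i (MvPolynomial.X (Sum.inl j)) = x j := by simp [act, hi, hj]
          rw [this]
          rfl
      · have hact : act i (MvPolynomial.X (Sum.inl j)) = x (Equiv.swap (prev i) i j) := by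
          simp [act, hi]
        have hx : Ideal.Quotient.mkₐ ZHalf (Ideal.span {denom i}) (x (prev i)) =
            Ideal.Quotient.mkₐ ZHalf (Ideal.span {denom i}) (x i) := by
          rw [← sub_eq_zero, ← map_sub]
          simpa only [denom, hi, if_false] using hd
        rw [hact]
        change Ideal.Quotient.mkₐ ZHalf (Ideal.span {denom i}) (x j) = _
        by_cases h1 : j = prev i
        · rw [h1, Equiv.swap_apply_left, hx]
        · by_cases h2 : j = i
          · rw [h2, Equiv.swap_apply_right, hx]
          · rw [Equiv.swap_apply_of_ne_of_ne h1 h2]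
    · have : act i (MvPolynomial.X (Sum.inr j)) = y j := by simp [act]
      rw [this]
      rfl
  exact DFunLike.congr_fun key f

/-- The type `B` divided difference operator `∂_i(f) = (f - s_i f) / denom i`, as an exact
quotient. -/
def divDiff {n : ℕ} (i : Fin n) (f : Poly n) : Poly n := (denom_dvd i f).choose

theorem denom_mul_divDiff {n : ℕ} (i : Fin n) (f : Poly n) :
    denom i * divDiff i f = f - act i f := (denom_dvd i f).choose_spec.symm

/-- The exact quotient is unique. -/
theorem eq_divDiff {n : ℕ} (i : Fin n) (f g : Poly n) (h : denom i * g = f - act i f) :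
    g = divDiff i f := by
  have hne : denom i ≠ 0 := by
    by_cases hi : (i : ℕ) = 0
    · simp only [denom, hi, if_true]
      exact MvPolynomial.X_ne_zero _
    · simp only [denom, hi, if_false]
      refine sub_ne_zero.2 fun h' => ?_
      have h1 : prev i = i := Sum.inl_injective (MvPolynomial.X_injective h')
      have h2 := congrArg Fin.val h1
      simp only [prev] at h2
      omega
  exact mul_left_cancel₀ hne (h.trans (denom_mul_divDiff i f).symm)

/-- `∂'_0 = ∂_0` and `∂'_i = -∂_i` for `i ≥ 1`. -/
def divDiff' {n : ℕ} (i : Fin n) (f : Poly n) : Poly n :=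
  if (i : ℕ) = 0 then divDiff i f else -divDiff i f

/-- `∂'_{a_1} ∘ ⋯ ∘ ∂'_{a_r}` for a word `a`. -/
def divDiffWord {n : ℕ} (a : List (Fin n)) (f : Poly n) : Poly n := a.foldr divDiff' f

/-- The operator `∂'_w`, through a reduced decomposition of `w`. -/
def divDiffPerm {n : ℕ} (w : SignedPerm n) (f : Poly n) : Poly n := divDiffWord (reducedWord w) f

/-! ## The `Q̃`- and `P̃`-polynomials -/

/-- The Pfaffian of the triangular array `(A i j)_{i < j}` of even size `2m`, by expansion along
the first row. -/
def pfaffian {R : Type*} [CommRing R] : (m : ℕ) → (Fin (2 * m) → Fin (2 * m) → R) → R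
  | 0, _ => 1
  | m + 1, A => ∑ j : Fin (2 * m + 1), (-1) ^ (j : ℕ) * A 0 j.succ *
      pfaffian m (fun a b => A (j.succAbove a).succ (j.succAbove b).succ)

/-- `Q̃_{i,j}(X) = e_i e_j + 2 ∑_{k=1}^{j} (-1)^k e_{i+k} e_{j-k}`. -/
def qTildePair (n i j : ℕ) : MvPolynomial (Fin n) ZHalf :=
  MvPolynomial.esymm (Fin n) ZHalf i * MvPolynomial.esymm (Fin n) ZHalf j +
    2 * ∑ k ∈ Finset.Icc 1 j, (-1) ^ k *
      (MvPolynomial.esymm (Fin n) ZHalf (i + k) * MvPolynomial.esymm (Fin n) ZHalf (j - k))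

/-- `Q̃_λ(X) = Pfaffian[Q̃_{λ_i, λ_j}(X)]_{1 ≤ i < j ≤ r}`, where `r` is `ℓ(λ)` rounded up to an
even number; the polynomial has integer coefficients and is regarded over `ℤ[1/2]`. -/
def qTilde (n : ℕ) (lam : Finset ℕ) : MvPolynomial (Fin n) ZHalf :=
  pfaffian ((length lam + 1) / 2) (fun i j => qTildePair n (part lam i) (part lam j))

/-- `P̃_λ = 2^{-ℓ(λ)} Q̃_λ`. -/
def pTilde (n : ℕ) (lam : Finset ℕ) : MvPolynomial (Fin n) ZHalf :=
  MvPolynomial.C (half ^ length lam) * qTilde n lam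

/-- `P̃_λ(X)`. -/
def pTildeX (n : ℕ) (lam : Finset ℕ) : Poly n := MvPolynomial.rename Sum.inl (pTilde n lam)

/-- `P̃_λ(Y)`. -/
def pTildeY (n : ℕ) (lam : Finset ℕ) : Poly n := MvPolynomial.rename Sum.inr (pTilde n lam)

/-- The reproducing kernel `P̃_n(X, Y) = ∑_{λ ∈ 𝒟_n} P̃_λ(X) P̃_{ρ_n ∖ λ}(Y)`. -/
def pKernel (n : ℕ) : Poly n :=
  ∑ lam ∈ strictPartitions n, pTildeX n lam * pTildeY n (dual n lam)

/-- `Δ(X, Y) = ∏_{i + j ≤ n} (x_i - y_j)`. -/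
def delta (n : ℕ) : Poly n :=
  ∏ p ∈ (Finset.univ : Finset (Fin n × Fin n)).filter
    (fun p => ((p.1 : ℕ) + 1) + ((p.2 : ℕ) + 1) ≤ n), (x p.1 - y p.2)

/-- The type `B` double Schubert polynomial
`𝔅_w(X, Y) = (-1)^{n(n-1)/2} ∂'_{w⁻¹ w_0} (Δ(X, Y) P̃_n(X, Y))`. -/
def schubertB {n : ℕ} (w : SignedPerm n) : Poly n :=
  (-1) ^ (n * (n - 1) / 2) * divDiffPerm (w⁻¹ * longest n) (delta n * pKernel n)

/-- `e_m(Y_{n-c})`, the `m`-th elementary symmetric polynomial in `y_1, …, y_{n-c}`; it is `0`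
for `m < 0`. -/
def elemY (n c : ℕ) (m : ℤ) : Poly n :=
  if 0 ≤ m then
    MvPolynomial.rename (fun j => Sum.inr (Fin.castLE (Nat.sub_le n c) j))
      (MvPolynomial.esymm (Fin (n - c)) ZHalf m.toNat)
  else 0

/-- The matrix `(e_{β_i - μ_j}(Y_{n - μ_j}))` with `1 ≤ i, j ≤ ℓ(μ)`. -/
def elemMatrix (n : ℕ) (be mu : Finset ℕ) :
    Matrix (Fin (length mu)) (Fin (length mu)) (Poly n) :=
  Matrix.of fun i j => elemY n (part mu j) ((part be i : ℤ) - (part mu j : ℤ))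

end SchubertB

end

noncomputable section

namespace SchubertB

/-! ### Rank-two identities behind the braid relations -/

section RankTwo

variable {R : Type*} [CommRing R] [IsDomain R]

/-! The element w_λ⁻¹w_0 is the inverse of w_0w_λ = (λ_1,…,λ_ℓ,-λ'_k,…,-λ'_1), a strictly decreasing
line. It is built from the identity by treating the letters 1,…,n in turn. A letter of λ moves right
past the larger letters not yet treated; a letter of λ' is barred by s_0 and carried to the far end.
Every step is an ascent, so ∂'_{w_λ⁻¹w_0} is a composite of chains of simple operators, one per
letter (`exists_route`, `divDiffPerm_maxGrassmannian`). Since ∂'_w is defined through a chosen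
reduced word, this first needs the braid relations and independence of the word
(`divDiffWord_eq_of_prod_eq`).

The factor Δ is a staircase of products ∏(x_k - y_t). Each chain consumes its first row and shifts
the remaining rows back by one variable (`chain_mul_stair`). For a letter of λ the consumed row
contributes only a sign, its degree being the length of the chain. For a letter q of λ' the row
∏_{t≤n-q}(x_1 - y_t) is multiplied into the symmetric factor, and ∂'_{n-1}⋯∂'_0 is applied
(`routeOp_stair_mul`).

The central computation is that ∂'_{n-1}⋯∂'_0(x_1^{n-b} P̃_α(X)) is ±P̃_{α∖b}(X) if b is a part of
α, and 0 otherwise (`chain_xVar_pow_mul_pTildeX`). Here s_0 changes the matrix Q̃_{i,j} by the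
rank-two form e_i s_0(e_j) - s_0(e_i)e_j (`sAct_zero_qVar`), so the change of the Pfaffian is a sum
over pairs of deleted indices (`map_pf`). The rest of the chain keeps only those pairs that contain
b, and what remains is the Pfaffian of α∖b.

Starting from P̃_n(X,Y), each letter of λ' thus deletes one part b from the X-index, with weight
±e_{b-q}(Y_{n-q}). Collecting the deleted parts into a set β disjoint from α, the sum over orders of
deletion is a Laplace expansion of the determinant (`listCoeff_eq`, `detList_eq_det`). The relative
signs of β and α give the intertwining number (`crossSign_eq`), the determinant vanishes unless β
contains λ' (`det_elemMatrix_eq_zero`), and the remaining signs combine to (-1)^{e(λ)} (`sign_eq`).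
-/

theorem braid_two (s t : R →+* R) (a b : R) (ha : a ≠ 0) (hb : b ≠ 0)
    (hsb : s b = b) (hta : t a = a)
    (hst : ∀ f, s (t f) = t (s f)) (f g1 g2 h1 h2 : R)
    (e1 : b * g1 = f - t f) (e2 : a * g2 = g1 - s g1)
    (e3 : a * h1 = f - s f) (e4 : b * h2 = h1 - t h1) : g2 = h2 := by
  have k1 := congrArg s e1
  have k3 := congrArg t e3
  simp only [map_mul, map_sub, hsb, hta] at k1 k3
  apply mul_left_cancel₀ (mul_ne_zero ha hb)
  linear_combination b * e2 - a * e4 + e1 - k1 - e3 + k3 + hst f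

/-- Clearing denominators by the product of the three positive roots leaves the alternating sum over
the dihedral group of order 6. Only its last term distinguishes s from t, and there the braid
relation applies. -/
theorem braid_three_aux (s t : R →+* R) (a b : R) (ha : a ≠ 0)
    (hsa : s a = -a) (hsb : s b = a + b) (hta : t a = a + b)
    (hss : ∀ f, s (s f) = f) (f g1 g2 g3 : R)
    (e1 : a * g1 = f - s f) (e2 : b * g2 = g1 - t g1) (e3 : a * g3 = g2 - s g2) :
    a * b * (a + b) * g3 =
      f - s f - t f + t (s f) + s (t f) - s (t (s f)) := by
  have k1 := congrArg s e1
  have k2 := congrArg t e1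
  have k3 := congrArg s e2
  have k4 := congrArg s k2
  simp only [map_mul, map_sub, map_add, hsb, hta, hsa, hss] at k1 k2 k3 k4
  apply mul_left_cancel₀ ha
  linear_combination a * b * (a + b) * e3 + a * (a + b) * e2 - a * b * k3 + (a + b) * e1
    - a * k2 + b * k1 + a * k4

theorem braid_three (s t : R →+* R) (a b : R) (ha : a ≠ 0) (hb : b ≠ 0) (hab : a + b ≠ 0)
    (hsa : s a = -a) (hsb : s b = a + b) (hta : t a = a + b) (htb : t b = -b)
    (hss : ∀ f, s (s f) = f) (htt : ∀ f, t (t f) = f)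
    (hst : ∀ f, s (t (s f)) = t (s (t f))) (f g1 g2 g3 h1 h2 h3 : R)
    (e1 : a * g1 = f - s f) (e2 : b * g2 = g1 - t g1) (e3 : a * g3 = g2 - s g2)
    (e4 : b * h1 = f - t f) (e5 : a * h2 = h1 - s h1) (e6 : b * h3 = h2 - t h2) :
    g3 = h3 := by
  have h := braid_three_aux s t a b ha hsa hsb hta hss f g1 g2 g3 e1 e2 e3
  have h' := braid_three_aux t s b a hb htb (by rw [hta, add_comm]) (by rw [hsb, add_comm]) htt
    f h1 h2 h3 e4 e5 e6
  apply mul_left_cancel₀ (mul_ne_zero (mul_ne_zero ha hb) hab)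
  linear_combination h - h' - hst f

/-- The same method in type B_2: the positive roots are a, b, a + b, b + 2a, and both words produce
the alternating sum over the dihedral group of order 8. -/
theorem braid_four (s t : R →+* R) (a b : R) (ha : a ≠ 0) (hb : b ≠ 0) (hab : a + b ≠ 0)
    (hab' : b + 2 * a ≠ 0)
    (hsa : s a = -a) (hsb : s b = b + 2 * a) (hta : t a = a + b) (htb : t b = -b)
    (hss : ∀ f, s (s f) = f) (htt : ∀ f, t (t f) = f)
    (hst : ∀ f, s (t (s (t f))) = t (s (t (s f)))) (f g1 g2 g3 g4 h1 h2 h3 h4 : R)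
    (e1 : b * g1 = f - t f) (e2 : a * g2 = g1 - s g1) (e3 : b * g3 = g2 - t g2)
    (e4 : a * g4 = g3 - s g3)
    (d1 : a * h1 = f - s f) (d2 : b * h2 = h1 - t h1) (d3 : a * h3 = h2 - s h2)
    (d4 : b * h4 = h3 - t h3) : g4 = h4 := by
  -- A quotient (q - u q)/c is invariant under u, because numerator and denominator both change
  -- sign. This shortens the translates of the intermediate quotients.
  have fix : ∀ (u : R →+* R) (c p q : R), c ≠ 0 → u c = -c → (∀ f, u (u f) = f) →
      c * p = q - u q → u p = p := by
    intro u c p q hc huc huu h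
    have := congrArg u h
    simp only [map_mul, map_sub, huc, huu] at this
    apply mul_left_cancel₀ hc
    linear_combination -this - h
  have tg1 : t g1 = g1 := fix t b g1 f hb htb htt e1
  have sg2 : s g2 = g2 := fix s a g2 g1 ha hsa hss e2
  have sh1 : s h1 = h1 := fix s a h1 f ha hsa hss d1
  have th2 : t h2 = h2 := fix t b h2 h1 hb htb htt d2
  have two : ∀ u : R →+* R, u 2 = 2 := fun u => map_ofNat u 2
  have p1 := congrArg s e1
  have p2 := congrArg t p1
  have p3 := congrArg s p2
  have q2 := congrArg t e2
  have q3 := congrArg s q2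
  have r3 := congrArg s e3
  have p1' := congrArg t d1
  have p2' := congrArg s p1'
  have p3' := congrArg t p2'
  have q2' := congrArg s d2
  have q3' := congrArg t q2'
  have r3' := congrArg t d3
  simp only [map_mul, map_sub, map_add, map_neg, hsb, hta, hsa, htb, tg1, sg2, sh1, th2,
    two] at p1 p2 p3 q2 q3 r3 p1' p2' p3' q2' q3' r3'
  have E : a * b * (a + b) * (b + 2 * a) * g4 = (f - t f) - (s f - s (t f)) +
      (t (s f) - t (s (t f))) - (s (t (s f)) - s (t (s (t f)))) := by
    linear_combination b * (a + b) * (b + 2 * a) * e4 + (a + b) * (b + 2 * a) * e3 -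
      b * (a + b) * r3 + 2 * (a + b) * e2 - (b + 2 * a) * q2 + b * q3 + e1 - p1 + p2 - p3
  have E' : a * b * (a + b) * (b + 2 * a) * h4 = (f - s f) - (t f - t (s f)) +
      (s (t f) - s (t (s f))) - (t (s (t f)) - t (s (t (s f)))) := by
    linear_combination a * (a + b) * (b + 2 * a) * d4 + (a + b) * (b + 2 * a) * d3 -
      a * (b + 2 * a) * r3' + (b + 2 * a) * d2 - (a + b) * q2' + a * q3' + d1 - p1' + p2' - p3'
  apply mul_left_cancel₀ (mul_ne_zero (mul_ne_zero (mul_ne_zero ha hb) hab) hab')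
  linear_combination E - E' + hst f

end RankTwo

/-! ### Divided differences indexed by natural numbers -/

variable {n : ℕ}

/-- The variable `x_{k+1}`, indexed by a natural number. -/
def xVar (n k : ℕ) : Poly n := if h : k < n then x ⟨k, h⟩ else 0

/-- The action of `s_k`, the identity for `k ≥ n`. -/
def sAct (n k : ℕ) : Poly n →+* Poly n :=
  if h : k < n then (act ⟨k, h⟩ : Poly n →ₐ[ZHalf] Poly n).toRingHom else RingHom.id _

/-- The denominator of `∂'_k`, including its sign. -/
def root (n k : ℕ) : Poly n := if k = 0 then xVar n 0 else xVar n k - xVar n (k - 1)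

theorem sAct_of_lt {k : ℕ} (h : k < n) (f : Poly n) : sAct n k f = act ⟨k, h⟩ f := by
  simp [sAct, h]

theorem x_injective : Function.Injective (x : Fin n → Poly n) := fun _ _ h =>
  Sum.inl_injective (MvPolynomial.X_injective h)

theorem sAct_zero_xVar (h : 0 < n) (j : ℕ) :
    sAct n 0 (xVar n j) = if j = 0 then -xVar n 0 else xVar n j := by
  rw [sAct_of_lt h]
  unfold xVar
  by_cases hj : j < n
  · simp only [hj, dif_pos, h]
    by_cases hj0 : j = 0
    · subst hj0
      simp [x, act]
    · simp [x, act, hj0]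
  · have : j ≠ 0 := by omega
    simp [hj, this]

theorem sAct_succ_xVar {k : ℕ} (h : k + 1 < n) (j : ℕ) :
    sAct n (k + 1) (xVar n j) =
      if j = k then xVar n (k + 1) else if j = k + 1 then xVar n k else xVar n j := by
  rw [sAct_of_lt h]
  unfold xVar
  by_cases hj : j < n
  · have hk : k < n := by omega
    simp only [hj, dif_pos, h, hk]
    have hp : prev (⟨k + 1, h⟩ : Fin n) = ⟨k, hk⟩ := rfl
    have : act ⟨k + 1, h⟩ (x (⟨j, hj⟩ : Fin n)) =
        x (Equiv.swap (⟨k, hk⟩ : Fin n) ⟨k + 1, h⟩ ⟨j, hj⟩) := by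
      simp [x, act, hp]
    rw [this]
    split_ifs with h1 h2
    · subst h1; rw [Equiv.swap_apply_left]
    · subst h2; rw [Equiv.swap_apply_right]
    · rw [Equiv.swap_apply_of_ne_of_ne] <;> simpa
  · have h1 : j ≠ k := by omega
    have h2 : j ≠ k + 1 := by omega
    simp [hj, h1, h2]

theorem sAct_y (k : ℕ) (j : Fin n) : sAct n k (y j) = y j := by
  by_cases h : k < n
  · rw [sAct_of_lt h]; simp [y, act]
  · simp [sAct, h]

theorem sAct_C (k : ℕ) (c : ZHalf) : sAct n k (MvPolynomial.C c) = MvPolynomial.C c := by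
  by_cases h : k < n
  · rw [sAct_of_lt h]; simp [act]
  · simp [sAct, h]

/-- A ring endomorphism identity can be checked on constants and variables. -/
theorem ringHom_ext_xVar {f g : Poly n →+* Poly n}
    (hC : ∀ c, f (MvPolynomial.C c) = g (MvPolynomial.C c))
    (hx : ∀ j, f (xVar n j) = g (xVar n j)) (hy : ∀ j : Fin n, f (y j) = g (y j)) : f = g := by
  refine MvPolynomial.ringHom_ext hC ?_
  rintro (j | j)
  · have := hx j
    simpa [xVar, x] using this
  · exact hy j

theorem sAct_sAct (k : ℕ) (f : Poly n) : sAct n k (sAct n k f) = f := by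
  have : (sAct n k).comp (sAct n k) = RingHom.id _ := by
    refine ringHom_ext_xVar (fun c => by simp [sAct_C]) (fun j => ?_) (fun j => by simp [sAct_y])
    simp only [RingHom.comp_apply, RingHom.id_apply]
    by_cases h : k < n
    · rcases k with _ | k
      · rw [sAct_zero_xVar h]
        split_ifs with h1
        · rw [map_neg, sAct_zero_xVar h]; simp [h1]
        · rw [sAct_zero_xVar h]; simp [h1]
      · rw [sAct_succ_xVar h]
        split_ifs with h1 h2
        · rw [sAct_succ_xVar h]; simp [h1]
        · rw [sAct_succ_xVar h]; simp [h2]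
        · rw [sAct_succ_xVar h]; simp [h1, h2]
    · simp [sAct, h]
  exact DFunLike.congr_fun this f

theorem sAct_comm_of_lt {i j : ℕ} (hij : i + 1 < j) (f : Poly n) :
    sAct n i (sAct n j f) = sAct n j (sAct n i f) := by
  by_cases hj : j < n
  swap
  · simp [sAct, hj]
  have hi : i < n := by omega
  have : (sAct n i).comp (sAct n j) = (sAct n j).comp (sAct n i) := by
    refine ringHom_ext_xVar (fun c => by simp [sAct_C]) (fun m => ?_) (fun j => by simp [sAct_y])
    simp only [RingHom.comp_apply]
    obtain ⟨j, rfl⟩ : ∃ j', j = j' + 1 := ⟨j - 1, by omega⟩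
    rcases i with _ | i
    · simp only [sAct_succ_xVar hj, sAct_zero_xVar hi]
      split_ifs <;> simp only [sAct_succ_xVar hj, sAct_zero_xVar hi, map_neg] <;>
        split_ifs <;> first | contradiction | omega | (subst_vars; rfl)
    · simp only [sAct_succ_xVar hj, sAct_succ_xVar hi]
      split_ifs <;> simp only [sAct_succ_xVar hj, sAct_succ_xVar hi] <;>
        split_ifs <;> first | rfl | omega
  exact DFunLike.congr_fun this f

theorem sAct_braid_three {i : ℕ} (hi : i + 2 < n) (f : Poly n) :
    sAct n (i + 1) (sAct n (i + 2) (sAct n (i + 1) f)) =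
      sAct n (i + 2) (sAct n (i + 1) (sAct n (i + 2) f)) := by
  have hi' : i + 1 < n := by omega
  have : ((sAct n (i + 1)).comp (sAct n (i + 2))).comp (sAct n (i + 1)) =
      ((sAct n (i + 2)).comp (sAct n (i + 1))).comp (sAct n (i + 2)) := by
    refine ringHom_ext_xVar (fun c => by simp [sAct_C]) (fun m => ?_) (fun j => by simp [sAct_y])
    simp only [RingHom.comp_apply]
    have e1 := sAct_succ_xVar (n := n) (k := i + 1) hi
    have e2 := sAct_succ_xVar (n := n) (k := i) hi'
    have e1' := e1
    rw [show i + 1 + 1 = i + 2 from rfl] at e1'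
    by_cases h1 : m = i
    · simp [e1', e2, h1]
    by_cases h2 : m = i + 1
    · simp [e1', e2, h2]
    by_cases h3 : m = i + 2
    · simp [e1', e2, h3]
    simp [e1', e2, h1, h2, h3]
  exact DFunLike.congr_fun this f

theorem sAct_braid_four (hn : 1 < n) (f : Poly n) :
    sAct n 0 (sAct n 1 (sAct n 0 (sAct n 1 f))) =
      sAct n 1 (sAct n 0 (sAct n 1 (sAct n 0 f))) := by
  have : (((sAct n 0).comp (sAct n 1)).comp (sAct n 0)).comp (sAct n 1) =
      (((sAct n 1).comp (sAct n 0)).comp (sAct n 1)).comp (sAct n 0) := by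
    refine ringHom_ext_xVar (fun c => by simp [sAct_C]) (fun m => ?_) (fun j => by simp [sAct_y])
    simp only [RingHom.comp_apply]
    have e1 := sAct_succ_xVar (n := n) (k := 0) hn
    have e2 := sAct_zero_xVar (n := n) (by omega)
    by_cases h1 : m = 0
    · simp [e1, e2, h1]
    by_cases h2 : m = 1
    · simp [e1, e2, h2]
    simp [e1, e2, h1, h2]
  exact DFunLike.congr_fun this f

theorem xVar_ne {i j : ℕ} (hi : i < n) (hj : j < n) (h : i ≠ j) : xVar n i ≠ xVar n j := by
  simp only [xVar, hi, hj, dif_pos]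
  exact fun h' => h (by simpa using x_injective h')

theorem root_eq_denom {k : ℕ} (h : k < n) :
    root n k = if k = 0 then denom ⟨k, h⟩ else -denom ⟨k, h⟩ := by
  by_cases hk : k = 0
  · subst hk; simp [root, denom, xVar, h]
  · have : k - 1 < n := by omega
    simp [root, denom, xVar, h, hk, this, prev]

theorem root_ne_zero {k : ℕ} (h : k < n) : root n k ≠ 0 := by
  by_cases hk : k = 0
  · subst hk
    simp only [root, if_true, xVar, h, dif_pos]
    exact MvPolynomial.X_ne_zero _
  · simp only [root, hk, if_false]
    exact sub_ne_zero.2 (xVar_ne h (by omega) (by omega))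

theorem sAct_root_self {k : ℕ} (h : k < n) : sAct n k (root n k) = -root n k := by
  rcases k with _ | k
  · simp [root, sAct_zero_xVar h]
  · simp [root, sAct_succ_xVar h]

theorem sAct_root_of_lt {i j : ℕ} (hij : i + 1 < j) (hj : j < n) :
    sAct n i (root n j) = root n j ∧ sAct n j (root n i) = root n i := by
  have hi : i < n := by omega
  obtain ⟨j, rfl⟩ : ∃ j', j = j' + 1 := ⟨j - 1, by omega⟩
  have a1 : j ≠ 0 := by omega
  rcases i with _ | i
  · have a2 : 0 ≠ j := by omega
    simp [root, sAct_zero_xVar hi, sAct_succ_xVar hj, a1, a2]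
  · have a2 : j ≠ i := by omega
    have a3 : j ≠ i + 1 := by omega
    have a4 : j + 1 ≠ i := by omega
    have a5 : i ≠ j + 1 := by omega
    simp [root, sAct_succ_xVar hi, sAct_succ_xVar hj, a2, a3, a4, a5, a2.symm, a3.symm]

/-- The operator `∂'_k`, zero for `k ≥ n`, as an additive map. -/
def bDiff (n k : ℕ) : Poly n →+ Poly n where
  toFun f := if h : k < n then divDiff' ⟨k, h⟩ f else 0
  map_zero' := by
    by_cases h : k < n
    · have : divDiff ⟨k, h⟩ (0 : Poly n) = 0 := (eq_divDiff _ _ _ (by simp)).symm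
      simp [h, divDiff', this]
    · simp [h]
  map_add' f g := by
    by_cases h : k < n
    · have : divDiff ⟨k, h⟩ (f + g) = divDiff ⟨k, h⟩ f + divDiff ⟨k, h⟩ g :=
        (eq_divDiff _ _ _ (by
          rw [mul_add, denom_mul_divDiff, denom_mul_divDiff, map_add]; ring)).symm
      simp only [h, dif_pos, divDiff', this]
      split_ifs <;> ring
    · simp [h]

theorem bDiff_fin (i : Fin n) (f : Poly n) : bDiff n i f = divDiff' i f := by
  simp [bDiff]

theorem root_mul_bDiff {k : ℕ} (h : k < n) (f : Poly n) :
    root n k * bDiff n k f = f - sAct n k f := by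
  rw [root_eq_denom h, sAct_of_lt h, ← denom_mul_divDiff]
  simp only [bDiff, AddMonoidHom.coe_mk, ZeroHom.coe_mk, h, dif_pos, divDiff']
  split_ifs <;> ring

theorem bDiff_eq_of_root_mul {k : ℕ} (h : k < n) {f g : Poly n}
    (hg : root n k * g = f - sAct n k f) : bDiff n k f = g :=
  mul_left_cancel₀ (root_ne_zero h) (by rw [root_mul_bDiff h, hg])

theorem bDiff_mul (k : ℕ) (f g : Poly n) :
    bDiff n k (f * g) = bDiff n k f * sAct n k g + f * bDiff n k g := by
  by_cases h : k < n
  · apply bDiff_eq_of_root_mul h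
    rw [map_mul]
    linear_combination (sAct n k g) * root_mul_bDiff h f + f * root_mul_bDiff h g
  · simp [bDiff, h]

theorem bDiff_of_sAct {k : ℕ} {f : Poly n} (hf : sAct n k f = f) : bDiff n k f = 0 := by
  by_cases h : k < n
  · apply bDiff_eq_of_root_mul h
    rw [hf]; ring
  · simp [bDiff, h]

theorem bDiff_mul_left {k : ℕ} {f : Poly n} (hf : sAct n k f = f) (g : Poly n) :
    bDiff n k (f * g) = f * bDiff n k g := by
  rw [bDiff_mul, bDiff_of_sAct hf, zero_mul, zero_add]

theorem sAct_bDiff_comm {i j : ℕ} (hij : i + 1 < j) (f : Poly n) :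
    sAct n j (bDiff n i f) = bDiff n i (sAct n j f) := by
  by_cases hj : j < n
  swap
  · simp [sAct, hj]
  have hi : i < n := by omega
  symm
  apply bDiff_eq_of_root_mul hi
  have := congrArg (sAct n j) (root_mul_bDiff hi f)
  rwa [map_mul, map_sub, (sAct_root_of_lt hij hj).2, ← sAct_comm_of_lt hij] at this

/-! ### Braid relations -/

theorem bDiff_comm {i j : ℕ} (hij : i + 1 < j) (hj : j < n) (f : Poly n) :
    bDiff n i (bDiff n j f) = bDiff n j (bDiff n i f) := by
  have hi : i < n := by omega
  exact braid_two (sAct n i) (sAct n j) (root n i) (root n j) (root_ne_zero hi) (root_ne_zero hj)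
    (sAct_root_of_lt hij hj).1 (sAct_root_of_lt hij hj).2 (sAct_comm_of_lt hij) f _ _ _ _
    (root_mul_bDiff hj _) (root_mul_bDiff hi _) (root_mul_bDiff hi _) (root_mul_bDiff hj _)

theorem bDiff_braid_three {i : ℕ} (hi : i + 2 < n) (f : Poly n) :
    bDiff n (i + 1) (bDiff n (i + 2) (bDiff n (i + 1) f)) =
      bDiff n (i + 2) (bDiff n (i + 1) (bDiff n (i + 2) f)) := by
  have hi' : i + 1 < n := by omega
  have e1 := sAct_succ_xVar (n := n) (k := i + 1) hi
  have e2 := sAct_succ_xVar (n := n) (k := i) hi'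
  refine braid_three (sAct n (i + 1)) (sAct n (i + 2)) (root n (i + 1)) (root n (i + 2))
    (root_ne_zero hi') (root_ne_zero hi) ?_ (sAct_root_self hi') ?_ ?_ (sAct_root_self hi)
    (sAct_sAct _) (sAct_sAct _) (sAct_braid_three hi) f _ _ _ _ _ _
    (root_mul_bDiff hi' _) (root_mul_bDiff hi _) (root_mul_bDiff hi' _)
    (root_mul_bDiff hi _) (root_mul_bDiff hi' _) (root_mul_bDiff hi _)
  · have : root n (i + 1) + root n (i + 2) = xVar n (i + 2) - xVar n i := by simp [root]
    rw [this]
    exact sub_ne_zero.2 (xVar_ne hi (by omega) (by omega))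
  · simp [root, e2]
  · have a1 : i ≠ i + 1 + 1 := by omega
    simp [root, e1, a1]

theorem bDiff_braid_four (hn : 1 < n) (f : Poly n) :
    bDiff n 0 (bDiff n 1 (bDiff n 0 (bDiff n 1 f))) =
      bDiff n 1 (bDiff n 0 (bDiff n 1 (bDiff n 0 f))) := by
  have h0 : 0 < n := by omega
  have e1 := sAct_succ_xVar (n := n) (k := 0) hn
  have e2 := sAct_zero_xVar (n := n) h0
  refine braid_four (sAct n 0) (sAct n 1) (root n 0) (root n 1)
    (root_ne_zero h0) (root_ne_zero hn) ?_ ?_ (sAct_root_self h0) ?_ ?_ (sAct_root_self hn)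
    (sAct_sAct _) (sAct_sAct _) (sAct_braid_four hn) f _ _ _ _ _ _ _ _
    (root_mul_bDiff hn _) (root_mul_bDiff h0 _) (root_mul_bDiff hn _)
    (root_mul_bDiff h0 _) (root_mul_bDiff h0 _) (root_mul_bDiff hn _)
    (root_mul_bDiff h0 _) (root_mul_bDiff hn _)
  · have : root n 0 + root n 1 = xVar n 1 := by simp [root]
    rw [this]
    simp only [xVar, hn, dif_pos]
    exact MvPolynomial.X_ne_zero _
  · have : root n 1 + 2 * root n 0 = xVar n 1 + xVar n 0 := by simp [root]; ring
    rw [this]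
    intro h
    -- Applying s_0 to x_2 = -x_1 would give x_2 = x_1.
    have h' := congrArg (sAct n 0) (eq_neg_of_add_eq_zero_left h)
    rw [map_neg, e2, e2] at h'
    simp only [one_ne_zero, if_false, if_true, neg_neg] at h'
    exact xVar_ne hn h0 (by omega) h'
  · simp [root, e2]; ring
  · simp [root, e1]

/-! ### Length of signed permutations -/

theorem natAbs_oneLine (v : SignedPerm n) (i : Fin n) : (oneLine v i).natAbs = v.right i + 1 := by
  unfold oneLine
  rcases Int.units_eq_one_or (v.left (v.right i)) with h | h <;> rw [h] <;> simp <;> omega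

theorem oneLine_ne_zero (v : SignedPerm n) (i : Fin n) : oneLine v i ≠ 0 := by
  intro h
  have := natAbs_oneLine v i
  rw [h] at this
  simp at this

theorem natAbs_oneLine_injective (v : SignedPerm n) {i j : Fin n}
    (h : (oneLine v i).natAbs = (oneLine v j).natAbs) : i = j := by
  rw [natAbs_oneLine, natAbs_oneLine] at h
  exact v.right.injective (Fin.ext (by omega))

theorem oneLine_injective : Function.Injective (oneLine : SignedPerm n → Fin n → ℤ) := by
  intro u v h
  have hr : u.right = v.right := Equiv.ext fun i => Fin.ext (by
    have := natAbs_oneLine u i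
    rw [h, natAbs_oneLine v i] at this
    omega)
  refine SemidirectProduct.ext (funext fun j => ?_) hr
  obtain ⟨i, rfl⟩ := u.right.surjective j
  have := congrFun h i
  unfold oneLine at this
  rw [← hr] at this
  have h2 : ((u.right i : ℕ) + 1 : ℤ) ≠ 0 := by omega
  exact Units.ext (mul_right_cancel₀ h2 this)

/-- The contribution of a pair of entries to the length. -/
def pairLen (a b : ℤ) : ℕ := (if b < a then 1 else 0) + (if a + b < 0 then 1 else 0)

/-- The length of a signed permutation, as a function of its one-line notation. -/
def lineLen (a : Fin n → ℤ) : ℕ :=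
  ∑ i, ∑ j, (if i < j then pairLen (a i) (a j) else 0) + ∑ i, if a i < 0 then 1 else 0

theorem prev_lt {k : Fin n} (hk : (k : ℕ) ≠ 0) : prev k < k := by
  rw [Fin.lt_def]; simp only [prev]; omega

/-- After reindexing by the transposition, the order of positions changes only for the pair `prev
k`, `k`. Its sum condition is symmetric, and its inversion condition goes from false to true. -/
theorem lineLen_swap (a : Fin n → ℤ) {k : Fin n} (hk : (k : ℕ) ≠ 0) (h : a (prev k) < a k) :
    lineLen (fun j => a (Equiv.swap (prev k) k j)) = lineLen a + 1 := by
  have hp := prev_lt hk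
  set τ := Equiv.swap (prev k) k with hτ
  have hτi : ∀ i, τ (τ i) = i := fun i => Equiv.swap_apply_self _ _ i
  have h1 : ∑ i, ∑ j, (if i < j then pairLen (a (τ i)) (a (τ j)) else 0) =
      ∑ i, ∑ j, (if τ i < τ j then pairLen (a i) (a j) else 0) := by
    rw [← Equiv.sum_comp τ]
    refine Finset.sum_congr rfl fun i _ => ?_
    rw [← Equiv.sum_comp τ]
    simp only [hτi]
  have h2 : ∑ i, (if a (τ i) < 0 then 1 else 0) = ∑ i, if a i < 0 then 1 else 0 :=
    Equiv.sum_comp τ (fun i => if a i < 0 then 1 else 0)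
  have key : ∀ i j, (if τ i < τ j then pairLen (a i) (a j) else 0) +
      (if i = prev k then if j = k then pairLen (a (prev k)) (a k) else 0 else 0) =
      (if i < j then pairLen (a i) (a j) else 0) +
      (if i = k then if j = prev k then pairLen (a k) (a (prev k)) else 0 else 0) := by
    intro i j
    have hval : ∀ i, ((τ i : Fin n) : ℕ) =
        if i = prev k then (k : ℕ) else if i = k then (k : ℕ) - 1 else (i : ℕ) := by
      intro i
      rw [hτ]
      split_ifs with h1 h2
      · rw [h1, Equiv.swap_apply_left]
      · rw [h2, Equiv.swap_apply_right]; rfl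
      · rw [Equiv.swap_apply_of_ne_of_ne h1 h2]
    have hpk : (prev k : ℕ) = (k : ℕ) - 1 := rfl
    simp only [Fin.lt_def, hval]
    by_cases i1 : i = prev k
    · subst i1
      by_cases j2 : j = k
      · subst j2
        simp [hp.ne', hp.ne, hpk]
        split_ifs <;> omega
      · have : (j : ℕ) ≠ k := fun h => j2 (Fin.ext h)
        by_cases j1 : j = prev k
        · simp [j1, hp.ne]
        · have : (j : ℕ) ≠ (k : ℕ) - 1 := fun h => j1 (Fin.ext h)
          have e : ((k : ℕ) < j) ↔ (k : ℕ) - 1 < j := by omega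
          simp [j1, j2, hp.ne, hpk, e]
    · by_cases i2 : i = k
      · subst i2
        by_cases j1 : j = prev i
        · subst j1
          simp [hp.ne', hpk]
          split_ifs <;> omega
        · by_cases j2 : j = i
          · simp [j2, hp.ne']
          · have : (j : ℕ) ≠ i := fun h => j2 (Fin.ext h)
            have : (j : ℕ) ≠ (i : ℕ) - 1 := fun h => j1 (Fin.ext h)
            have e : ((i : ℕ) - 1 < j) ↔ (i : ℕ) < j := by omega
            simp [j1, j2, hp.ne', e]
      · have b1 : (i : ℕ) ≠ k := fun h => i2 (Fin.ext h)
        have b2 : (i : ℕ) ≠ (k : ℕ) - 1 := fun h => i1 (Fin.ext h)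
        by_cases j1 : j = prev k
        · have e : ((i : ℕ) < k) ↔ (i : ℕ) < (k : ℕ) - 1 := by omega
          simp [i1, i2, j1, hpk, e]
        · by_cases j2 : j = k
          · have e : ((i : ℕ) < (k : ℕ) - 1) ↔ (i : ℕ) < (k : ℕ) := by omega
            simp [i1, i2, j2, hp.ne', e]
          · simp [i1, i2, j1, j2]
  have hsum := Finset.sum_congr (rfl : (Finset.univ : Finset (Fin n)) = _) fun i _ =>
    Finset.sum_congr (rfl : (Finset.univ : Finset (Fin n)) = _) fun j _ => key i j
  simp only [Finset.sum_add_distrib, Finset.sum_ite_eq', Finset.sum_ite_irrel,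
    Finset.sum_const_zero, Finset.mem_univ, if_true] at hsum
  have hg : pairLen (a k) (a (prev k)) = pairLen (a (prev k)) (a k) + 1 := by
    unfold pairLen
    rw [if_pos h, if_neg h.not_gt, add_comm (a k)]
    omega
  unfold lineLen
  rw [h1, h2]
  omega

/-- Negating the first entry exchanges the two conditions counted by `pairLen` for each pair
containing it, so only the number of negative entries grows. -/
theorem lineLen_neg (a : Fin n → ℤ) {k : Fin n} (hk : (k : ℕ) = 0) (h : 0 < a k) :
    lineLen (fun j => if j = k then -a j else a j) = lineLen a + 1 := by
  have h1 : ∀ i j, (if i < j then pairLen (if i = k then -a i else a i)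
      (if j = k then -a j else a j) else 0) = if i < j then pairLen (a i) (a j) else 0 := by
    intro i j
    split_ifs with h1 h2 h3 h3 <;> try rfl
    · subst h2; subst h3; exact absurd h1 (lt_irrefl _)
    · unfold pairLen
      have e1 : (a j < -a i) ↔ a i + a j < 0 := by omega
      have e2 : (-a i + a j < 0) ↔ a j < a i := by omega
      simp only [e1, e2]
      omega
    · subst h3
      rw [Fin.lt_def] at h1
      omega
  have h2 : ∀ i, (if (if i = k then -a i else a i) < 0 then 1 else 0) =
      (if a i < 0 then 1 else 0) + if i = k then 1 else 0 := by
    intro i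
    split_ifs with h1 h2 h3 <;> subst_vars <;> first | rfl | omega
  unfold lineLen
  simp only [h1, h2, Finset.sum_add_distrib, Finset.sum_ite_eq', Finset.mem_univ, if_true]
  omega

/-- The length of a signed permutation. -/
def len (v : SignedPerm n) : ℕ := lineLen (oneLine v)

/-- `s_i` is an ascent of `v`. -/
def IsAscent (v : SignedPerm n) (i : Fin n) : Prop :=
  if (i : ℕ) = 0 then 0 < oneLine v i else oneLine v (prev i) < oneLine v i

theorem simple_mul_self (i : Fin n) : simple i * simple i = 1 := by
  apply oneLine_injective
  funext j
  have h := one_mul (simple i)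
  by_cases hi : (i : ℕ) = 0
  · rw [oneLine_mul_simple_zero _ _ hi, ← h, oneLine_mul_simple_zero _ _ hi]
    split_ifs <;> simp
  · rw [oneLine_mul_simple_pos _ _ hi, ← h, oneLine_mul_simple_pos _ _ hi, Equiv.swap_apply_self]

theorem mul_simple_mul_simple (v : SignedPerm n) (i : Fin n) :
    v * simple i * simple i = v := by
  rw [mul_assoc, simple_mul_self, mul_one]

theorem simple_inv (i : Fin n) : (simple i)⁻¹ = simple i :=
  inv_eq_of_mul_eq_one_right (simple_mul_self i)

theorem len_mul_simple (v : SignedPerm n) (i : Fin n) (h : IsAscent v i) :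
    len (v * simple i) = len v + 1 := by
  unfold IsAscent at h
  unfold len
  split_ifs at h with hi
  · rw [← lineLen_neg _ hi h]
    congr 1
    funext j
    exact oneLine_mul_simple_zero v i hi j
  · rw [← lineLen_swap _ hi h]
    congr 1
    funext j
    exact oneLine_mul_simple_pos v i hi j

theorem isAscent_mul_simple (v : SignedPerm n) (i : Fin n) (h : ¬ IsAscent v i) :
    IsAscent (v * simple i) i := by
  unfold IsAscent at h ⊢
  split_ifs at h ⊢ with hi
  · rw [oneLine_mul_simple_zero _ _ hi, if_pos rfl]
    have := oneLine_ne_zero v i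
    omega
  · rw [oneLine_mul_simple_pos _ _ hi, oneLine_mul_simple_pos _ _ hi, Equiv.swap_apply_left,
      Equiv.swap_apply_right]
    refine lt_of_le_of_ne (not_lt.1 h) fun h' => ?_
    exact (prev_lt hi).ne' (natAbs_oneLine_injective v (by rw [h']))

theorem len_of_not_isAscent (v : SignedPerm n) (i : Fin n) (h : ¬ IsAscent v i) :
    len v = len (v * simple i) + 1 := by
  have := len_mul_simple _ i (isAscent_mul_simple v i h)
  rwa [mul_simple_mul_simple] at this

theorem len_one : len (1 : SignedPerm n) = 0 := by
  have h : ∀ i : Fin n, oneLine (1 : SignedPerm n) i = (i : ℕ) + 1 := fun i => by simp [oneLine]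
  unfold len lineLen
  rw [Nat.add_eq_zero_iff]
  constructor
  · refine Finset.sum_eq_zero fun i _ => Finset.sum_eq_zero fun j _ => ?_
    split_ifs with hij
    · rw [Fin.lt_def] at hij
      unfold pairLen
      rw [h, h, if_neg (by omega), if_neg (by omega), add_zero]
    · rfl
  · refine Finset.sum_eq_zero fun i _ => ?_
    rw [h, if_neg (by omega)]

/-- The entries are then positive and increasing, so the underlying permutation is an increasing
bijection of `Fin n`. -/
theorem eq_one_of_isAscent (v : SignedPerm n) (h : ∀ i, IsAscent v i) : v = 1 := by
  have hmono : StrictMono (oneLine v) := by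
    rcases n with _ | n
    · exact fun i => i.elim0
    · rw [Fin.strictMono_iff_lt_succ]
      intro i
      have := h i.succ
      rw [IsAscent, if_neg (by simp)] at this
      have e : prev i.succ = i.castSucc := Fin.ext (by simp [prev])
      rwa [e] at this
  have hpos : ∀ i, 0 < oneLine v i := by
    intro i
    have h0 := h ⟨0, i.pos⟩
    rw [IsAscent, if_pos rfl] at h0
    exact lt_of_lt_of_le h0 (hmono.monotone (Nat.zero_le _))
  have hval : ∀ i, oneLine v i = (v.right i : ℕ) + 1 := fun i => by
    have := natAbs_oneLine v i
    have := hpos i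
    omega
  have hr : v.right = 1 := by
    have : StrictMono v.right := fun i j hij => by
      have := hmono hij
      rw [hval, hval] at this
      rw [Fin.lt_def]
      omega
    exact Equiv.ext fun i => congrFun ((this.range_inj strictMono_id).1
      (by rw [v.right.surjective.range_eq, Function.surjective_id.range_eq])) i
  apply oneLine_injective
  funext i
  rw [hval, hr]
  simp [oneLine]

/-- The inverse appears because ascents concern right multiplication, whereas operators are composed
by adding letters on the left of a word. -/
theorem len_le_length (a : List (Fin n)) : len ((a.map simple).prod)⁻¹ ≤ a.length := by
  induction a with
  | nil => simp [len_one]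
  | cons i a ih =>
    rw [List.map_cons, List.prod_cons, mul_inv_rev, simple_inv, List.length_cons]
    by_cases h : IsAscent ((a.map simple).prod)⁻¹ i
    · rw [len_mul_simple _ _ h]; omega
    · have := len_of_not_isAscent _ _ h
      omega

theorem exists_word_length_eq_len (v : SignedPerm n) :
    ∃ a : List (Fin n), (a.map simple).prod = v⁻¹ ∧ a.length = len v := by
  induction hr : len v generalizing v with
  | zero =>
    refine ⟨[], ?_, rfl⟩
    rw [eq_one_of_isAscent v]
    · simp
    · intro i
      by_contra h
      have := len_of_not_isAscent _ _ h
      omega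
  | succ r ih =>
    have : ∃ i, ¬ IsAscent v i := by
      by_contra! h
      rw [eq_one_of_isAscent v h, len_one] at hr
      omega
    obtain ⟨i, hi⟩ := this
    obtain ⟨a, ha, hl⟩ := ih (v * simple i) (by have := len_of_not_isAscent _ _ hi; omega)
    refine ⟨i :: a, ?_, by simp [hl]⟩
    rw [List.map_cons, List.prod_cons, ha, mul_inv_rev, simple_inv, ← mul_assoc, simple_mul_self,
      one_mul]

theorem isReducedWord_length {a : List (Fin n)} {v : SignedPerm n} (h : IsReducedWord a v⁻¹) :
    a.length = len v := by
  obtain ⟨b, hb, hl⟩ := exists_word_length_eq_len v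
  refine le_antisymm (hl ▸ h.2 b hb) ?_
  have := len_le_length a
  rwa [h.1, inv_inv] at this

/-! ### Independence of the reduced decomposition -/

theorem divDiffWord_append (a b : List (Fin n)) (f : Poly n) :
    divDiffWord (a ++ b) f = divDiffWord a (divDiffWord b f) := by
  simp [divDiffWord, List.foldr_append]

/-- The data of a braid relation that starts with `s_i` on one side and `s_j` on the other. -/
def BraidPair (i j : Fin n) : Prop :=
  ∃ p q : List (Fin n), ((i :: p).map simple).prod = ((j :: q).map simple).prod ∧
    p.length = q.length ∧
    (∀ f : Poly n, divDiffWord (i :: p) f = divDiffWord (j :: q) f) ∧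
    ∀ v : SignedPerm n, ¬ IsAscent v i → ¬ IsAscent v j →
      len v = len (v * ((i :: p).map simple).prod) + (p.length + 1)

theorem BraidPair.symm {i j : Fin n} (h : BraidPair i j) : BraidPair j i := by
  obtain ⟨p, q, h1, h2, h3, h4⟩ := h
  refine ⟨q, p, h1.symm, h2.symm, fun f => (h3 f).symm, fun v hj hi => ?_⟩
  rw [← h1, ← h2]
  exact h4 v hi hj

theorem simple_mul_comm {i j : Fin n} (hij : (i : ℕ) + 1 < j) :
    simple i * simple j = simple j * simple i := by
  have hj : (j : ℕ) ≠ 0 := by omega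
  apply oneLine_injective
  funext k
  rw [← one_mul (simple i), ← one_mul (simple j), ← mul_assoc, ← mul_assoc, mul_one, mul_one]
  have d1 : prev j ≠ i := fun h => by have := congrArg Fin.val h; simp only [prev] at this; omega
  have d2 : j ≠ i := fun h => by have := congrArg Fin.val h; omega
  by_cases hi : (i : ℕ) = 0
  · rw [oneLine_mul_simple_pos _ _ hj, oneLine_mul_simple_zero _ _ hi,
      oneLine_mul_simple_zero _ _ hi, oneLine_mul_simple_pos _ _ hj]
    have : Equiv.swap (prev j) j k = i ↔ k = i := by
      rw [Equiv.swap_apply_eq_iff, Equiv.swap_apply_of_ne_of_ne d1.symm d2.symm]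
    simp only [this]
  · have d3 : prev j ≠ prev i := fun h => by
      have := congrArg Fin.val h; simp only [prev] at this; omega
    have d4 : j ≠ prev i := fun h => by
      have := congrArg Fin.val h; simp only [prev] at this; omega
    rw [oneLine_mul_simple_pos _ _ hj, oneLine_mul_simple_pos _ _ hi,
      oneLine_mul_simple_pos _ _ hi, oneLine_mul_simple_pos _ _ hj]
    congr 1
    by_cases k1 : k = i
    · subst k1
      rw [Equiv.swap_apply_of_ne_of_ne d1.symm d2.symm, Equiv.swap_apply_right,
        Equiv.swap_apply_of_ne_of_ne d3.symm d4.symm]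
    by_cases k2 : k = prev i
    · subst k2
      rw [Equiv.swap_apply_of_ne_of_ne d3.symm d4.symm, Equiv.swap_apply_left,
        Equiv.swap_apply_of_ne_of_ne d1.symm d2.symm]
    rw [Equiv.swap_apply_of_ne_of_ne k2 k1]
    by_cases k3 : k = j
    · subst k3
      rw [Equiv.swap_apply_right, Equiv.swap_apply_of_ne_of_ne d3 d1]
    by_cases k4 : k = prev j
    · subst k4
      rw [Equiv.swap_apply_left, Equiv.swap_apply_of_ne_of_ne d4 d2]
    rw [Equiv.swap_apply_of_ne_of_ne k4 k3, Equiv.swap_apply_of_ne_of_ne k2 k1]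

theorem braidPair_of_lt {i j : Fin n} (hij : (i : ℕ) + 1 < j) : BraidPair i j := by
  have hj : (j : ℕ) ≠ 0 := by omega
  have d1 : prev j ≠ i := fun h => by have := congrArg Fin.val h; simp only [prev] at this; omega
  have d2 : j ≠ i := fun h => by have := congrArg Fin.val h; omega
  refine ⟨[j], [i], ?_, rfl, ?_, ?_⟩
  · simp [simple_mul_comm hij]
  · intro f
    simp only [divDiffWord, List.foldr_cons, List.foldr_nil, ← bDiff_fin]
    exact bDiff_comm hij j.2 f
  · intro v hi' hj'
    simp only [List.map_cons, List.map_nil, List.prod_cons, List.prod_nil, mul_one, ← mul_assoc]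
    rw [len_of_not_isAscent v i hi', len_of_not_isAscent (v * simple i) j]
    · rfl
    · unfold IsAscent at hj' ⊢
      rw [if_neg hj] at hj' ⊢
      by_cases hi : (i : ℕ) = 0
      · rwa [oneLine_mul_simple_zero _ _ hi, oneLine_mul_simple_zero _ _ hi, if_neg d1, if_neg d2]
      · have d3 : prev j ≠ prev i := fun h => by
          have := congrArg Fin.val h; simp only [prev] at this; omega
        have d4 : j ≠ prev i := fun h => by
          have := congrArg Fin.val h; simp only [prev] at this; omega
        rwa [oneLine_mul_simple_pos _ _ hi, oneLine_mul_simple_pos _ _ hi,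
          Equiv.swap_apply_of_ne_of_ne d3 d1, Equiv.swap_apply_of_ne_of_ne d4 d2]

/-- Two adjacent descents make three consecutive entries decrease; the braid word sorts them, and
each of its three letters removes one inversion. -/
theorem braidPair_of_eq_succ {i j : Fin n} (hi : (i : ℕ) ≠ 0) (hij : (j : ℕ) = i + 1) :
    BraidPair i j := by
  have hj : (j : ℕ) ≠ 0 := by omega
  have hp : prev j = i := Fin.ext (by simp [prev, hij])
  have d1 : i ≠ j := fun h => by have := congrArg Fin.val h; omega
  have d2 : prev i ≠ i := (prev_lt hi).ne
  have d3 : prev i ≠ j := fun h => by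
    have := congrArg Fin.val h; simp only [prev] at this; omega
  refine ⟨[j, i], [i, j], ?_, rfl, ?_, ?_⟩
  · simp only [List.map_cons, List.map_nil, List.prod_cons, List.prod_nil, mul_one, simple, hi, hj,
      if_false, hp]
    simp only [← map_mul]
    congr 1
    rw [← mul_assoc, ← mul_assoc, Equiv.swap_mul_swap_mul_swap d2 d3,
      Equiv.swap_comm (prev i) i, Equiv.swap_comm i j,
      Equiv.swap_mul_swap_mul_swap d1.symm d3.symm, Equiv.swap_comm]
  · intro f
    obtain ⟨i, hi'⟩ := i
    obtain ⟨j, hj'⟩ := j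
    simp only at hi hij
    subst hij
    obtain ⟨k, rfl⟩ : ∃ k, i = k + 1 := ⟨i - 1, by omega⟩
    simp only [divDiffWord, List.foldr_cons, List.foldr_nil, ← bDiff_fin]
    exact bDiff_braid_three hj' f
  · intro v hi' hj'
    simp only [List.map_cons, List.map_nil, List.prod_cons, List.prod_nil, mul_one, ← mul_assoc]
    unfold IsAscent at hi' hj'
    rw [if_neg hi] at hi'
    rw [if_neg hj, hp] at hj'
    have e : ¬ oneLine v (prev i) < oneLine v j := by omega
    rw [len_of_not_isAscent v i, len_of_not_isAscent (v * simple i) j,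
      len_of_not_isAscent (v * simple i * simple j) i]
    · rfl
    · unfold IsAscent
      rw [if_neg hi, oneLine_mul_simple_pos _ _ hj, oneLine_mul_simple_pos _ _ hj,
        oneLine_mul_simple_pos _ _ hi, oneLine_mul_simple_pos _ _ hi, hp, Equiv.swap_apply_left,
        Equiv.swap_apply_of_ne_of_ne d2 d3, Equiv.swap_apply_left,
        Equiv.swap_apply_of_ne_of_ne d3.symm d1.symm]
      exact hj'
    · unfold IsAscent
      rw [if_neg hj, hp, oneLine_mul_simple_pos _ _ hi, oneLine_mul_simple_pos _ _ hi,
        Equiv.swap_apply_right, Equiv.swap_apply_of_ne_of_ne d3.symm d1.symm]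
      exact e
    · unfold IsAscent
      rwa [if_neg hi]

/-- Descents at both generators mean that the first two entries satisfy b < a < 0. The four letters
of the braid word take (a, b) through (-a, b), (b, -a), (-b, -a) to (-a, -b), each step being a
descent. -/
theorem braidPair_zero_one {i j : Fin n} (hi : (i : ℕ) = 0) (hij : (j : ℕ) = 1) :
    BraidPair i j := by
  have hj : (j : ℕ) ≠ 0 := by omega
  have hp : prev j = i := Fin.ext (by simp [prev, hij, hi])
  have d1 : i ≠ j := fun h => by have := congrArg Fin.val h; omega
  refine ⟨[j, i, j], [i, j, i], ?_, rfl, ?_, ?_⟩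
  · simp only [List.map_cons, List.map_nil, List.prod_cons, List.prod_nil, mul_one]
    apply oneLine_injective
    funext k
    have e1 : simple i * (simple j * (simple i * simple j)) =
      1 * simple i * simple j * simple i * simple j := by simp only [mul_assoc, one_mul]
    have e2 : simple j * (simple i * (simple j * simple i)) =
      1 * simple j * simple i * simple j * simple i := by simp only [mul_assoc, one_mul]
    rw [e1, e2]
    simp only [oneLine_mul_simple_pos _ _ hj, oneLine_mul_simple_zero _ _ hi, hp]
    by_cases k1 : k = i
    · subst k1
      simp [d1.symm]
    by_cases k2 : k = j
    · subst k2
      simp [d1.symm]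
    simp [k1, k2, Equiv.swap_apply_of_ne_of_ne]
  · intro f
    simp only [divDiffWord, List.foldr_cons, List.foldr_nil, ← bDiff_fin, hi, hij]
    exact bDiff_braid_four (by have := j.2; omega) f
  · intro v hi' hj'
    simp only [List.map_cons, List.map_nil, List.prod_cons, List.prod_nil, mul_one, ← mul_assoc]
    unfold IsAscent at hi' hj'
    rw [if_pos hi] at hi'
    rw [if_neg hj, hp] at hj'
    have n1 := oneLine_ne_zero v i
    have n2 := oneLine_ne_zero v j
    have n3 : oneLine v i ≠ oneLine v j := fun h =>
      d1 (natAbs_oneLine_injective v (by rw [h]))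
    have z : oneLine (v * simple i) i = - oneLine v i ∧
        oneLine (v * simple i) j = oneLine v j := by
      simp [oneLine_mul_simple_zero _ _ hi, d1.symm]
    have z1 : oneLine (v * simple i * simple j) i = oneLine v j ∧
        oneLine (v * simple i * simple j) j = - oneLine v i := by
      simp [oneLine_mul_simple_pos _ _ hj, hp, z]
    have z2 : oneLine (v * simple i * simple j * simple i) i = - oneLine v j ∧
        oneLine (v * simple i * simple j * simple i) j = - oneLine v i := by
      rw [oneLine_mul_simple_zero _ _ hi, oneLine_mul_simple_zero _ _ hi, if_pos rfl,
        if_neg d1.symm, z1.1, z1.2]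
      exact ⟨rfl, rfl⟩
    rw [len_of_not_isAscent v i, len_of_not_isAscent (v * simple i) j,
      len_of_not_isAscent (v * simple i * simple j) i,
      len_of_not_isAscent (v * simple i * simple j * simple i) j]
    · rfl
    · unfold IsAscent
      rw [if_neg hj, hp, z2.1, z2.2]
      omega
    · unfold IsAscent
      rw [if_pos hi, z1.1]
      omega
    · unfold IsAscent
      rw [if_neg hj, hp, z.1, z.2]
      omega
    · unfold IsAscent
      rwa [if_pos hi]

theorem braidPair {i j : Fin n} (h : i ≠ j) : BraidPair i j := by
  have aux : ∀ i j : Fin n, i < j → BraidPair i j := by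
    intro i j hij
    rw [Fin.lt_def] at hij
    by_cases h1 : (i : ℕ) + 1 < j
    · exact braidPair_of_lt h1
    by_cases hi : (i : ℕ) = 0
    · exact braidPair_zero_one hi (by omega)
    · exact braidPair_of_eq_succ hi (by omega)
  rcases lt_or_gt_of_ne h with h | h
  · exact aux i j h
  · exact (aux j i h).symm

/-- Matsumoto's argument, by induction on length. If the first letters i, j differ, both are
descents of v, so there are reduced words that begin with the two sides of the braid relation and
share a tail c. Each given word agrees by induction with the one having the same first letter, and
the braid relation joins the two. -/
theorem divDiffWord_eq_of_prod_eq (v : SignedPerm n) (a b : List (Fin n))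
    (ha : (a.map simple).prod = v⁻¹) (hb : (b.map simple).prod = v⁻¹)
    (hal : a.length = len v) (hbl : b.length = len v) (f : Poly n) :
    divDiffWord a f = divDiffWord b f := by
  induction hr : len v generalizing v a b with
  | zero =>
    rw [hr, List.length_eq_zero_iff] at hal hbl
    rw [hal, hbl]
  | succ r ih =>
    rcases a with _ | ⟨i, a⟩
    · simp at hal; omega
    rcases b with _ | ⟨j, b⟩
    · simp at hbl; omega
    rw [List.map_cons, List.prod_cons] at ha hb
    rw [List.length_cons] at hal hbl
    have tail : ∀ (i : Fin n) (a : List (Fin n)), simple i * (a.map simple).prod = v⁻¹ →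
        (a.map simple).prod = (v * simple i)⁻¹ := by
      intro i a h
      rw [mul_inv_rev, ← h, simple_inv, ← mul_assoc, simple_mul_self, one_mul]
    have desc : ∀ (i : Fin n) (a : List (Fin n)), simple i * (a.map simple).prod = v⁻¹ →
        a.length + 1 = len v → ¬ IsAscent v i := by
      intro i a h hl h'
      have h1 := len_mul_simple v i h'
      have h2 := len_le_length a
      rw [tail i a h, inv_inv] at h2
      omega
    have hi := desc i a ha hal
    have hj := desc j b hb hbl
    have li := len_of_not_isAscent v i hi
    have lj := len_of_not_isAscent v j hj
    by_cases hij : i = j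
    · subst hij
      have := ih (v * simple i) a b (tail i a ha) (tail i b hb) (by omega) (by omega) (by omega)
      change divDiff' i (divDiffWord a f) = divDiff' i (divDiffWord b f)
      rw [this]
    · obtain ⟨p, q, h1, h2, h3, h4⟩ := braidPair hij
      have hl := h4 v hi hj
      obtain ⟨c, hc, hcl⟩ := exists_word_length_eq_len (v * ((i :: p).map simple).prod)
      have pc : simple i * ((p ++ c).map simple).prod = v⁻¹ := by
        rw [List.map_append, List.prod_append, hc, mul_inv_rev, List.map_cons, List.prod_cons]
        group
      have qc : simple j * ((q ++ c).map simple).prod = v⁻¹ := by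
        rw [List.map_append, List.prod_append, hc, h1, mul_inv_rev, List.map_cons, List.prod_cons]
        group
      have ea := ih (v * simple i) a (p ++ c) (tail i a ha) (tail i _ pc) (by omega)
        (by rw [List.length_append]; omega) (by omega)
      have eb := ih (v * simple j) b (q ++ c) (tail j b hb) (tail j _ qc) (by omega)
        (by rw [List.length_append]; omega) (by omega)
      change divDiff' i (divDiffWord a f) = divDiff' j (divDiffWord b f)
      rw [ea, eb]
      have := h3 (divDiffWord c f)
      rw [← divDiffWord_append, ← divDiffWord_append] at this
      exact this

theorem reducedWord_spec (w : SignedPerm n) : IsReducedWord (reducedWord w) w :=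
  (exists_isReducedWord w).choose_spec

theorem divDiffPerm_one (f : Poly n) : divDiffPerm 1 f = f := by
  have h := reducedWord_spec (1 : SignedPerm n)
  have : (reducedWord (1 : SignedPerm n)).length ≤ 0 := h.2 [] rfl
  rw [divDiffPerm, List.length_eq_zero_iff.1 (Nat.le_zero.1 this)]
  rfl

/-- At an ascent, prefixing i to a reduced word of v⁻¹ gives a reduced word, which may replace the
chosen one. -/
theorem divDiffPerm_mul_simple (v : SignedPerm n) (i : Fin n) (h : IsAscent v i) (f : Poly n) :
    divDiffPerm (v * simple i)⁻¹ f = bDiff n i (divDiffPerm v⁻¹ f) := by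
  have h1 := reducedWord_spec v⁻¹
  have h2 := reducedWord_spec (v * simple i)⁻¹
  rw [bDiff_fin]
  refine divDiffWord_eq_of_prod_eq (v * simple i) _ (i :: reducedWord v⁻¹) h2.1 ?_
    (isReducedWord_length h2) ?_ f
  · rw [List.map_cons, List.prod_cons, h1.1, mul_inv_rev, simple_inv]
  · rw [List.length_cons, isReducedWord_length h1, len_mul_simple v i h]

/-! ### A reduced decomposition of `w_λ⁻¹ w_0` -/

/-- The composite `∂'_{i+L-1} ∘ ⋯ ∘ ∂'_{i+1} ∘ ∂'_i`. -/
def chain (n : ℕ) : ℕ → ℕ → Poly n →+ Poly n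
  | _, 0 => AddMonoidHom.id _
  | i, L + 1 => (chain n (i + 1) L).comp (bDiff n i)

theorem chain_zero (i : ℕ) (f : Poly n) : chain n i 0 f = f := rfl

theorem chain_succ (i L : ℕ) (f : Poly n) :
    chain n i (L + 1) f = chain n (i + 1) L (bDiff n i f) := rfl

theorem chain_succ_last (i L : ℕ) (f : Poly n) :
    chain n i (L + 1) f = bDiff n (i + L) (chain n i L f) := by
  induction L generalizing i f with
  | zero => rfl
  | succ L ih =>
    rw [chain_succ, ih, chain_succ]
    congr 2
    omega

/-- The one-line notation, indexed by natural numbers. -/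
def entry (v : SignedPerm n) (k : ℕ) : ℤ := if h : k < n then oneLine v ⟨k, h⟩ else 0

theorem entry_fin (v : SignedPerm n) (i : Fin n) : entry v i = oneLine v i := by simp [entry]

theorem entry_mul_simple_zero (v : SignedPerm n) (h : 0 < n) (k : ℕ) :
    entry (v * simple ⟨0, h⟩) k = if k = 0 then -entry v 0 else entry v k := by
  unfold entry
  by_cases hk : k < n
  · simp only [hk, h, dif_pos]
    rw [oneLine_mul_simple_zero _ _ rfl]
    by_cases h0 : k = 0
    · subst h0; simp
    · simp [h0]
  · have : k ≠ 0 := by omega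
    simp [hk, this]

theorem entry_mul_simple_succ (v : SignedPerm n) {m : ℕ} (h : m + 1 < n) (k : ℕ) :
    entry (v * simple ⟨m + 1, h⟩) k =
      if k = m then entry v (m + 1) else if k = m + 1 then entry v m else entry v k := by
  have hm : m < n := by omega
  have hp : prev (⟨m + 1, h⟩ : Fin n) = ⟨m, hm⟩ := rfl
  unfold entry
  by_cases hk : k < n
  · simp only [hk, h, hm, dif_pos]
    rw [oneLine_mul_simple_pos _ _ (Nat.succ_ne_zero m), hp]
    split_ifs with h1 h2
    · subst h1; rw [Equiv.swap_apply_left]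
    · subst h2; rw [Equiv.swap_apply_right]
    · rw [Equiv.swap_apply_of_ne_of_ne] <;> simpa
  · have h1 : k ≠ m := by omega
    have h2 : k ≠ m + 1 := by omega
    simp [hk, h1, h2]

/-- Moving the first entry to the right past `m` larger entries. -/
theorem exists_move_first (v : SignedPerm n) (m : ℕ) (hm : m < n)
    (h : ∀ j, 1 ≤ j → j ≤ m → entry v 0 < entry v j) :
    ∃ v' : SignedPerm n, (∀ j, entry v' j =
        if j < m then entry v (j + 1) else if j = m then entry v 0 else entry v j) ∧
      ∀ f, divDiffPerm v'⁻¹ f = chain n 1 m (divDiffPerm v⁻¹ f) := by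
  induction m with
  | zero =>
    refine ⟨v, fun j => ?_, fun f => rfl⟩
    split_ifs with h1 h2
    · omega
    · rw [h2]
    · rfl
  | succ m ih =>
    obtain ⟨u, hu, hd⟩ := ih (by omega) (fun j h1 h2 => h j h1 (by omega))
    refine ⟨u * simple ⟨m + 1, hm⟩, fun j => ?_, fun f => ?_⟩
    · rw [entry_mul_simple_succ]
      simp only [hu]
      split_ifs <;> first | omega | rfl | (subst_vars; rfl)
    · rw [divDiffPerm_mul_simple, hd, chain_succ_last, add_comm 1 m]
      rw [IsAscent, if_neg (Nat.succ_ne_zero m), ← entry_fin, ← entry_fin]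
      simp only [prev, hu, Nat.add_sub_cancel]
      simpa using h (m + 1) (by omega) le_rfl

/-- The composite of divided differences that processes the letters `1, …, p`. -/
def routeOp (n : ℕ) (lam : Finset ℕ) : ℕ → Poly n → Poly n
  | 0, f => f
  | p + 1, f => if p + 1 ∈ lam then chain n 1 (n - p - 1) (routeOp n lam p f)
      else chain n 0 n (routeOp n lam p f)

/-- Invariant after the letters 1,…,p: the untreated letters stand in front in increasing order, and
the treated ones follow in decreasing order with the signs prescribed by `lam`. The next letter p +
1 is first. If it lies in `lam`, it stops just before the treated block, all of which it exceeds.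
Otherwise its barred form is smaller than every other entry and travels past all n - 1 of them. -/
theorem exists_route (lam : Finset ℕ) (p : ℕ) (hp : p ≤ n) :
    ∃ v : SignedPerm n, (∀ j, j < n - p → entry v j = p + 1 + j) ∧
      (∀ j k, n - p ≤ j → j < k → k < n → entry v k < entry v j) ∧
      (∀ j, n - p ≤ j → j < n → -(p : ℤ) ≤ entry v j ∧ entry v j ≤ p ∧
        (0 < entry v j ↔ (entry v j).natAbs ∈ lam)) ∧
      ∀ f, divDiffPerm v⁻¹ f = routeOp n lam p f := by
  induction p with
  | zero =>
    refine ⟨1, ?_, fun j k h1 h2 h3 => by omega, fun j h1 h2 => by omega, fun f => ?_⟩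
    · intro j hj
      have : j < n := by omega
      simp [entry, this, oneLine]
      omega
    · rw [inv_one, divDiffPerm_one]; rfl
  | succ p ih =>
    obtain ⟨v, h1, h2, h3, h4⟩ := ih (by omega)
    have h10 := h1 0 (by omega)
    by_cases hmem : p + 1 ∈ lam
    · obtain ⟨u, hu, hd⟩ := exists_move_first v (n - p - 1) (by omega) (by
        intro j hj1 hj2
        rw [h10, h1 j (by omega)]
        omega)
      refine ⟨u, ?_, ?_, ?_, ?_⟩
      · intro j hj
        rw [hu, if_pos (by omega), h1 (j + 1) (by omega)]
        push_cast; ring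
      · intro j k hj hjk hk
        rw [hu, hu, if_neg (by omega), if_neg (by omega), if_neg (by omega)]
        split_ifs with hj'
        · rw [h10]
          have := (h3 k (by omega) hk).2.1
          push_cast; omega
        · exact h2 j k (by omega) hjk hk
      · intro j hj hjn
        rw [hu, if_neg (by omega)]
        split_ifs with hj'
        · rw [h10]
          refine ⟨by push_cast; omega, by push_cast; omega, iff_of_true (by omega) ?_⟩
          convert hmem using 1
          omega
        · obtain ⟨a1, a2, a3⟩ := h3 j (by omega) hjn
          exact ⟨by push_cast; omega, by push_cast; omega, a3⟩
      · intro f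
        rw [hd, h4, routeOp, if_pos hmem]
    · have hn : 0 < n := by omega
      have hz : ∀ k, entry (v * simple ⟨0, hn⟩) k = if k = 0 then -entry v 0 else entry v k :=
        entry_mul_simple_zero v hn
      obtain ⟨u, hu, hd⟩ := exists_move_first (v * simple ⟨0, hn⟩) (n - 1) (by omega) (by
        intro j hj1 hj2
        rw [hz, hz, if_pos rfl, if_neg (by omega), h10]
        by_cases hj : j < n - p
        · rw [h1 j hj]; omega
        · have := (h3 j (by omega) (by omega)).1
          push_cast; omega)
      have hu' : ∀ j, j < n → entry u j = if j < n - 1 then entry v (j + 1) else -entry v 0 := by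
        intro j hj
        rw [hu]
        split_ifs with c1 c2
        · rw [hz, if_neg (by omega)]
        · rw [hz, if_pos rfl]
        · omega
      refine ⟨u, ?_, ?_, ?_, ?_⟩
      · intro j hj
        rw [hu' j (by omega), if_pos (by omega), h1 (j + 1) (by omega)]
        push_cast; ring
      · intro j k hj hjk hk
        rw [hu' k hk, hu' j (by omega), if_pos (by omega : j < n - 1)]
        split_ifs with hk'
        · exact h2 (j + 1) (k + 1) (by omega) (by omega) (by omega)
        · rw [h10]
          have := (h3 (j + 1) (by omega) (by omega)).1
          push_cast; omega
      · intro j hj hjn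
        rw [hu' j hjn]
        split_ifs with hj'
        · obtain ⟨a1, a2, a3⟩ := h3 (j + 1) (by omega) (by omega)
          exact ⟨by push_cast; omega, by push_cast; omega, a3⟩
        · rw [h10]
          refine ⟨by push_cast; omega, by push_cast; omega, iff_of_false (by omega) ?_⟩
          rwa [show (-((p : ℤ) + 1 + (0 : ℕ))).natAbs = p + 1 by omega]
      · intro f
        have hdz : divDiffPerm (v * simple ⟨0, hn⟩)⁻¹ f = bDiff n 0 (divDiffPerm v⁻¹ f) := by
          refine divDiffPerm_mul_simple v ⟨0, hn⟩ ?_ f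
          rw [IsAscent, if_pos rfl, ← entry_fin]
          change 0 < entry v 0
          rw [h10]; omega
        rw [hd, hdz, h4, routeOp, if_neg hmem]
        obtain ⟨m, rfl⟩ : ∃ m, n = m + 1 := ⟨n - 1, by omega⟩
        rfl

theorem part_mem {lam : Finset ℕ} {i : ℕ} (hi : i < lam.card) : part lam i ∈ lam := by
  rw [part, List.getD_eq_getElem _ _ (by simpa using hi)]
  exact (Finset.mem_sort _).1 (List.getElem_mem _)

theorem part_lt_part {lam : Finset ℕ} {i j : ℕ} (hij : i < j) (hj : j < lam.card) :
    part lam j < part lam i := by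
  rw [part, part, List.getD_eq_getElem _ _ (by simpa using hj),
    List.getD_eq_getElem _ _ (by simpa using hij.trans hj)]
  have h := (Finset.sortedGT_sort lam).pairwise
  exact (List.pairwise_iff_getElem.1 h) _ _ _ _ hij

theorem card_add_card_dual {lam : Finset ℕ} (h : lam ∈ strictPartitions n) :
    lam.card + (dual n lam).card = n := by
  have := Finset.card_sdiff_add_card_eq_card (Finset.mem_powerset.1 h)
  simp only [dual]
  simp at this
  omega

theorem longest_mul_longest : longest n * longest n = 1 := by
  apply oneLine_injective
  funext i
  simp [longest, oneLine, left_mul_apply]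

theorem oneLine_longest_mul (w : SignedPerm n) (i : Fin n) :
    oneLine (longest n * w) i = -oneLine w i := by
  simp [longest, oneLine, left_mul_apply]

/-- A decreasing line is determined by its set of entries, and each absolute value occurs once, with
sign dictated by S. -/
theorem eq_of_strictAnti {u v : SignedPerm n} (hu : StrictAnti (oneLine u))
    (hv : StrictAnti (oneLine v)) (S : Finset ℕ)
    (hu' : ∀ i, 0 < oneLine u i ↔ (oneLine u i).natAbs ∈ S)
    (hv' : ∀ i, 0 < oneLine v i ↔ (oneLine v i).natAbs ∈ S) : u = v := by
  have sub : ∀ u v : SignedPerm n, (∀ i, 0 < oneLine u i ↔ (oneLine u i).natAbs ∈ S) →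
      (∀ i, 0 < oneLine v i ↔ (oneLine v i).natAbs ∈ S) →
      Set.range (oneLine u) ⊆ Set.range (oneLine v) := by
    rintro u v hu' hv' _ ⟨i, rfl⟩
    obtain ⟨j, hj⟩ := v.right.surjective (u.right i)
    refine ⟨j, ?_⟩
    have e : (oneLine u i).natAbs = (oneLine v j).natAbs := by
      rw [natAbs_oneLine, natAbs_oneLine, hj]
    have := hu' i
    rw [e, ← hv' j] at this
    have := oneLine_ne_zero u i
    have := oneLine_ne_zero v j
    omega
  exact oneLine_injective ((hu.range_inj hv).1 (Set.Subset.antisymm (sub u v hu' hv')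
    (sub v u hv' hu')))

/-- Both w_0w_λ and the endpoint of the route are decreasing with positive entries exactly the parts
of `lam`, hence equal. -/
theorem divDiffPerm_maxGrassmannian {lam : Finset ℕ} (h : lam ∈ strictPartitions n)
    (f : Poly n) :
    divDiffPerm ((maxGrassmannian n lam h)⁻¹ * longest n) f = routeOp n lam n f := by
  obtain ⟨v, -, h2, h3, h4⟩ := exists_route (n := n) lam n le_rfl
  rw [← h4]
  have hinv : (longest n)⁻¹ = longest n := inv_eq_of_mul_eq_one_right longest_mul_longest
  have : (maxGrassmannian n lam h)⁻¹ * longest n = (longest n * maxGrassmannian n lam h)⁻¹ := by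
    rw [mul_inv_rev, hinv]
  rw [this]
  congr 2
  have hcard := card_add_card_dual h
  have hlast : ∀ i : Fin n, oneLine (longest n * maxGrassmannian n lam h) i =
      if (i : ℕ) < lam.card then (part lam i : ℤ) else -(part (dual n lam) (n - 1 - i) : ℤ) := by
    intro i
    rw [oneLine_longest_mul, oneLine_maxGrassmannian]
    unfold length
    split_ifs <;> simp
  have pos1 : ∀ i, i < lam.card → 0 < part lam i := fun i hi => by
    have := Finset.mem_Icc.1 (Finset.mem_powerset.1 h (part_mem hi)); omega
  have pos2 : ∀ i, i < (dual n lam).card → 0 < part (dual n lam) i := fun i hi => by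
    have hm : part (dual n lam) i ∈ dual n lam := part_mem hi
    have := Finset.mem_Icc.1 (Finset.mem_sdiff.1 hm).1; omega
  refine eq_of_strictAnti ?_ ?_ lam ?_ ?_
  · intro i j hij
    rw [Fin.lt_def] at hij
    rw [hlast, hlast]
    split_ifs with c1 c2 c2
    · exact_mod_cast part_lt_part hij c1
    · omega
    · have := pos1 i c2; omega
    · have := part_lt_part (lam := dual n lam) (i := n - 1 - j) (j := n - 1 - i) (by omega)
        (by omega)
      omega
  · intro i j hij
    rw [← entry_fin, ← entry_fin]
    exact h2 i j (by omega) hij j.2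
  · intro i
    rw [hlast]
    split_ifs with c1
    · simp [part_mem c1, pos1 i c1]
    · have hi : n - 1 - (i : ℕ) < (dual n lam).card := by omega
      have hm : part (dual n lam) (n - 1 - i) ∈ dual n lam := part_mem hi
      have := (Finset.mem_sdiff.1 hm).2
      rw [Int.natAbs_neg, Int.natAbs_natCast]
      exact iff_of_false (by omega) this
  · intro i
    rw [← entry_fin]
    exact (h3 i (by omega) i.2).2.2

/-! ### Divided differences of staircase products -/

/-- `f` is fixed by every generator. -/
def FixedAll (f : Poly n) : Prop := ∀ k, sAct n k f = f

/-- `f` is symmetric in `x_1, …, x_n`. -/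
def SymmX (f : Poly n) : Prop := ∀ k, sAct n (k + 1) f = f

theorem chain_mul_left {i L : ℕ} {f : Poly n} (hf : ∀ k, i ≤ k → k < i + L → sAct n k f = f)
    (g : Poly n) : chain n i L (f * g) = f * chain n i L g := by
  induction L generalizing i g with
  | zero => rfl
  | succ L ih =>
    rw [chain_succ, chain_succ, bDiff_mul_left (hf i le_rfl (by omega)),
      ih (fun k h1 h2 => hf k (by omega) (by omega))]

theorem SymmX.chain_mul {f : Poly n} (hf : SymmX f) (i L : ℕ) (g : Poly n) :
    chain n (i + 1) L (f * g) = f * chain n (i + 1) L g :=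
  chain_mul_left (fun k h _ => by
    obtain ⟨k, rfl⟩ : ∃ k', k = k' + 1 := ⟨k - 1, by omega⟩
    exact hf k) g

/-- The variable `y_{j+1}`, indexed by a natural number. -/
def yVar (n j : ℕ) : Poly n := if h : j < n then y ⟨j, h⟩ else 0

theorem sAct_yVar (k j : ℕ) : sAct n k (yVar n j) = yVar n j := by
  unfold yVar
  split_ifs
  · exact sAct_y _ _
  · exact map_zero _

/-- The product `(x_{k+1} - y_1) ⋯ (x_{k+1} - y_h)`. -/
def yProd (n h k : ℕ) : Poly n := ∏ t ∈ Finset.range h, (xVar n k - yVar n t)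

/-- The product of `(x_{j+1+t} - y_s)` over `1 ≤ s ≤ h - t`. -/
def stair (n : ℕ) : ℕ → ℕ → Poly n
  | _, 0 => 1
  | j, h + 1 => yProd n (h + 1) j * stair n (j + 1) h

theorem sAct_xVar_of_lt {k j : ℕ} (h : k < j) : sAct n k (xVar n j) = xVar n j := by
  by_cases hk : k < n
  · rcases k with _ | k
    · rw [sAct_zero_xVar hk, if_neg (by omega)]
    · rw [sAct_succ_xVar hk, if_neg (by omega), if_neg (by omega)]
  · simp [sAct, hk]

theorem sAct_xVar_of_gt {k j : ℕ} (h : j + 1 < k) : sAct n k (xVar n j) = xVar n j := by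
  by_cases hk : k < n
  · obtain ⟨k, rfl⟩ : ∃ k', k = k' + 1 := ⟨k - 1, by omega⟩
    rw [sAct_succ_xVar hk, if_neg (by omega), if_neg (by omega)]
  · simp [sAct, hk]

theorem sAct_yProd {k j j' : ℕ} (h : sAct n k (xVar n j) = xVar n j') (m : ℕ) :
    sAct n k (yProd n m j) = yProd n m j' := by
  simp only [yProd, map_prod, map_sub, h, sAct_yVar]

theorem sAct_stair {k j : ℕ} (h : k < j) (m : ℕ) : sAct n k (stair n j m) = stair n j m := by
  induction m generalizing j with
  | zero => exact map_one _
  | succ m ih =>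
    rw [stair, map_mul, sAct_yProd (sAct_xVar_of_lt h), ih (by omega)]

theorem elemY_fixed (c : ℕ) (m : ℤ) : FixedAll (elemY n c m) := by
  intro k
  unfold elemY
  split_ifs
  · have : (sAct n k).comp (MvPolynomial.rename (fun j : Fin (n - c) => (Sum.inr
        (Fin.castLE (Nat.sub_le n c) j) : Fin n ⊕ Fin n)) :
          MvPolynomial (Fin (n - c)) ZHalf →ₐ[ZHalf] Poly n).toRingHom =
        (MvPolynomial.rename (fun j : Fin (n - c) => (Sum.inr
        (Fin.castLE (Nat.sub_le n c) j) : Fin n ⊕ Fin n)) :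
          MvPolynomial (Fin (n - c)) ZHalf →ₐ[ZHalf] Poly n).toRingHom := by
      refine MvPolynomial.ringHom_ext (fun r => ?_) (fun j => ?_)
      · simp [sAct_C]
      · have := sAct_y k (Fin.castLE (Nat.sub_le n c) j)
        simpa [y] using this
    exact DFunLike.congr_fun this _
  · exact map_zero _

theorem yProd_eq_sum (c k : ℕ) (hc : c ≤ n) :
    yProd n (n - c) k = ∑ m ∈ Finset.range (n - c + 1),
      (-1) ^ m * elemY n c m * xVar n k ^ (n - c - m) := by
  set φ : MvPolynomial (Fin (n - c)) ZHalf →+* Poly n :=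
    (MvPolynomial.rename (fun j : Fin (n - c) => (Sum.inr
      (Fin.castLE (Nat.sub_le n c) j) : Fin n ⊕ Fin n))).toRingHom with hφ
  -- Vieta's formula is stated for factors r + X; evaluating at -x gives ∏(y_t - x), and the sign
  -- (-1)^{n-c} is restored afterwards.
  have h := congrArg (Polynomial.eval₂ φ (-xVar n k))
    (MvPolynomial.prod_C_add_X_eq_sum_esymm ZHalf (Fin (n - c)))
  have hY : ∀ j : Fin (n - c), φ (MvPolynomial.X j) = yVar n j := fun j => by
    have : (j : ℕ) < n := by omega
    simp [hφ, yVar, this, y, Fin.castLE]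
  simp only [Polynomial.eval₂_finsetProd, Polynomial.eval₂_finsetSum, Polynomial.eval₂_add,
    Polynomial.eval₂_mul, Polynomial.eval₂_pow, Polynomial.eval₂_X, Polynomial.eval₂_C, hY,
    Fintype.card_fin] at h
  rw [Fin.prod_univ_eq_prod_range (fun t => -xVar n k + yVar n t) (n - c)] at h
  have h2 : yProd n (n - c) k =
      (-1) ^ (n - c) * ∏ t ∈ Finset.range (n - c), (-xVar n k + yVar n t) := by
    have := Finset.prod_const (s := Finset.range (n - c)) (-1 : Poly n)
    rw [Finset.card_range] at this
    rw [← this, ← Finset.prod_mul_distrib]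
    exact Finset.prod_congr rfl fun t _ => by ring
  rw [h2, h, Finset.mul_sum]
  refine Finset.sum_congr rfl fun m hm => ?_
  rw [Finset.mem_range] at hm
  have he : elemY n c m = φ (MvPolynomial.esymm (Fin (n - c)) ZHalf m) := by
    simp [elemY, hφ]
  obtain ⟨d, hd⟩ : ∃ d, n - c = m + d := ⟨n - c - m, by omega⟩
  rw [he, neg_pow (xVar n k), show n - c - m = d by omega]
  have : (-1 : Poly n) ^ (n - c) * (-1) ^ d = (-1) ^ m := by
    rw [hd, pow_add, mul_assoc, ← mul_pow]; simp
  linear_combination (xVar n k ^ d * φ (MvPolynomial.esymm (Fin (n - c)) ZHalf m)) * this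

/-- The first operator turns a power into minus the complete homogeneous sum, one degree lower, in
two neighbouring variables. The later ones ignore the older variable, so by induction only the top
power survives, with one sign per operator. -/
theorem chain_xVar_pow {m L r : ℕ} (hm : m + L < n) (hr : r ≤ L) :
    chain n (m + 1) L (xVar n m ^ r) = if r = L then (-1) ^ L else 0 := by
  induction L generalizing m r with
  | zero =>
    obtain rfl : r = 0 := by omega
    simp [chain_zero]
  | succ L ih =>
    rcases r with _ | r
    · rw [chain_succ, pow_zero, bDiff_of_sAct (map_one _), map_zero, if_neg (by omega)]
    have hb : bDiff n (m + 1) (xVar n m ^ (r + 1)) =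
        ∑ s ∈ Finset.range (r + 1), xVar n m ^ (r - s) * (-1 * xVar n (m + 1) ^ s) := by
      apply bDiff_eq_of_root_mul (by omega)
      have h1 : sAct n (m + 1) (xVar n m) = xVar n (m + 1) := by
        rw [sAct_succ_xVar (by omega), if_pos rfl]
      have h2 := geom_sum₂_mul (xVar n (m + 1)) (xVar n m) (r + 1)
      rw [map_pow, h1]
      have h3 : root n (m + 1) = xVar n (m + 1) - xVar n m := by simp [root]
      rw [h3, ← neg_sub (_ ^ _), ← h2, mul_comm, ← neg_mul, ← Finset.sum_neg_distrib]
      congr 1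
      refine Finset.sum_congr rfl fun s _ => ?_
      rw [Nat.add_sub_cancel]
      ring
    have hx : ∀ k, m + 1 + 1 ≤ k → k < m + 1 + 1 + L → ∀ e, sAct n k (xVar n m ^ e) = xVar n m ^ e :=
      fun k h1 h2 e => by rw [map_pow, sAct_xVar_of_gt (by omega)]
    rw [chain_succ, hb, map_sum]
    have : ∀ s ∈ Finset.range (r + 1),
        chain n (m + 1 + 1) L (xVar n m ^ (r - s) * (-1 * xVar n (m + 1) ^ s)) =
        if s = L then xVar n m ^ (r - s) * (-1) ^ (L + 1) else 0 := by
      intro s hs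
      rw [Finset.mem_range] at hs
      rw [chain_mul_left (fun k h1 h2 => hx k h1 h2 _),
        chain_mul_left (fun k _ _ => by rw [map_neg, map_one]), ih (by omega) (by omega)]
      split_ifs
      · ring
      · ring
    rw [Finset.sum_congr rfl this, Finset.sum_ite_eq']
    by_cases hrL : r = L
    · subst hrL
      simp
    · rw [if_neg (by simp; omega), if_neg (by omega)]

theorem chain_yProd {m L h : ℕ} (hm : m + L < n) (hh : h ≤ L) :
    chain n (m + 1) L (yProd n h m) = if h = L then (-1) ^ L else 0 := by
  obtain ⟨c, hc, rfl⟩ : ∃ c, c ≤ n ∧ h = n - c := ⟨n - h, by omega, by omega⟩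
  rw [yProd_eq_sum c m hc, map_sum]
  have : ∀ j ∈ Finset.range (n - c + 1),
      chain n (m + 1) L ((-1) ^ j * elemY n c j * xVar n m ^ (n - c - j)) =
      if j = 0 then (if n - c = L then (-1) ^ L else 0) else 0 := by
    intro j hj
    rw [Finset.mem_range] at hj
    rw [chain_mul_left (fun k _ _ => by
      rw [map_mul, map_pow, map_neg, map_one, elemY_fixed]), chain_xVar_pow hm (by omega)]
    by_cases hj0 : j = 0
    · subst hj0
      simp [elemY]
    · rw [if_neg (by omega), if_neg hj0, mul_zero]
  rw [Finset.sum_congr rfl this, Finset.sum_ite_eq', if_pos (by simp)]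

/-- By the twisted Leibniz rule the first operator either hits q, and then moves the first row of
the staircase to the preceding variable, or hits that row. The second contribution is annihilated by
the rest of the chain, since the row has degree below the chain length. The row that was moved is
inert for the later operators, so the argument repeats with the remaining rows. -/
theorem chain_mul_stair {m L h : ℕ} (hm : m + L < n) (hh : h < L ∨ h = 0) (q : Poly n)
    (hq : ∀ k, m + 1 < k → sAct n k q = q) :
    chain n (m + 1) L (q * stair n (m + 1) h) = stair n m h * chain n (m + 1) L q := by
  induction L generalizing m h q with
  | zero =>
    obtain rfl : h = 0 := by omega
    simp [stair]
  | succ L ih =>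
    rcases h with _ | h
    · simp [stair]
    have h1 : sAct n (m + 1) (xVar n (m + 1)) = xVar n m := by
      rw [sAct_succ_xVar (by omega), if_neg (by omega), if_pos rfl]
    have h2 := chain_yProd (n := n) (m := m) (L := L + 1) (h := h + 1) hm (by omega)
    rw [if_neg (by omega), chain_succ] at h2
    -- The reflection exchanges the two variables, so the two divided differences are opposite and
    -- the vanishing `h2` carries over.
    have h3 : bDiff n (m + 1) (yProd n (h + 1) (m + 1)) =
        -bDiff n (m + 1) (yProd n (h + 1) m) := by
      apply mul_left_cancel₀ (root_ne_zero (n := n) (k := m + 1) (by omega))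
      have h1' : sAct n (m + 1) (xVar n m) = xVar n (m + 1) := by
        rw [sAct_succ_xVar (by omega), if_pos rfl]
      rw [mul_neg, root_mul_bDiff (by omega), root_mul_bDiff (by omega), sAct_yProd h1,
        sAct_yProd h1']
      ring
    have e : bDiff n (m + 1) (q * stair n (m + 1) (h + 1)) =
        (bDiff n (m + 1) q * yProd n (h + 1) m +
          q * bDiff n (m + 1) (yProd n (h + 1) (m + 1))) * stair n (m + 1 + 1) h := by
      rw [stair, ← mul_assoc, mul_comm, bDiff_mul_left (sAct_stair (by omega) _), bDiff_mul,
        sAct_yProd h1, mul_comm]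
    rw [chain_succ, e, ih (by omega) (by omega), map_add, mul_comm (bDiff n (m + 1) q),
      chain_mul_left, chain_mul_left, h3, map_neg, h2, chain_succ, stair]
    · ring
    · exact fun k hk _ => hq k (by omega)
    · exact fun k hk _ => sAct_yProd (sAct_xVar_of_gt (by omega)) _
    · intro k hk
      rw [map_add, map_mul, map_mul, sAct_bDiff_comm hk, sAct_bDiff_comm hk, hq k (by omega),
        sAct_yProd (sAct_xVar_of_gt (by omega)), sAct_yProd (sAct_xVar_of_gt hk)]

theorem stair_eq_prod (j h : ℕ) :
    stair n j h = ∏ t ∈ Finset.range h, yProd n (h - t) (j + t) := by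
  induction h generalizing j with
  | zero => rfl
  | succ h ih =>
    rw [stair, ih, Finset.prod_range_succ']
    simp only [add_zero, Nat.sub_zero, mul_comm (yProd n (h + 1) j)]
    congr 1
    refine Finset.prod_congr rfl fun t _ => ?_
    congr 1 <;> omega

theorem delta_eq_stair : delta n = stair n 0 (n - 1) := by
  have h1 : delta n = ∏ t ∈ Finset.range n, ∏ s ∈ Finset.range n,
      if t + 1 + (s + 1) ≤ n then xVar n t - yVar n s else 1 := by
    rw [delta, Finset.prod_filter, Fintype.prod_prod_type,
      ← Fin.prod_univ_eq_prod_range (fun t => ∏ s ∈ Finset.range n,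
        if t + 1 + (s + 1) ≤ n then xVar n t - yVar n s else 1)]
    refine Finset.prod_congr rfl fun i _ => ?_
    rw [← Fin.prod_univ_eq_prod_range (fun s =>
        if (i : ℕ) + 1 + (s + 1) ≤ n then xVar n i - yVar n s else 1)]
    refine Finset.prod_congr rfl fun j _ => ?_
    simp [xVar, yVar]
  have h2 : ∀ t ∈ Finset.range n, ∏ s ∈ Finset.range n,
      (if t + 1 + (s + 1) ≤ n then xVar n t - yVar n s else 1) = yProd n (n - 1 - t) t := by
    intro t _
    rw [← Finset.prod_filter, yProd]
    refine Finset.prod_congr (Finset.ext fun s => ?_) fun _ _ => rfl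
    simp only [Finset.mem_filter, Finset.mem_range]
    omega
  rw [h1, Finset.prod_congr rfl h2, stair_eq_prod]
  rcases n with _ | n
  · rfl
  · rw [Finset.prod_range_succ]
    simp [yProd]

/-! ### Divided differences of the staircase times a symmetric polynomial -/

/-- The symmetric factor that is left after processing the letters `1, …, p`. -/
def coreOp (n : ℕ) (lam : Finset ℕ) : ℕ → Poly n → Poly n
  | 0, f => f
  | p + 1, f => if p + 1 ∈ lam then coreOp n lam p f
      else chain n 0 n (yProd n (n - (p + 1)) 0 * coreOp n lam p f)

theorem chain_zero_eq (hn : 0 < n) (f : Poly n) :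
    chain n 0 n f = chain n 1 (n - 1) (bDiff n 0 f) := by
  obtain ⟨m, rfl⟩ : ∃ m, n = m + 1 := ⟨n - 1, by omega⟩
  rfl

theorem stair_eq (j h : ℕ) : stair n j h = yProd n h j * stair n (j + 1) (h - 1) := by
  rcases h with _ | h
  · simp [stair, yProd]
  · rfl

/-- For a letter q of `lam`, the symmetric core leaves the chain, the first row has degree n - q
equal to the chain length and yields (-1)^{n-q}, and the other rows shift. Otherwise ∂'_0 ignores
the rows beyond the first, so these shift again while the first row is absorbed into the core. -/
theorem routeOp_stair_mul (lam : Finset ℕ) (f : Poly n) (hf : ∀ p, p ≤ n → SymmX (coreOp n lam p f))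
    (p : ℕ) (hp : p ≤ n) :
    routeOp n lam p (stair n 0 (n - 1) * f) =
      (-1) ^ (∑ q ∈ (Finset.Icc 1 p).filter (· ∈ lam), (n - q)) *
        (stair n 0 (n - p - 1) * coreOp n lam p f) := by
  induction p with
  | zero => simp [routeOp, coreOp]
  | succ p ih =>
    have hn : 0 < n := by omega
    have ih := ih (by omega)
    have hs := hf p (by omega)
    have hIcc : Finset.Icc 1 (p + 1) = insert (p + 1) (Finset.Icc 1 p) := by
      ext q; simp only [Finset.mem_insert, Finset.mem_Icc]; omega
    have hpn : p + 1 ∉ (Finset.Icc 1 p).filter (· ∈ lam) := by simp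
    set e := ∑ q ∈ (Finset.Icc 1 p).filter (· ∈ lam), (n - q) with he
    have hsign : ∀ i L : ℕ, ∀ g : Poly n, chain n i L ((-1) ^ e * g) = (-1) ^ e * chain n i L g :=
      fun i L g => chain_mul_left (fun k _ _ => by rw [map_pow, map_neg, map_one]) g
    have hst := stair_eq (n := n) 0 (n - p - 1)
    rw [routeOp, coreOp, hIcc, Finset.filter_insert]
    split_ifs with hmem
    · rw [Finset.sum_insert hpn, ih, hsign, hst, zero_add, mul_comm _ (coreOp n lam p f),
        hs.chain_mul 0, chain_mul_stair (by omega) (by omega), chain_yProd (by omega) (by omega),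
        if_pos rfl]
      · rw [pow_add, ← he, show n - (p + 1) = n - p - 1 by omega]
        ring
      · exact fun k hk => sAct_yProd (sAct_xVar_of_gt (by omega)) _
    · rw [ih, hsign, ← he, chain_zero_eq hn, chain_zero_eq hn, hst, zero_add]
      have e1 : yProd n (n - p - 1) 0 * stair n 1 (n - p - 1 - 1) * coreOp n lam p f =
          stair n 1 (n - p - 1 - 1) * (yProd n (n - p - 1) 0 * coreOp n lam p f) := by ring
      rw [e1, bDiff_mul_left (sAct_stair (by omega) _), mul_comm (stair n 1 _),
        chain_mul_stair (m := 0) (by omega) (by omega)]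
      · rw [show n - (p + 1) = n - p - 1 by omega]
      · intro k hk
        rw [sAct_bDiff_comm hk, map_mul, sAct_yProd (sAct_xVar_of_gt hk)]
        obtain ⟨k, rfl⟩ : ∃ k', k = k' + 1 := ⟨k - 1, by omega⟩
        rw [hs k]

/-! ### Elementary symmetric polynomials -/

/-- The elementary symmetric polynomial `e_k(X)`. -/
def eVar (n k : ℕ) : Poly n := MvPolynomial.rename Sum.inl (MvPolynomial.esymm (Fin n) ZHalf k)

theorem symmX_rename {p : MvPolynomial (Fin n) ZHalf} (hp : p.IsSymmetric) :
    SymmX (MvPolynomial.rename Sum.inl p : Poly n) := by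
  intro k
  by_cases hk : k + 1 < n
  swap
  · simp [sAct, hk]
  rw [sAct_of_lt hk]
  have : ((act ⟨k + 1, hk⟩).comp (MvPolynomial.rename Sum.inl) :
      MvPolynomial (Fin n) ZHalf →ₐ[ZHalf] Poly n) =
      (MvPolynomial.rename Sum.inl).comp
        (MvPolynomial.rename (Equiv.swap (prev ⟨k + 1, hk⟩) ⟨k + 1, hk⟩)) := by
    refine MvPolynomial.algHom_ext fun j => ?_
    simp [act, x]
  have h := DFunLike.congr_fun this p
  rw [AlgHom.comp_apply, AlgHom.comp_apply, hp] at h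
  exact h

theorem eVar_symm (k : ℕ) : SymmX (eVar n k) :=
  symmX_rename (MvPolynomial.esymm_isSymmetric _ _ _)

theorem eVar_zero : eVar n 0 = 1 := by simp [eVar]

/-- The elementary symmetric polynomial `e_k(x_2, …, x_{n+1})`. -/
def eTail (n k : ℕ) : Poly (n + 1) :=
  ((Finset.univ : Finset (Fin n)).val.map fun j => (x j.succ : Poly (n + 1))).esymm k

theorem eTail_zero : eTail n 0 = 1 := by
  simp [eTail, Multiset.esymm]

theorem eVar_succ (k : ℕ) :
    eVar (n + 1) (k + 1) = eTail n (k + 1) + xVar (n + 1) 0 * eTail n k := by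
  have h : eVar (n + 1) (k + 1) =
      ((Finset.univ : Finset (Fin (n + 1))).val.map (x : _ → Poly (n + 1))).esymm (k + 1) := by
    rw [eVar, MvPolynomial.rename_eq_aeval, MvPolynomial.aeval_esymm_eq_multiset_esymm]
    rfl
  have hu : (Finset.univ : Finset (Fin (n + 1))).val.map (x : _ → Poly (n + 1)) =
      x 0 ::ₘ (Finset.univ : Finset (Fin n)).val.map fun j => (x j.succ : Poly (n + 1)) := by
    rw [Fin.univ_succ, Finset.cons_val, Multiset.map_cons, Finset.map_val, Multiset.map_map]
    rfl
  have hx : xVar (n + 1) 0 = x 0 := by simp [xVar]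
  rw [h, hu, hx]
  simp only [Multiset.esymm, eTail, Multiset.powersetCard_cons, Multiset.map_add, Multiset.sum_add,
    Multiset.map_map, Function.comp_def, Multiset.prod_cons, Multiset.sum_map_mul_left]

theorem sAct_zero_eTail (k : ℕ) : sAct (n + 1) 0 (eTail n k) = eTail n k := by
  simp only [eTail, Multiset.esymm, map_multiset_sum, Multiset.map_map, Function.comp_def,
    map_multiset_prod]
  congr 1
  refine Multiset.map_congr rfl fun s hs => ?_
  congr 1
  conv_rhs => rw [← Multiset.map_id s]
  refine Multiset.map_congr rfl fun z hz => ?_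
  have := Multiset.mem_of_le (Multiset.mem_powersetCard.1 hs).1 hz
  obtain ⟨j, -, rfl⟩ := Multiset.mem_map.1 this
  have hj : (x j.succ : Poly (n + 1)) = xVar (n + 1) (j + 1) := by simp [xVar]; rfl
  rw [hj, sAct_xVar_of_lt (by omega)]
  rfl

theorem eTail_eq_zero {k : ℕ} (h : n < k) : eTail n k = 0 := by
  rw [eTail, Multiset.esymm, Multiset.powersetCard_eq_empty _ (by simpa using h)]
  simp

/-- Since x_1 E_q = e_{q+1} - E_{q+1}, where E denotes `eTail`, each power of x_1 can be traded for
a shift of the index: the symmetric e_{q+1} leaves the chain and multiplies the image of a power of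
degree below n, which is zero. -/
theorem chain_xVar_pow_mul_eTail {r : ℕ} (hr : r ≤ n) (q : ℕ) :
    chain (n + 1) 1 n (xVar (n + 1) 0 ^ r * eTail n q) =
      (-1) ^ r * chain (n + 1) 1 n (eTail n (q + r)) := by
  induction r generalizing q with
  | zero => simp
  | succ r ih =>
    have e : xVar (n + 1) 0 ^ (r + 1) * eTail n q = eVar (n + 1) (q + 1) * xVar (n + 1) 0 ^ r -
        xVar (n + 1) 0 ^ r * eTail n (q + 1) := by
      rw [eVar_succ]; ring
    rw [e, map_sub, (eVar_symm _).chain_mul 0, chain_xVar_pow (by omega) (by omega),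
      if_neg (by omega), ih (by omega), show q + 1 + r = q + (r + 1) by omega]
    ring

theorem chain_eTail (k : ℕ) : chain (n + 1) 1 n (eTail n k) = if k = n then 1 else 0 := by
  by_cases hk : k ≤ n
  · have h := chain_xVar_pow_mul_eTail hk 0
    rw [eTail_zero, mul_one, chain_xVar_pow (by omega) hk, zero_add] at h
    have h2 : ((-1 : Poly (n + 1)) ^ k) * (-1) ^ k = 1 := by rw [← mul_pow]; simp
    calc chain (n + 1) 1 n (eTail n k) =
        (-1) ^ k * ((-1) ^ k * chain (n + 1) 1 n (eTail n k)) := by rw [← mul_assoc, h2, one_mul]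
      _ = _ := by
        rw [← h]
        split_ifs with h3
        · subst h3; exact h2
        · exact mul_zero _
  · rw [eTail_eq_zero (by omega), map_zero, if_neg (by omega)]

theorem bDiff_zero_xVar_pow (hn : 0 < n) (r : ℕ) :
    bDiff n 0 (xVar n 0 ^ r) = (1 - (-1) ^ r) * xVar n 0 ^ (r - 1) := by
  apply bDiff_eq_of_root_mul hn
  rw [map_pow, sAct_zero_xVar hn, if_pos rfl, neg_pow, root, if_pos rfl]
  rcases r with _ | r
  · simp
  · rw [Nat.add_sub_cancel]; ring

/-- In the Leibniz rule for ∂'_0, the term that differentiates the power has degree r - 1 < n in x_1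
beside a symmetric factor, so the chain kills it; the sign is that of s_0 on x_1^r. -/
theorem chain_xVar_pow_mul_of_symmX {f : Poly (n + 1)} (hf : SymmX f) {r : ℕ} (hr : r ≤ n) :
    chain (n + 1) 0 (n + 1) (xVar (n + 1) 0 ^ r * f) =
      (-1) ^ r * chain (n + 1) 1 n (xVar (n + 1) 0 ^ r * bDiff (n + 1) 0 f) := by
  have hc : ∀ c : ℤ, ∀ g : Poly (n + 1), chain (n + 1) 1 n ((c : Poly (n + 1)) * g) =
      c * chain (n + 1) 1 n g := fun c g => chain_mul_left (fun k _ _ => map_intCast _ c) g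
  have h1 : bDiff (n + 1) 0 (xVar (n + 1) 0 ^ r * f) =
      ((-1 : ℤ) ^ r : ℤ) * (xVar (n + 1) 0 ^ r * bDiff (n + 1) 0 f) +
      f * ((1 - (-1 : ℤ) ^ r : ℤ) * xVar (n + 1) 0 ^ (r - 1)) := by
    rw [mul_comm, bDiff_mul, bDiff_zero_xVar_pow (by omega), map_pow,
      sAct_zero_xVar (by omega), if_pos rfl, neg_pow]
    push_cast
    ring
  rw [chain_zero_eq (by omega), Nat.add_sub_cancel, h1, map_add, hc, hf.chain_mul 0, hc]
  rcases r with _ | r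
  · simp
  · rw [Nat.add_sub_cancel, chain_xVar_pow (by omega) (by omega), if_neg (by omega)]
    push_cast
    ring

/-- Here ∂'_0 e_p = 2E_{p-1} with E denoting `eTail`, and the chain tests whether p - 1 + r = n.
This 2 is what the normalization of P̃ later absorbs. -/
theorem chain_xVar_pow_mul_bDiff_eVar {r : ℕ} (hr : r ≤ n) (p : ℕ) :
    (-1) ^ r * chain (n + 1) 1 n (xVar (n + 1) 0 ^ r * bDiff (n + 1) 0 (eVar (n + 1) p)) =
      if p = n + 1 - r then 2 else 0 := by
  rcases p with _ | q
  · rw [eVar_zero, bDiff_of_sAct (map_one _), mul_zero, map_zero, mul_zero, if_neg (by omega)]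
  · have hx := bDiff_zero_xVar_pow (n := n + 1) (by omega) 1
    have h2 : bDiff (n + 1) 0 (eVar (n + 1) (q + 1)) = 2 * eTail n q := by
      rw [eVar_succ, map_add, bDiff_of_sAct (sAct_zero_eTail _), mul_comm,
        bDiff_mul_left (sAct_zero_eTail _)]
      simp only [pow_one] at hx
      rw [hx]
      simp only [Nat.sub_self, pow_zero]
      ring
    have h3 : chain (n + 1) 1 n (2 * (xVar (n + 1) 0 ^ r * eTail n q)) =
        2 * chain (n + 1) 1 n (xVar (n + 1) 0 ^ r * eTail n q) :=
      chain_mul_left (fun k _ _ => map_ofNat _ 2) _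
    have h4 : ((-1 : Poly (n + 1)) ^ r) * (-1) ^ r = 1 := by rw [← mul_pow]; simp
    rw [h2, mul_left_comm, h3, chain_xVar_pow_mul_eTail hr, chain_eTail]
    by_cases h : q + r = n
    · rw [if_pos h, if_pos (by omega)]
      linear_combination 2 * h4
    · rw [if_neg h, if_neg (by omega)]; ring

/-! ### The two-index polynomials -/

/-- `Q̃_{i,j}(X)`. -/
def qVar (n i j : ℕ) : Poly n := MvPolynomial.rename Sum.inl (qTildePair n i j)

theorem qVar_eq (i j : ℕ) : qVar n i j = eVar n i * eVar n j +
    2 * ∑ k ∈ Finset.Icc 1 j, (-1) ^ k * (eVar n (i + k) * eVar n (j - k)) := by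
  simp only [qVar, qTildePair, eVar, map_add, map_mul, map_sum, map_pow, map_neg, map_one,
    map_ofNat]

theorem qVar_zero_right (i : ℕ) : qVar n i 0 = eVar n i := by
  simp [qVar_eq, eVar_zero]

theorem qVar_symm (i j : ℕ) : SymmX (qVar n i j) := by
  intro k
  simp only [qVar_eq, map_add, map_mul, map_sum, map_pow, map_neg, map_one, map_ofNat,
    eVar_symm _ k]

/-- Substituting e_k = E_k + x_1E_{k-1}, with E denoting `eTail`, the change of each product
e_{i+k}e_{j-k} is 2x_1 times a sum of two consecutive terms. The alternating sum therefore
telescopes, and the result has rank two in the indices i, j. -/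
theorem sAct_zero_qVar {i j : ℕ} (hij : j < i) :
    sAct (n + 1) 0 (qVar (n + 1) i j) = qVar (n + 1) i j -
      (eVar (n + 1) i * sAct (n + 1) 0 (eVar (n + 1) j) -
        sAct (n + 1) 0 (eVar (n + 1) i) * eVar (n + 1) j) := by
  obtain ⟨i, rfl⟩ : ∃ i', i = i' + 1 := ⟨i - 1, by omega⟩
  set s := sAct (n + 1) 0
  set e := eVar (n + 1)
  set E := eTail n
  set X := xVar (n + 1) 0
  have h0 : e 0 = 1 := eVar_zero
  have hE0 : E 0 = 1 := eTail_zero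
  have h1 : ∀ k, e (k + 1) = E (k + 1) + X * E k := eVar_succ
  have h2 : ∀ k, s (e (k + 1)) = E (k + 1) - X * E k := fun k => by
    have hX : s X = -X := by
      simpa using sAct_zero_xVar (n := n + 1) (by omega) 0
    have hE : ∀ k, s (E k) = E k := sAct_zero_eTail
    rw [h1, map_add, map_mul, hX, hE, hE]; ring
  have hs0 : s (e 0) = 1 := by rw [h0, map_one]
  -- The index i has been lowered by one, so the original first index is i + 1; the cutoff at j
  -- removes the upper boundary term of the telescoping sum.
  set T : ℕ → Poly (n + 1) := fun k => if k ≤ j then E (i + k) * E (j - k) else 0 with hT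
  have diff : ∀ k, k ≤ j → e (i + 1 + k) * e (j - k) - s (e (i + 1 + k)) * s (e (j - k)) =
      2 * X * (T k + T (k + 1)) := by
    intro k hk
    have a1 := h1 (i + k)
    have a2 := h2 (i + k)
    rw [show i + k + 1 = i + 1 + k by omega] at a1 a2
    simp only [hT, if_pos hk]
    rw [a2, a1]
    rcases Nat.lt_or_ge k j with h | h
    · obtain ⟨d, hd⟩ : ∃ d, j - k = d + 1 := ⟨j - k - 1, by omega⟩
      rw [if_pos (by omega), hd, h2, h1, show j - (k + 1) = d by omega,
        show i + (k + 1) = i + 1 + k by omega]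
      ring
    · rw [if_neg (by omega), show j - k = 0 by omega, hs0, h0, hE0]
      ring
  have tele : ∀ m, ∑ k ∈ Finset.Icc 1 m, (-1) ^ k * (2 * X * (T k + T (k + 1))) =
      2 * X * ((-1) ^ m * T (m + 1) - T 1) := by
    intro m
    induction m with
    | zero => simp
    | succ m ih =>
      rw [Finset.sum_Icc_succ_top (by omega), ih]
      ring
  have hsum : ∑ k ∈ Finset.Icc 1 j, (-1) ^ k * (e (i + 1 + k) * e (j - k)) -
      ∑ k ∈ Finset.Icc 1 j, (-1) ^ k * (s (e (i + 1 + k)) * s (e (j - k))) = -(2 * X * T 1) := by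
    rw [← Finset.sum_sub_distrib, Finset.sum_congr rfl fun k hk => by
      rw [← mul_sub, diff k (Finset.mem_Icc.1 hk).2], tele]
    simp only [hT, if_neg (show ¬ j + 1 ≤ j by omega)]
    ring
  have hfirst := diff 0 (Nat.zero_le _)
  have hrhs : e (i + 1) * s (e j) - s (e (i + 1)) * e j = 2 * X * (T 0 - T 1) := by
    simp only [hT, if_pos (Nat.zero_le j)]
    rcases j with _ | j
    · rw [hs0, h0, h2, h1, if_neg (by omega)]
      simp only [Nat.sub_zero, hE0, add_zero]
      ring
    · rw [if_pos (by omega), h2, h2, h1, h1]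
      simp only [Nat.sub_zero, Nat.add_sub_cancel, add_zero]
      ring
  rw [hrhs, qVar_eq]
  simp only [map_add, map_mul, map_sum, map_pow, map_neg, map_one, map_ofNat]
  simp only [Nat.sub_zero, add_zero] at hfirst
  linear_combination -hfirst - 2 * hsum

/-! ### Pfaffians indexed by finite sets of natural numbers -/

section Pfaffian

variable {R : Type*} [CommRing R]

/-- The sign of removing `b` from `S`, listed in decreasing order. -/
def sgn (R : Type*) [CommRing R] (S : Finset ℕ) (b : ℕ) : R := (-1) ^ (S.filter (b < ·)).card

theorem sgn_erase_of_le {S : Finset ℕ} {a b : ℕ} (h : a ≤ b) :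
    sgn R (S.erase a) b = sgn R S b := by
  unfold sgn
  congr 2
  ext c
  simp only [Finset.mem_filter, Finset.mem_erase]
  constructor
  · rintro ⟨⟨_, h1⟩, h2⟩; exact ⟨h1, h2⟩
  · rintro ⟨h1, h2⟩; exact ⟨⟨by omega, h1⟩, h2⟩

theorem sgn_erase_of_lt {S : Finset ℕ} {a b : ℕ} (ha : a ∈ S) (h : b < a) :
    sgn R (S.erase a) b = -sgn R S b := by
  unfold sgn
  have : (S.erase a).filter (b < ·) = (S.filter (b < ·)).erase a := by
    rw [Finset.filter_erase]
  have hm : a ∈ S.filter (b < ·) := Finset.mem_filter.2 ⟨ha, h⟩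
  rw [this, ← Finset.card_erase_add_one hm, pow_succ]
  ring

/-- Removing the larger index first changes the position of the smaller one by one, while the
opposite order has no such effect. This antisymmetry drives all the cancellations below. -/
theorem sgn_mul_sgn_erase {S : Finset ℕ} {a b : ℕ} (ha : a ∈ S) (hb : b ∈ S) (hab : a ≠ b) :
    sgn R S a * sgn R (S.erase a) b = -(sgn R S b * sgn R (S.erase b) a) := by
  rcases lt_or_gt_of_ne hab with h | h
  · rw [sgn_erase_of_le h.le, sgn_erase_of_lt hb h]; ring
  · rw [sgn_erase_of_lt ha h, sgn_erase_of_le h.le]; ring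

theorem sgn_max {S : Finset ℕ} {a : ℕ} (h : ∀ b ∈ S, b ≤ a) : sgn R S a = 1 := by
  unfold sgn
  rw [Finset.filter_false_of_mem fun b hb => not_lt.2 (h b hb)]
  simp

theorem sgn_zero {S : Finset ℕ} (h : 0 ∈ S) : sgn R S 0 = (-1) ^ (S.card - 1) := by
  unfold sgn
  rw [← Finset.card_erase_of_mem h]
  congr 2
  ext c
  simp only [Finset.mem_filter, Finset.mem_erase]
  constructor
  · rintro ⟨h1, h2⟩; exact ⟨by omega, h1⟩
  · rintro ⟨h1, h2⟩; exact ⟨h2, by omega⟩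

theorem sum_sum_erase_comm {M : Type*} [AddCommMonoid M] (S : Finset ℕ) (F : ℕ → ℕ → M) :
    ∑ a ∈ S, ∑ b ∈ S.erase a, F a b = ∑ b ∈ S, ∑ a ∈ S.erase b, F a b :=
  Finset.sum_comm' fun a b => by
    simp only [Finset.mem_erase]
    constructor
    · rintro ⟨h1, h2, h3⟩; exact ⟨⟨h2.symm, h1⟩, h3⟩
    · rintro ⟨⟨h1, h2⟩, h3⟩; exact ⟨h2, h1.symm, h3⟩

theorem sum_sum_erase_eq_zero (S : Finset ℕ) (F : ℕ → ℕ → R)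
    (h : ∀ a ∈ S, ∀ b ∈ S, a ≠ b → F a b = -F b a) : ∑ a ∈ S, ∑ b ∈ S.erase a, F a b = 0 := by
  have e : ∑ a ∈ S, ∑ b ∈ S.erase a, F a b = ∑ p ∈ S.offDiag, F p.1 p.2 :=
    (Finset.sum_finset_product (f := fun p => F p.1 p.2) S.offDiag S (fun a => S.erase a) (by
      rintro ⟨a, b⟩
      simp only [Finset.mem_offDiag, Finset.mem_erase]
      tauto)).symm
  rw [e]
  refine Finset.sum_involution (fun p _ => (p.2, p.1)) ?_ ?_ ?_ ?_
  · rintro ⟨a, b⟩ hp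
    obtain ⟨h1, h2, h3⟩ := Finset.mem_offDiag.1 hp
    rw [h a h1 b h2 h3]; ring
  · rintro ⟨a, b⟩ hp - heq
    obtain ⟨h1, h2, h3⟩ := Finset.mem_offDiag.1 hp
    exact h3 (Prod.ext_iff.1 heq).2
  · rintro ⟨a, b⟩ hp
    obtain ⟨h1, h2, h3⟩ := Finset.mem_offDiag.1 hp
    exact Finset.mem_offDiag.2 ⟨h2, h1, h3.symm⟩
  · rintro ⟨a, b⟩ hp
    rfl

/-- The Pfaffian of `A` on the index set `S` of cardinality `2m`, listed in decreasing order, by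
expansion along the largest index. -/
def pf (A : ℕ → ℕ → R) : ℕ → Finset ℕ → R
  | 0, _ => 1
  | m + 1, S => ∑ b ∈ S.erase (S.sup id), sgn R (S.erase (S.sup id)) b * A (S.sup id) b *
      pf A m ((S.erase (S.sup id)).erase b)

theorem sup_id_eq {S : Finset ℕ} {M : ℕ} (hM : M ∈ S) (h : ∀ b ∈ S, b ≤ M) : S.sup id = M :=
  le_antisymm (Finset.sup_le h) (Finset.le_sup (f := id) hM)

theorem pf_succ (A : ℕ → ℕ → R) (m : ℕ) {S : Finset ℕ} {M : ℕ} (hM : M ∈ S)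
    (h : ∀ b ∈ S, b ≤ M) :
    pf A (m + 1) S = ∑ b ∈ S.erase M, sgn R (S.erase M) b * A M b *
      pf A m ((S.erase M).erase b) := by
  rw [pf, sup_id_eq hM h]

theorem exists_max_of_card {S : Finset ℕ} (h : S.card ≠ 0) : ∃ M ∈ S, ∀ b ∈ S, b ≤ M :=
  S.exists_max_image id (Finset.card_ne_zero.1 h)

/-- The correction term in the behaviour of a Pfaffian under a modification of rank two. -/
def pfTwo (A : ℕ → ℕ → R) (u v : ℕ → R) (m : ℕ) (S : Finset ℕ) : R :=
  ∑ a ∈ S, ∑ c ∈ S.erase a, sgn R S a * sgn R (S.erase a) c * u a * v c *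
    pf A (m - 1) ((S.erase a).erase c)

theorem pfTwo_antisymm (A : ℕ → ℕ → R) (u : ℕ → R) (m : ℕ) (S : Finset ℕ) :
    pfTwo A u u m S = 0 := by
  refine sum_sum_erase_eq_zero S _ fun a ha b hb hab => ?_
  rw [sgn_mul_sgn_erase ha hb hab, Finset.erase_right_comm]
  ring

/-- The expansion of u ∧ u ∧ v = 0. Together with its companion for v ∧ u ∧ v, it removes all terms
quadratic in the modification u ∧ v. -/
theorem sum_mul_pfTwo_left (A : ℕ → ℕ → R) (u v : ℕ → R) (m : ℕ) (T : Finset ℕ) :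
    ∑ b ∈ T, sgn R T b * u b * pfTwo A u v m (T.erase b) = 0 := by
  simp only [pfTwo, Finset.mul_sum]
  refine sum_sum_erase_eq_zero T _ fun a ha b hb hab => ?_
  rw [← Finset.sum_neg_distrib, Finset.erase_right_comm]
  refine Finset.sum_congr rfl fun c _ => ?_
  have := sgn_mul_sgn_erase (R := R) ha hb hab
  linear_combination (u a * u b * sgn R ((T.erase b).erase a) c * v c *
    pf A (m - 1) (((T.erase b).erase a).erase c)) * this

theorem sum_mul_pfTwo_right (A : ℕ → ℕ → R) (u v : ℕ → R) (m : ℕ) (T : Finset ℕ) :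
    ∑ b ∈ T, sgn R T b * v b * pfTwo A u v m (T.erase b) = 0 := by
  simp only [pfTwo, Finset.mul_sum]
  rw [sum_sum_erase_comm]
  refine Finset.sum_eq_zero fun a ha => ?_
  simp only [Finset.erase_right_comm (b := a)]
  refine sum_sum_erase_eq_zero (T.erase a) _ fun b hb c hc hbc => ?_
  have hb' := Finset.mem_erase.1 hb
  have hc' := Finset.mem_erase.1 hc
  rw [Finset.erase_right_comm (a := b) (b := c)]
  have h1 := sgn_mul_sgn_erase (R := R) hb'.2 ha hb'.1
  have h2 := sgn_mul_sgn_erase (R := R) hc'.2 ha hc'.1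
  have h3 := sgn_mul_sgn_erase (R := R) hb hc hbc
  linear_combination (v b * u a * v c * pf A (m - 1) (((T.erase a).erase c).erase b)) *
    (sgn R ((T.erase a).erase b) c * h1 + sgn R ((T.erase a).erase c) b * h2 - sgn R T a * h3)

/-- Collects the correction terms in which M is not deleted: expanding their Pfaffians along M and
exchanging the order of deletion gives the left side. -/
theorem sum_mul_pfTwo_pf (A : ℕ → ℕ → R) (u v : ℕ → R) (m M : ℕ) (T : Finset ℕ)
    (hT : ∀ b ∈ T, b < M) (hcard : T.card = 2 * m + 1) :
    ∑ b ∈ T, sgn R T b * A M b * pfTwo A u v m (T.erase b) =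
      ∑ a ∈ T, ∑ c ∈ T.erase a, sgn R T a * sgn R (T.erase a) c * u a * v c *
        pf A m ((insert M T |>.erase a).erase c) := by
  rcases m with _ | m
  · obtain ⟨a, rfl⟩ := Finset.card_eq_one.1 hcard
    simp [pfTwo]
  simp only [pfTwo, Finset.mul_sum, Nat.add_sub_cancel]
  rw [sum_sum_erase_comm]
  refine Finset.sum_congr rfl fun a ha => ?_
  simp only [Finset.erase_right_comm (b := a)]
  rw [sum_sum_erase_comm]
  refine Finset.sum_congr rfl fun c hc => ?_
  have hMa : M ≠ a := (hT a ha).ne'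
  have hMc : M ≠ c := (hT c (Finset.mem_of_mem_erase hc)).ne'
  have hMT : M ∉ T := fun h => (hT M h).false
  have e : ((insert M T).erase a).erase c = insert M ((T.erase a).erase c) := by
    rw [Finset.erase_insert_of_ne hMa, Finset.erase_insert_of_ne hMc]
  rw [e, pf_succ A m (Finset.mem_insert_self _ _), Finset.erase_insert, Finset.mul_sum]
  · refine Finset.sum_congr rfl fun b hb => ?_
    have hb' := Finset.mem_erase.1 hb
    have hb'' := Finset.mem_erase.1 hb'.2
    have h1 := sgn_mul_sgn_erase (R := R) hb''.2 ha hb''.1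
    have h2 := sgn_mul_sgn_erase (R := R) hb'.2 hc hb'.1
    rw [Finset.erase_right_comm (a := b) (b := c)]
    linear_combination (A M b * u a * v c * pf A m (((T.erase a).erase c).erase b)) *
      (sgn R ((T.erase a).erase b) c * h1 - sgn R T a * h2)
  · simp [hMT]
  · intro b hb
    rcases Finset.mem_insert.1 hb with rfl | hb
    · exact le_rfl
    · exact (hT b (Finset.mem_of_mem_erase (Finset.mem_of_mem_erase hb))).le

theorem pfTwo_insert (A : ℕ → ℕ → R) (u v : ℕ → R) (m M : ℕ) (T : Finset ℕ)
    (hT : ∀ b ∈ T, b < M) :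
    pfTwo A u v (m + 1) (insert M T) =
      ∑ b ∈ T, sgn R T b * (u M * v b - v M * u b) * pf A m (T.erase b) +
      ∑ a ∈ T, ∑ c ∈ T.erase a, sgn R T a * sgn R (T.erase a) c * u a * v c *
        pf A m ((insert M T |>.erase a).erase c) := by
  have hMT : M ∉ T := fun h => (hT M h).false
  have hmax : ∀ b ∈ insert M T, b ≤ M := fun b hb => by
    rcases Finset.mem_insert.1 hb with rfl | hb
    · exact le_rfl
    · exact (hT b hb).le
  have hs : ∀ a ∈ T, sgn R (insert M T) a = -sgn R T a := fun a ha => by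
    have := sgn_erase_of_lt (R := R) (Finset.mem_insert_self M T) (hT a ha)
    rw [Finset.erase_insert hMT] at this
    rw [this, neg_neg]
  rw [pfTwo, Finset.sum_insert hMT, Finset.erase_insert hMT, sgn_max hmax, Nat.add_sub_cancel]
  have hrow : ∀ a ∈ T, ∑ c ∈ (insert M T).erase a, sgn R (insert M T) a *
      sgn R ((insert M T).erase a) c * u a * v c * pf A m (((insert M T).erase a).erase c) =
      -(sgn R T a * u a * v M * pf A m (T.erase a)) +
      ∑ c ∈ T.erase a, sgn R T a * sgn R (T.erase a) c * u a * v c *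
        pf A m ((insert M T |>.erase a).erase c) := by
    intro a ha
    have hMa : M ≠ a := (hT a ha).ne'
    have hMa' : M ∉ T.erase a := fun h => hMT (Finset.mem_of_mem_erase h)
    rw [Finset.erase_insert_of_ne hMa, Finset.sum_insert hMa', Finset.erase_insert hMa', hs a ha,
      sgn_max (S := insert M (T.erase a)) (a := M)]
    · congr 1
      · ring
      · refine Finset.sum_congr rfl fun c hc => ?_
        have hc' := Finset.mem_of_mem_erase hc
        have hh : sgn R (insert M (T.erase a)) c = -sgn R (T.erase a) c := by
          have := sgn_erase_of_lt (R := R) (Finset.mem_insert_self M (T.erase a)) (hT c hc')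
          rw [Finset.erase_insert hMa'] at this
          rw [this, neg_neg]
        rw [hh]
        ring
    · intro b hb
      rcases Finset.mem_insert.1 hb with rfl | hb
      · exact le_rfl
      · exact (hT b (Finset.mem_of_mem_erase hb)).le
  rw [Finset.sum_congr rfl hrow, Finset.sum_add_distrib, ← add_assoc, ← Finset.sum_add_distrib]
  congr 1
  refine Finset.sum_congr rfl fun b _ => ?_
  ring

/-- The effect on a Pfaffian of a ring endomorphism that changes the matrix by `u ∧ v`. -/
theorem map_pf (A : ℕ → ℕ → R) (u v : ℕ → R) (s : R →+* R)
    (hs : ∀ a b, b < a → s (A a b) = A a b - (u a * v b - v a * u b)) (m : ℕ) (S : Finset ℕ)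
    (hS : S.card = 2 * m) : s (pf A m S) = pf A m S - pfTwo A u v m S := by
  induction m generalizing S with
  | zero =>
    obtain rfl := Finset.card_eq_zero.1 hS
    simp [pf, pfTwo]
  | succ m ih =>
    obtain ⟨M, hM, hmax⟩ := exists_max_of_card (S := S) (by omega)
    obtain ⟨T, hMT, rfl⟩ : ∃ T, M ∉ T ∧ S = insert M T :=
      ⟨S.erase M, Finset.notMem_erase _ _, (Finset.insert_erase hM).symm⟩
    have hT : ∀ b ∈ T, b < M := fun b hb =>
      lt_of_le_of_ne (hmax b (Finset.mem_insert_of_mem hb)) fun h => hMT (h ▸ hb)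
    rw [Finset.card_insert_of_notMem hMT] at hS
    have hsg : ∀ b, s (sgn R T b) = sgn R T b := fun b => by simp [sgn]
    rw [pfTwo_insert A u v m M T hT, pf_succ A m hM hmax, Finset.erase_insert hMT, map_sum,
      ← sum_mul_pfTwo_pf A u v m M T hT (by omega)]
    -- The last bracket is quadratic in u ∧ v and vanishes after summation over b; the middle one
    -- assembles to `pfTwo` on the larger set.
    have step : ∀ b ∈ T, s (sgn R T b * A M b * pf A m (T.erase b)) =
        sgn R T b * A M b * pf A m (T.erase b) -
        (sgn R T b * (u M * v b - v M * u b) * pf A m (T.erase b) +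
          sgn R T b * A M b * pfTwo A u v m (T.erase b)) +
        (u M * (sgn R T b * v b * pfTwo A u v m (T.erase b)) -
          v M * (sgn R T b * u b * pfTwo A u v m (T.erase b))) := by
      intro b hb
      rw [map_mul, map_mul, hsg, hs M b (hT b hb),
        ih (T.erase b) (by rw [Finset.card_erase_of_mem hb]; omega)]
      ring
    rw [Finset.sum_congr rfl step, Finset.sum_add_distrib, Finset.sum_sub_distrib,
      Finset.sum_add_distrib, Finset.sum_sub_distrib, ← Finset.mul_sum, ← Finset.mul_sum,
      sum_mul_pfTwo_left, sum_mul_pfTwo_right]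
    ring

/-- Expansion of a Pfaffian along the index `0`. -/
theorem pf_insert_zero (A : ℕ → ℕ → R) (m : ℕ) (T : Finset ℕ) (h0 : 0 ∉ T)
    (hT : T.card = 2 * m + 1) :
    pf A (m + 1) (insert 0 T) = ∑ c ∈ T, sgn R T c * A c 0 * pf A m (T.erase c) := by
  induction m generalizing T with
  | zero =>
    obtain ⟨a, rfl⟩ := Finset.card_eq_one.1 hT
    have ha : a ≠ 0 := fun h => h0 (by simp [h])
    rw [pf_succ A 0 (M := a) (by simp) (by simp)]
    have : (insert 0 {a} : Finset ℕ).erase a = {0} := by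
      ext c; simp only [Finset.mem_erase, Finset.mem_insert, Finset.mem_singleton]; omega
    rw [this]
    simp [pf, sgn, Finset.filter_singleton]
  | succ m ih =>
    obtain ⟨M, hM, hmax⟩ := exists_max_of_card (S := T) (by omega)
    have hM0 : M ≠ 0 := fun h => h0 (h ▸ hM)
    obtain ⟨U, hMU, rfl⟩ : ∃ U, M ∉ U ∧ T = insert M U :=
      ⟨T.erase M, Finset.notMem_erase _ _, (Finset.insert_erase hM).symm⟩
    have hU : ∀ b ∈ U, b < M := fun b hb =>
      lt_of_le_of_ne (hmax b (Finset.mem_insert_of_mem hb)) fun h => hMU (h ▸ hb)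
    have h0U : 0 ∉ U := fun h => h0 (Finset.mem_insert_of_mem h)
    rw [Finset.card_insert_of_notMem hMU] at hT
    have e1 : (insert 0 (insert M U)).erase M = insert 0 U := by
      rw [Finset.erase_insert_of_ne hM0.symm, Finset.erase_insert hMU]
    have hne : ∀ c ∈ U, c ≠ 0 := fun c hc h => h0U (h ▸ hc)
    have hs0 : ∀ c ∈ U, sgn R (insert 0 U) c = sgn R U c := fun c hc => by
      have := sgn_erase_of_le (R := R) (S := insert 0 U) (Nat.zero_le c)
      rw [Finset.erase_insert h0U] at this
      exact this.symm
    have hsM : ∀ c ∈ U, sgn R (insert M U) c = -sgn R U c := fun c hc => by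
      have := sgn_erase_of_lt (R := R) (Finset.mem_insert_self M U) (hU c hc)
      rw [Finset.erase_insert hMU] at this
      rw [this, neg_neg]
    rw [pf_succ A (m + 1) (M := M) (by simp) (by
        intro b hb
        rcases Finset.mem_insert.1 hb with rfl | hb
        · omega
        · exact hmax b hb), e1, Finset.sum_insert h0U, Finset.sum_insert hMU,
      Finset.erase_insert h0U, Finset.erase_insert hMU, sgn_max hmax,
      sgn_zero (Finset.mem_insert_self _ _), Finset.card_insert_of_notMem h0U]
    have hpow : (-1 : R) ^ (U.card + 1 - 1) = 1 :=
      Even.neg_one_pow ⟨m + 1, by omega⟩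
    rw [hpow]
    congr 1
    have l : ∀ b ∈ U, sgn R (insert 0 U) b * A M b * pf A (m + 1) ((insert 0 U).erase b) =
        ∑ c ∈ U.erase b, sgn R U b * sgn R (U.erase b) c * A M b * A c 0 *
          pf A m ((U.erase b).erase c) := by
      intro b hb
      rw [Finset.erase_insert_of_ne (hne b hb).symm, ih (U.erase b)
        (fun h => h0U (Finset.mem_of_mem_erase h))
        (by rw [Finset.card_erase_of_mem hb]; omega), hs0 b hb, Finset.mul_sum]
      exact Finset.sum_congr rfl fun c _ => by ring
    have r : ∀ c ∈ U, sgn R (insert M U) c * A c 0 * pf A (m + 1) ((insert M U).erase c) =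
        ∑ b ∈ U.erase c, sgn R U b * sgn R (U.erase b) c * A M b * A c 0 *
          pf A m ((U.erase b).erase c) := by
      intro c hc
      have hMc : M ∉ U.erase c := fun h => hMU (Finset.mem_of_mem_erase h)
      rw [Finset.erase_insert_of_ne (hU c hc).ne', pf_succ A m (Finset.mem_insert_self _ _) (by
        intro b hb
        rcases Finset.mem_insert.1 hb with rfl | hb
        · exact le_rfl
        · exact (hU b (Finset.mem_of_mem_erase hb)).le), Finset.erase_insert hMc, hsM c hc,
        Finset.mul_sum]
      refine Finset.sum_congr rfl fun b hb => ?_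
      have hb' := Finset.mem_erase.1 hb
      have := sgn_mul_sgn_erase (R := R) hb'.2 hc hb'.1
      rw [Finset.erase_right_comm (a := b)]
      linear_combination (-(A M b * A c 0 * pf A m ((U.erase c).erase b))) * this
    rw [Finset.sum_congr rfl l, Finset.sum_congr rfl r, sum_sum_erase_comm]

theorem sgn_image {k : ℕ} {f : Fin k → ℕ} (hf : StrictAnti f) (j : Fin k) :
    sgn R (Finset.univ.image f) (f j) = (-1) ^ (j : ℕ) := by
  unfold sgn
  congr 1
  have : (Finset.univ.image f).filter (f j < ·) = (Finset.Iio j).image f := by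
    ext c
    simp only [Finset.mem_filter, Finset.mem_image, Finset.mem_univ, true_and, Finset.mem_Iio]
    constructor
    · rintro ⟨⟨i, rfl⟩, h⟩; exact ⟨i, hf.lt_iff_gt.1 h, rfl⟩
    · rintro ⟨i, h, rfl⟩; exact ⟨⟨i, rfl⟩, hf.lt_iff_gt.2 h⟩
  rw [this, Finset.card_image_of_injective _ hf.injective, Fin.card_Iio]

theorem image_erase_succAbove {k : ℕ} {f : Fin (k + 1) → ℕ} (hf : Function.Injective f)
    (j : Fin (k + 1)) :
    (Finset.univ.image f).erase (f j) = Finset.univ.image (fun i => f (j.succAbove i)) := by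
  ext c
  simp only [Finset.mem_erase, Finset.mem_image, Finset.mem_univ, true_and]
  constructor
  · rintro ⟨h, i, rfl⟩
    obtain ⟨l, rfl⟩ := Fin.exists_succAbove_eq (y := j) (x := i) fun h' => h (by rw [h'])
    exact ⟨l, rfl⟩
  · rintro ⟨i, rfl⟩
    exact ⟨fun h => Fin.succAbove_ne j i (hf h), _, rfl⟩

theorem pfaffian_eq_pf (A : ℕ → ℕ → R) (m : ℕ) (f : Fin (2 * m) → ℕ) (hf : StrictAnti f) :
    pfaffian m (fun i j => A (f i) (f j)) = pf A m (Finset.univ.image f) := by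
  induction m with
  | zero => rfl
  | succ m ih =>
    have hf' : StrictAnti (fun i : Fin (2 * m + 1) => f i.succ) := fun i j h =>
      hf (Fin.succ_lt_succ_iff.2 h)
    have e1 : (Finset.univ.image f).erase (f 0) =
        Finset.univ.image (fun i : Fin (2 * m + 1) => f i.succ) :=
      image_erase_succAbove (k := 2 * m + 1) hf.injective 0
    rw [pf_succ A m (M := f 0) (Finset.mem_image_of_mem _ (Finset.mem_univ _)) (by
        intro b hb
        obtain ⟨i, -, rfl⟩ := Finset.mem_image.1 hb
        exact hf.antitone (Nat.zero_le _)), e1,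
      Finset.sum_image hf'.injective.injOn]
    rw [pfaffian]
    refine Finset.sum_congr rfl fun j _ => ?_
    rw [sgn_image hf', image_erase_succAbove hf'.injective]
    congr 1
    exact ih (fun i => f (j.succAbove i).succ) fun a b h =>
      hf' ((Fin.strictMono_succAbove j) h)

end Pfaffian

/-! ### Divided differences of `P̃`-polynomials -/

theorem sgn_fixed (k : ℕ) (S : Finset ℕ) (b : ℕ) : sAct n k (sgn (Poly n) S b) = sgn _ S b := by
  simp [sgn]

theorem pf_symm (m : ℕ) (S : Finset ℕ) : SymmX (pf (qVar n) m S) := by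
  intro k
  induction m generalizing S with
  | zero => exact map_one _
  | succ m ih =>
    rw [pf, map_sum]
    refine Finset.sum_congr rfl fun b _ => ?_
    rw [map_mul, map_mul, sgn_fixed, qVar_symm _ _ k, ih]

/-- The change of the Pfaffian is governed by e ∧ s_0(e). Subtracting the vanishing e ∧ e replaces
s_0(e_b) by s_0(e_b) - e_b = -x_1∂'_0(e_b), and x_1 cancels. -/
theorem bDiff_zero_pf (m : ℕ) (S : Finset ℕ) (hS : S.card = 2 * m) :
    bDiff (n + 1) 0 (pf (qVar (n + 1)) m S) = -∑ a ∈ S, ∑ b ∈ S.erase a,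
      sgn _ S a * sgn _ (S.erase a) b * eVar (n + 1) a * bDiff (n + 1) 0 (eVar (n + 1) b) *
        pf (qVar (n + 1)) (m - 1) ((S.erase a).erase b) := by
  apply bDiff_eq_of_root_mul (by omega)
  have h1 := map_pf (qVar (n + 1)) (eVar (n + 1)) (fun b => sAct (n + 1) 0 (eVar (n + 1) b))
    (sAct (n + 1) 0) (fun a b h => sAct_zero_qVar h) m S hS
  have h2 := pfTwo_antisymm (qVar (n + 1)) (eVar (n + 1)) m S
  rw [h1, sub_sub_cancel, ← sub_zero (pfTwo _ _ _ _ _), ← h2]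
  simp only [pfTwo, ← Finset.sum_sub_distrib, Finset.mul_sum, mul_neg, ← Finset.sum_neg_distrib]
  refine Finset.sum_congr rfl fun a _ => Finset.sum_congr rfl fun b _ => ?_
  have := root_mul_bDiff (n := n + 1) (k := 0) (by omega) (eVar (n + 1) b)
  linear_combination (-(sgn _ S a * sgn _ (S.erase a) b * eVar (n + 1) a *
        pf (qVar (n + 1)) (m - 1) ((S.erase a).erase b))) * this

/-- In each summand of ∂'_0 of the Pfaffian every factor except ∂'_0(e_b) is symmetric and leaves
the chain, which then selects b = n + 1 - r. -/
theorem chain_xVar_pow_mul_pf (m : ℕ) (S : Finset ℕ) (hS : S.card = 2 * m) {r : ℕ} (hr : r ≤ n) :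
    chain (n + 1) 0 (n + 1) (xVar (n + 1) 0 ^ r * pf (qVar (n + 1)) m S) =
      if n + 1 - r ∈ S then 2 * sgn _ S (n + 1 - r) * ∑ a ∈ S.erase (n + 1 - r),
        sgn _ (S.erase (n + 1 - r)) a * eVar (n + 1) a *
          pf (qVar (n + 1)) (m - 1) ((S.erase (n + 1 - r)).erase a) else 0 := by
  set t := n + 1 - r with ht
  rw [chain_xVar_pow_mul_of_symmX (pf_symm m S) hr, bDiff_zero_pf m S hS]
  simp only [mul_neg, Finset.mul_sum, map_neg, map_sum]
  have step : ∀ a ∈ S, ∀ b ∈ S.erase a, (-1) ^ r * chain (n + 1) 1 n (xVar (n + 1) 0 ^ r *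
      (sgn _ S a * sgn _ (S.erase a) b * eVar (n + 1) a * bDiff (n + 1) 0 (eVar (n + 1) b) *
        pf (qVar (n + 1)) (m - 1) ((S.erase a).erase b))) =
      if b = t then sgn _ S a * sgn _ (S.erase a) b * eVar (n + 1) a *
        pf (qVar (n + 1)) (m - 1) ((S.erase a).erase b) * 2 else 0 := by
    intro a _ b _
    have hsym : SymmX (sgn (Poly (n + 1)) S a * sgn (Poly (n + 1)) (S.erase a) b * eVar (n + 1) a *
        pf (qVar (n + 1)) (m - 1) ((S.erase a).erase b)) := fun k => by
      rw [map_mul, map_mul, map_mul, sgn_fixed, sgn_fixed, eVar_symm _ k, pf_symm _ _ k]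
    have h := chain_xVar_pow_mul_bDiff_eVar hr b
    rw [← ht] at h
    rw [show ∀ X s1 s2 e d p : Poly (n + 1), X * (s1 * s2 * e * d * p) = (s1 * s2 * e * p) * (X * d)
      from fun X s1 s2 e d p => by ring, hsym.chain_mul 0, mul_left_comm, h, mul_ite, mul_zero]
  rw [Finset.sum_congr rfl fun a ha => Finset.sum_congr rfl (step a ha), sum_sum_erase_comm]
  have inner : ∀ b ∈ S, ∑ a ∈ S.erase b, (if b = t then sgn (Poly (n + 1)) S a *
      sgn _ (S.erase a) b * eVar (n + 1) a *
        pf (qVar (n + 1)) (m - 1) ((S.erase a).erase b) * 2 else 0) =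
      if b = t then ∑ a ∈ S.erase t, sgn (Poly (n + 1)) S a *
      sgn _ (S.erase a) t * eVar (n + 1) a *
        pf (qVar (n + 1)) (m - 1) ((S.erase a).erase t) * 2 else 0 := by
    intro b _
    split_ifs with h
    · rw [h]
    · simp
  rw [Finset.sum_congr rfl inner, Finset.sum_ite_eq']
  split_ifs with hmem
  · rw [← Finset.sum_neg_distrib]
    refine Finset.sum_congr rfl fun a ha => ?_
    have ha' := Finset.mem_erase.1 ha
    have := sgn_mul_sgn_erase (R := Poly (n + 1)) ha'.2 hmem ha'.1
    rw [Finset.erase_right_comm (a := a)]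
    linear_combination (-2 * eVar (n + 1) a *
        pf (qVar (n + 1)) (m - 1) ((S.erase t).erase a)) * this
  · exact neg_zero

theorem map_pfaffian {R R' : Type*} [CommRing R] [CommRing R'] (φ : R →+* R') (m : ℕ)
    (A : Fin (2 * m) → Fin (2 * m) → R) :
    φ (pfaffian m A) = pfaffian m (fun i j => φ (A i j)) := by
  induction m with
  | zero => exact map_one φ
  | succ m ih =>
    rw [pfaffian, pfaffian, map_sum]
    refine Finset.sum_congr rfl fun j _ => ?_
    rw [map_mul, map_mul, map_pow, map_neg, map_one, ih]

/-- The index set of the Pfaffian of `lam`: a zero part is added to `lam` if its length is odd. -/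
def evenHull (lam : Finset ℕ) : Finset ℕ := if Even lam.card then lam else insert 0 lam

/-- `Q̃_λ(X)` as a Pfaffian over a set of indices. -/
def qTildeX (n : ℕ) (lam : Finset ℕ) : Poly n :=
  pf (qVar n) ((lam.card + 1) / 2) (evenHull lam)

theorem part_eq_zero {lam : Finset ℕ} {i : ℕ} (h : lam.card ≤ i) : part lam i = 0 := by
  rw [part, List.getD_eq_default _ _ (by simpa using h)]

theorem image_part (lam : Finset ℕ) :
    Finset.univ.image (fun i : Fin lam.card => part lam i) = lam := by
  refine Finset.eq_of_subset_of_card_le ?_ ?_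
  · intro b hb
    obtain ⟨i, -, rfl⟩ := Finset.mem_image.1 hb
    exact part_mem i.2
  · rw [Finset.card_image_of_injective, Finset.card_univ, Fintype.card_fin]
    have : StrictAnti (fun i : Fin lam.card => part lam i) := fun i j h => part_lt_part h j.2
    exact this.injective

theorem rename_qTilde {lam : Finset ℕ} (h0 : 0 ∉ lam) :
    (MvPolynomial.rename Sum.inl (qTilde n lam) : Poly n) = qTildeX n lam := by
  set φ : MvPolynomial (Fin n) ZHalf →+* Poly n := (MvPolynomial.rename Sum.inl).toRingHom with hφ
  have h1 : (MvPolynomial.rename Sum.inl (qTilde n lam) : Poly n) = φ (qTilde n lam) := rfl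
  have hpos : ∀ i, i < lam.card → 0 < part lam i := fun i hi =>
    Nat.pos_of_ne_zero fun h => h0 (h ▸ part_mem hi)
  have hanti : StrictAnti (fun i : Fin (2 * ((lam.card + 1) / 2)) => part lam i) := by
    intro i j hij
    rw [Fin.lt_def] at hij
    change part lam j < part lam i
    by_cases hj : (j : ℕ) < lam.card
    · exact part_lt_part hij hj
    · rw [part_eq_zero (not_lt.1 hj)]
      exact hpos _ (by omega)
  have h2 := pfaffian_eq_pf (qVar n) _ _ hanti
  rw [h1, qTilde, map_pfaffian]
  refine h2.trans ?_
  rw [qTildeX]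
  congr 1
  unfold evenHull
  have hmem : ∀ c, c ∈ lam ↔ ∃ i : Fin lam.card, part lam i = c := fun c => by
    conv_lhs => rw [← image_part lam]
    simp only [Finset.mem_image, Finset.mem_univ, true_and]
  ext c
  split_ifs with he
  · have e : 2 * ((lam.card + 1) / 2) = lam.card := by obtain ⟨d, hd⟩ := he; omega
    rw [hmem]
    simp only [Finset.mem_image, Finset.mem_univ, true_and]
    constructor
    · rintro ⟨i, rfl⟩; exact ⟨⟨i, by omega⟩, rfl⟩
    · rintro ⟨i, rfl⟩; exact ⟨⟨i, by omega⟩, rfl⟩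
  · have e : 2 * ((lam.card + 1) / 2) = lam.card + 1 := by
      obtain ⟨d, hd⟩ := Nat.not_even_iff_odd.1 he; omega
    simp only [Finset.mem_insert, Finset.mem_image, Finset.mem_univ, true_and, hmem]
    constructor
    · rintro ⟨i, rfl⟩
      by_cases hi : (i : ℕ) < lam.card
      · exact Or.inr ⟨⟨i, hi⟩, rfl⟩
      · exact Or.inl (part_eq_zero (not_lt.1 hi))
    · rintro (rfl | ⟨i, rfl⟩)
      · exact ⟨⟨lam.card, by omega⟩, part_eq_zero le_rfl⟩
      · exact ⟨⟨i, by omega⟩, rfl⟩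

/-- Let t be the selected part. For even length the remaining sum is the expansion along the index 0
of the Pfaffian of the odd set `lam.erase t`, because Q̃_{a,0} = e_a. For odd length the index 0 is
already present: its own term is the wanted Pfaffian, and the other terms, expanded along 0, carry
the symmetric products e_a e_c against antisymmetric signs and cancel. -/
theorem chain_xVar_pow_mul_qTildeX {lam : Finset ℕ} (h0 : 0 ∉ lam) {r : ℕ} (hr : r ≤ n) :
    chain (n + 1) 0 (n + 1) (xVar (n + 1) 0 ^ r * qTildeX (n + 1) lam) =
      if n + 1 - r ∈ lam then 2 * sgn _ lam (n + 1 - r) * qTildeX (n + 1) (lam.erase (n + 1 - r))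
      else 0 := by
  have ht0 : n + 1 - r ≠ 0 := by omega
  set t := n + 1 - r with ht
  rcases Nat.even_or_odd lam.card with he | ho
  · obtain ⟨m, hm⟩ := he
    have h1 : qTildeX (n + 1) lam = pf (qVar (n + 1)) m lam := by
      rw [qTildeX, evenHull, if_pos ⟨m, hm⟩, show (lam.card + 1) / 2 = m by omega]
    rw [h1, chain_xVar_pow_mul_pf m lam (by omega) hr, ← ht]
    split_ifs with hmem
    · congr 1
      have hc := Finset.card_erase_of_mem hmem
      have hcard := Finset.card_pos.2 ⟨t, hmem⟩
      obtain ⟨m, rfl⟩ : ∃ m', m = m' + 1 := ⟨m - 1, by omega⟩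
      rw [qTildeX, evenHull, if_neg (by rw [Nat.not_even_iff_odd]; exact ⟨m, by omega⟩),
        show ((lam.erase t).card + 1) / 2 = m + 1 by omega,
        pf_insert_zero _ _ _ (fun h => h0 (Finset.mem_of_mem_erase h)) (by omega)]
      simp only [qVar_zero_right, Nat.add_sub_cancel]
    · rfl
  · obtain ⟨m, hm⟩ := ho
    have h1 : qTildeX (n + 1) lam = pf (qVar (n + 1)) (m + 1) (insert 0 lam) := by
      rw [qTildeX, evenHull, if_neg (by rw [Nat.not_even_iff_odd]; exact ⟨m, hm⟩),
        show (lam.card + 1) / 2 = m + 1 by omega]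
    rw [h1, chain_xVar_pow_mul_pf (m + 1) _ (by rw [Finset.card_insert_of_notMem h0]; omega) hr,
      ← ht]
    have hiff : t ∈ insert 0 lam ↔ t ∈ lam := by simp [ht0]
    simp only [hiff]
    split_ifs with hmem
    · have hs : sgn (Poly (n + 1)) (insert 0 lam) t = sgn _ lam t := by
        have := sgn_erase_of_le (R := Poly (n + 1)) (S := insert 0 lam) (Nat.zero_le t)
        rw [Finset.erase_insert h0] at this
        exact this.symm
      have hc := Finset.card_erase_of_mem hmem
      rw [hs, Finset.erase_insert_of_ne ht0.symm, Nat.add_sub_cancel]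
      congr 1
      set U := lam.erase t with hU
      have h0U : 0 ∉ U := fun h => h0 (Finset.mem_of_mem_erase h)
      rw [Finset.sum_insert h0U, Finset.erase_insert h0U, sgn_zero (Finset.mem_insert_self _ _),
        Finset.card_insert_of_notMem h0U, Even.neg_one_pow ⟨m, by omega⟩, eVar_zero, qTildeX,
        evenHull, if_pos ⟨m, by omega⟩, show (U.card + 1) / 2 = m by omega, one_mul, one_mul]
      have hzero : ∑ a ∈ U, sgn (Poly (n + 1)) (insert 0 U) a * eVar (n + 1) a *
          pf (qVar (n + 1)) m ((insert 0 U).erase a) = 0 := by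
        have row : ∀ a ∈ U, sgn (Poly (n + 1)) (insert 0 U) a * eVar (n + 1) a *
            pf (qVar (n + 1)) m ((insert 0 U).erase a) =
            ∑ c ∈ U.erase a, sgn (Poly (n + 1)) U a * sgn _ (U.erase a) c * eVar (n + 1) a *
              eVar (n + 1) c * pf (qVar (n + 1)) (m - 1) ((U.erase a).erase c) := by
          intro a ha
          have hca := Finset.card_erase_of_mem ha
          have hpos := Finset.card_pos.2 ⟨a, ha⟩
          obtain ⟨m, rfl⟩ : ∃ m', m = m' + 1 := ⟨m - 1, by omega⟩
          have hs : sgn (Poly (n + 1)) (insert 0 U) a = sgn _ U a := by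
            have := sgn_erase_of_le (R := Poly (n + 1)) (S := insert 0 U) (Nat.zero_le a)
            rw [Finset.erase_insert h0U] at this
            exact this.symm
          rw [Finset.erase_insert_of_ne (fun h : 0 = a => h0U (h ▸ ha)), pf_insert_zero _ _ _
            (fun h => h0U (Finset.mem_of_mem_erase h)) (by omega), hs, Finset.mul_sum]
          refine Finset.sum_congr rfl fun c _ => ?_
          rw [qVar_zero_right, Nat.add_sub_cancel]
          ring
        rw [Finset.sum_congr rfl row]
        refine sum_sum_erase_eq_zero U _ fun a ha b hb hab => ?_
        rw [sgn_mul_sgn_erase ha hb hab, Finset.erase_right_comm (s := U) (a := a)]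
        ring
      rw [hzero, add_zero]
    · rfl

theorem pTildeX_eq {lam : Finset ℕ} (h0 : 0 ∉ lam) :
    pTildeX n lam = MvPolynomial.C (half ^ lam.card) * qTildeX n lam := by
  rw [pTildeX, pTilde, map_mul, MvPolynomial.rename_C, rename_qTilde h0]
  rfl

theorem pTildeX_symm {lam : Finset ℕ} (h0 : 0 ∉ lam) : SymmX (pTildeX n lam) := fun k => by
  rw [pTildeX_eq h0, map_mul, sAct_C, qTildeX, pf_symm _ _ k]

/-- Losing one part changes the normalization by exactly the factor 2 produced by the chain, so each
deletion has coefficient ±1. -/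
theorem chain_xVar_pow_mul_pTildeX {lam : Finset ℕ} (h0 : 0 ∉ lam) {b : ℕ} (hb : 1 ≤ b)
    (hbn : b ≤ n) :
    chain n 0 n (xVar n 0 ^ (n - b) * pTildeX n lam) =
      if b ∈ lam then sgn _ lam b * pTildeX n (lam.erase b) else 0 := by
  obtain ⟨n, rfl⟩ : ∃ n', n = n' + 1 := ⟨n - 1, by omega⟩
  rw [pTildeX_eq h0, mul_left_comm, chain_mul_left (fun k _ _ => sAct_C k _),
    chain_xVar_pow_mul_qTildeX h0 (by omega), show n + 1 - (n + 1 - b) = b by omega]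
  split_ifs with h
  · rw [pTildeX_eq (fun h' => h0 (Finset.mem_of_mem_erase h')), ← Finset.card_erase_add_one h,
      pow_succ, map_mul]
    have : (MvPolynomial.C half : Poly (n + 1)) * 2 = 1 := by
      have := congrArg (MvPolynomial.C : ZHalf → Poly (n + 1)) two_mul_half
      rw [map_mul, map_one, map_ofNat] at this
      rw [mul_comm]; exact this
    linear_combination (MvPolynomial.C (half ^ (lam.erase b).card) * sgn _ lam b *
      qTildeX (n + 1) (lam.erase b)) * this
  · exact mul_zero _

/-! ### The double sum -/

/-- The coefficient of `x^{n-b}` in `(x - y_1) ⋯ (x - y_{n-q})`. -/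
def yCoeff (n q b : ℕ) : Poly n := (-1) ^ (b + q) * elemY n q ((b : ℤ) - q)

theorem yCoeff_fixed (q b : ℕ) : FixedAll (yCoeff n q b) := fun k => by
  rw [yCoeff, map_mul, elemY_fixed, map_pow, map_neg, map_one]

/-- The terms with b < q are zero by the convention on negative indices; including them makes the
range independent of q. -/
theorem yProd_eq_sum_yCoeff {q : ℕ} (hq : 1 ≤ q) (hqn : q ≤ n) :
    yProd n (n - q) 0 = ∑ b ∈ Finset.Icc 1 n, yCoeff n q b * xVar n 0 ^ (n - b) := by
  have h1 : ∑ b ∈ Finset.Icc 1 n, yCoeff n q b * xVar n 0 ^ (n - b) =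
      ∑ b ∈ Finset.Ico q (n + 1), yCoeff n q b * xVar n 0 ^ (n - b) := by
    refine (Finset.sum_subset (fun b hb => ?_) fun b hb hb' => ?_).symm
    · simp only [Finset.mem_Ico, Finset.mem_Icc] at hb ⊢; omega
    · simp only [Finset.mem_Ico, Finset.mem_Icc] at hb hb'
      rw [yCoeff, elemY, if_neg (by omega), mul_zero, zero_mul]
  rw [h1, Finset.sum_Ico_eq_sum_range, yProd_eq_sum q 0 hqn, show n + 1 - q = n - q + 1 by omega]
  refine Finset.sum_congr rfl fun m _ => ?_
  rw [yCoeff, show ((q + m : ℕ) : ℤ) - q = m by push_cast; ring, show q + m + q = m + 2 * q by ring,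
    pow_add, pow_mul, neg_one_sq, one_pow, mul_one, show n - (q + m) = n - q - m by omega]

theorem zero_notMem {lam : Finset ℕ} (h : lam ∈ strictPartitions n) : 0 ∉ lam := fun h' => by
  simpa using Finset.mem_powerset.1 h h'

theorem sum_erase_eq_sum_insert {M : Type*} [AddCommMonoid M] (I : Finset ℕ)
    (F : Finset ℕ → ℕ → M) :
    ∑ ga ∈ I.powerset, ∑ b ∈ ga, F ga b = ∑ al ∈ I.powerset, ∑ b ∈ I \ al, F (insert b al) b := by
  rw [Finset.sum_sigma', Finset.sum_sigma']
  refine Finset.sum_bij' (fun p _ => ⟨p.1.erase p.2, p.2⟩) (fun p _ => ⟨insert p.2 p.1, p.2⟩)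
    ?_ ?_ ?_ ?_ ?_
  · rintro ⟨ga, b⟩ h
    simp only [Finset.mem_sigma, Finset.mem_powerset, Finset.mem_sdiff] at h ⊢
    exact ⟨(Finset.erase_subset _ _).trans h.1, h.1 h.2, Finset.notMem_erase _ _⟩
  · rintro ⟨al, b⟩ h
    simp only [Finset.mem_sigma, Finset.mem_powerset, Finset.mem_sdiff] at h ⊢
    exact ⟨Finset.insert_subset h.2.1 h.1, Finset.mem_insert_self _ _⟩
  · rintro ⟨ga, b⟩ h
    simp only [Finset.mem_sigma] at h
    simp [Finset.insert_erase h.2]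
  · rintro ⟨al, b⟩ h
    simp only [Finset.mem_sigma, Finset.mem_sdiff] at h
    simp [Finset.erase_insert h.2.2]
  · rintro ⟨ga, b⟩ h
    simp only [Finset.mem_sigma] at h
    simp [Finset.insert_erase h.2]

/-- The effect of one letter of λ' on an expansion in the P̃_α(X): deleting b from γ is read
backwards, so the new coefficient at α collects the old ones at α ∪ {b}. -/
theorem chain_yProd_mul_sum {q : ℕ} (hq : 1 ≤ q) (hqn : q ≤ n) (c : Finset ℕ → Poly n)
    (hc : ∀ ga, FixedAll (c ga)) :
    chain n 0 n (yProd n (n - q) 0 * ∑ ga ∈ strictPartitions n, pTildeX n ga * c ga) =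
      ∑ al ∈ strictPartitions n, pTildeX n al *
        ∑ b ∈ Finset.Icc 1 n \ al, sgn _ al b * yCoeff n q b * c (insert b al) := by
  have h1 : ∀ ga ∈ strictPartitions n,
      chain n 0 n (yProd n (n - q) 0 * (pTildeX n ga * c ga)) =
      ∑ b ∈ ga, pTildeX n (ga.erase b) * (sgn _ ga b * yCoeff n q b * c ga) := by
    intro ga hga
    have h0 := zero_notMem hga
    have e : yProd n (n - q) 0 * (pTildeX n ga * c ga) = ∑ b ∈ Finset.Icc 1 n,
        (yCoeff n q b * c ga) * (xVar n 0 ^ (n - b) * pTildeX n ga) := by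
      rw [yProd_eq_sum_yCoeff hq hqn, Finset.sum_mul]
      exact Finset.sum_congr rfl fun b _ => by ring
    rw [e, map_sum]
    have h2 : ∀ b ∈ Finset.Icc 1 n, chain n 0 n
        ((yCoeff n q b * c ga) * (xVar n 0 ^ (n - b) * pTildeX n ga)) =
        if b ∈ ga then pTildeX n (ga.erase b) * (sgn _ ga b * yCoeff n q b * c ga) else 0 := by
      intro b hb
      obtain ⟨hb1, hb2⟩ := Finset.mem_Icc.1 hb
      rw [chain_mul_left (fun k _ _ => by rw [map_mul, yCoeff_fixed, hc]),
        chain_xVar_pow_mul_pTildeX h0 hb1 hb2]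
      split_ifs
      · ring
      · exact mul_zero _
    rw [Finset.sum_congr rfl h2, ← Finset.sum_filter]
    refine Finset.sum_congr (Finset.ext fun b => ?_) fun _ _ => rfl
    rw [Finset.mem_filter]
    exact ⟨fun h => h.2, fun h => ⟨Finset.mem_powerset.1 hga h, h⟩⟩
  rw [Finset.mul_sum, map_sum, Finset.sum_congr rfl h1, strictPartitions, sum_erase_eq_sum_insert]
  refine Finset.sum_congr rfl fun al _ => ?_
  rw [Finset.mul_sum]
  refine Finset.sum_congr rfl fun b hb => ?_
  have hb' := (Finset.mem_sdiff.1 hb).2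
  have hs : sgn (Poly n) (insert b al) b = sgn _ al b := by
    have := sgn_erase_of_le (R := Poly n) (S := insert b al) (le_refl b)
    rw [Finset.erase_insert hb'] at this
    exact this.symm
  rw [Finset.erase_insert hb', hs]

/-- The coefficient of `P̃_α(X)` after processing the letters in the list. -/
def listCoeff (n : ℕ) : List ℕ → Finset ℕ → Poly n
  | [], al => pTildeY n (dual n al)
  | d :: ds, al => ∑ b ∈ Finset.Icc 1 n \ al, sgn _ al b * yCoeff n d b * listCoeff n ds (insert b al)

theorem fixedAll_rename_inr (p : MvPolynomial (Fin n) ZHalf) :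
    FixedAll (MvPolynomial.rename Sum.inr p : Poly n) := by
  intro k
  have : (sAct n k).comp (MvPolynomial.rename Sum.inr :
      MvPolynomial (Fin n) ZHalf →ₐ[ZHalf] Poly n).toRingHom =
      (MvPolynomial.rename Sum.inr : MvPolynomial (Fin n) ZHalf →ₐ[ZHalf] Poly n).toRingHom := by
    refine MvPolynomial.ringHom_ext (fun r => ?_) (fun j => ?_)
    · simp [sAct_C]
    · have := sAct_y k j
      simpa [y] using this
  exact DFunLike.congr_fun this _

theorem listCoeff_fixed (ds : List ℕ) (al : Finset ℕ) : FixedAll (listCoeff n ds al) := by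
  intro k
  induction ds generalizing al with
  | nil => exact fixedAll_rename_inr _ k
  | cons d ds ih =>
    rw [listCoeff, map_sum]
    exact Finset.sum_congr rfl fun b _ => by
      rw [map_mul, map_mul, sgn_fixed, yCoeff_fixed, ih]

/-- The letters in `{1, …, p}` that are not in `lam`, in decreasing order. -/
def complList (lam : Finset ℕ) : ℕ → List ℕ
  | 0 => []
  | p + 1 => if p + 1 ∈ lam then complList lam p else (p + 1) :: complList lam p

theorem coreOp_pKernel (lam : Finset ℕ) (p : ℕ) (hp : p ≤ n) :
    coreOp n lam p (pKernel n) =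
      ∑ al ∈ strictPartitions n, pTildeX n al * listCoeff n (complList lam p) al := by
  induction p with
  | zero => rfl
  | succ p ih =>
    rw [coreOp, complList]
    split_ifs
    · exact ih (by omega)
    · rw [ih (by omega), chain_yProd_mul_sum (by omega) hp _ (listCoeff_fixed _)]
      rfl

/-- Supplies the symmetry required by `routeOp_stair_mul`; it is visible only from the explicit
expansion in the P̃_α(X). -/
theorem symmX_coreOp_pKernel (lam : Finset ℕ) (p : ℕ) (hp : p ≤ n) :
    SymmX (coreOp n lam p (pKernel n)) := fun k => by
  rw [coreOp_pKernel lam p hp, map_sum]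
  exact Finset.sum_congr rfl fun al hal => by
    rw [map_mul, pTildeX_symm (zero_notMem hal) k, listCoeff_fixed]

/-- The Laplace expansion along the first column of the determinant with rows `be` and columns
`ds`. -/
def detList (n : ℕ) : List ℕ → Finset ℕ → Poly n
  | [], _ => 1
  | d :: ds, be => ∑ b ∈ be, sgn _ be b * yCoeff n d b * detList n ds (be.erase b)

/-- The product of the signs of the elements of `be` relative to `al`. -/
def crossSign (n : ℕ) (al be : Finset ℕ) : Poly n := ∏ c ∈ be, sgn _ al c

/-- The sign of c flips exactly when c < b. Counting these elements as all of `be` except those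
above b produces the Laplace sign `sgn _ be b`. -/
theorem crossSign_insert_left {al be : Finset ℕ} {b : ℕ} (hal : b ∉ al) (hbe : b ∉ be) :
    crossSign n (insert b al) be = (-1) ^ be.card * sgn _ be b * crossSign n al be := by
  have h1 : ∀ c ∈ be, sgn (Poly n) (insert b al) c =
      (-1) * (if b < c then -1 else 1) * sgn _ al c := by
    intro c hc
    have hcb : c ≠ b := fun h => hbe (h ▸ hc)
    rcases lt_or_gt_of_ne hcb with h | h
    · have := sgn_erase_of_lt (R := Poly n) (Finset.mem_insert_self b al) h
      rw [Finset.erase_insert hal] at this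
      rw [if_neg h.not_gt, this]; ring
    · have := sgn_erase_of_le (R := Poly n) (S := insert b al) (le_of_lt h)
      rw [Finset.erase_insert hal] at this
      rw [if_pos h, this]; ring
  rw [crossSign, Finset.prod_congr rfl h1, Finset.prod_mul_distrib, Finset.prod_mul_distrib,
    Finset.prod_const, Finset.prod_ite, Finset.prod_const, Finset.prod_const_one, mul_one]
  rfl

/-- Group the sequences of inserted parts by their set β. Choosing the first part b is a choice of
row in the first column. Having b in α when the rest of β is treated costs (-1)^{|β|-1} times the
Laplace sign, and these exponents add up to 0 + 1 + ⋯. -/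
theorem listCoeff_eq (ds : List ℕ) (al : Finset ℕ) :
    listCoeff n ds al = ∑ be ∈ (Finset.Icc 1 n \ al).powersetCard ds.length,
      (-1) ^ (∑ i ∈ Finset.range ds.length, i) * crossSign n al be * detList n ds be *
        pTildeY n (dual n (al ∪ be)) := by
  induction ds generalizing al with
  | nil => simp [listCoeff, detList, crossSign]
  | cons d ds ih =>
    simp only [listCoeff, detList, ih, Finset.mul_sum, Finset.sum_mul]
    rw [Finset.sum_sigma', Finset.sum_sigma']
    refine Finset.sum_bij' (fun p _ => ⟨insert p.1 p.2, p.1⟩) (fun p _ => ⟨p.2, p.1.erase p.2⟩)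
      ?_ ?_ ?_ ?_ ?_
    · rintro ⟨b, be⟩ h
      simp only [Finset.mem_sigma, Finset.mem_powersetCard, Finset.mem_sdiff] at h ⊢
      obtain ⟨⟨h1, h2⟩, h3, h4⟩ := h
      have hb : b ∉ be := fun h => (Finset.mem_sdiff.1 (h3 h)).2 (Finset.mem_insert_self _ _)
      refine ⟨⟨?_, ?_⟩, Finset.mem_insert_self _ _⟩
      · refine Finset.insert_subset (Finset.mem_sdiff.2 ⟨h1, h2⟩) (h3.trans ?_)
        exact Finset.sdiff_subset_sdiff (Finset.Subset.refl _) (Finset.subset_insert _ _)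
      · rw [Finset.card_insert_of_notMem hb, h4, List.length_cons]
    · rintro ⟨be, b⟩ h
      simp only [Finset.mem_sigma, Finset.mem_powersetCard] at h ⊢
      obtain ⟨⟨h1, h2⟩, h3⟩ := h
      refine ⟨h1 h3, ?_, ?_⟩
      · intro c hc
        have hc' := Finset.mem_erase.1 hc
        have := Finset.mem_sdiff.1 (h1 hc'.2)
        exact Finset.mem_sdiff.2 ⟨this.1, by simp [hc'.1, this.2]⟩
      · rw [Finset.card_erase_of_mem h3, h2, List.length_cons, Nat.add_sub_cancel]
    · rintro ⟨b, be⟩ h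
      simp only [Finset.mem_sigma, Finset.mem_powersetCard] at h
      have hb : b ∉ be := fun h' =>
        (Finset.mem_sdiff.1 (h.2.1 h')).2 (Finset.mem_insert_self _ _)
      simp [Finset.erase_insert hb]
    · rintro ⟨be, b⟩ h
      simp only [Finset.mem_sigma] at h
      simp [Finset.insert_erase h.2]
    · rintro ⟨b, be⟩ h
      simp only [Finset.mem_sigma, Finset.mem_powersetCard, Finset.mem_sdiff] at h
      obtain ⟨⟨h1, h2⟩, h3, h4⟩ := h
      have hb : b ∉ be := fun h => (Finset.mem_sdiff.1 (h3 h)).2 (Finset.mem_insert_self _ _)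
      have hs : sgn (Poly n) (insert b be) b = sgn _ be b := by
        have := sgn_erase_of_le (R := Poly n) (S := insert b be) (le_refl b)
        rw [Finset.erase_insert hb] at this
        exact this.symm
      have hc : crossSign n al (insert b be) = sgn _ al b * crossSign n al be :=
        Finset.prod_insert hb
      simp only [Finset.erase_insert hb, List.length_cons]
      rw [crossSign_insert_left h2 hb, h4, hs, hc, Finset.sum_range_succ, pow_add,
        show insert b al ∪ be = al ∪ insert b be by
          rw [Finset.insert_union, Finset.union_insert]]
      ring

/-! ### From iterated expansions to determinants -/

theorem detList_eq_det (k : ℕ) (d f : Fin k → ℕ) (hf : StrictAnti f) :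
    detList n (List.ofFn d) (Finset.univ.image f) =
      (Matrix.of fun i j => yCoeff n (d j) (f i)).det := by
  induction k with
  | zero => simp [detList]
  | succ k ih =>
    rw [List.ofFn_succ, detList, Finset.sum_image hf.injective.injOn,
      Matrix.det_succ_column_zero]
    refine Finset.sum_congr rfl fun i _ => ?_
    rw [sgn_image hf, image_erase_succAbove hf.injective,
      ih (fun j => d j.succ) (fun j => f (i.succAbove j))
        (fun a b h => hf (Fin.strictMono_succAbove i h))]
    rfl

theorem pairwise_complList (lam : Finset ℕ) (p : ℕ) :
    (complList lam p).Pairwise (· > ·) ∧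
      ∀ q, q ∈ complList lam p ↔ (1 ≤ q ∧ q ≤ p) ∧ q ∉ lam := by
  induction p with
  | zero => exact ⟨List.Pairwise.nil, fun q => by simp [complList]; omega⟩
  | succ p ih =>
    obtain ⟨h1, h2⟩ := ih
    rw [complList]
    split_ifs with h
    · refine ⟨h1, fun q => ?_⟩
      rw [h2]
      constructor
      · rintro ⟨h3, h4⟩; exact ⟨by omega, h4⟩
      · rintro ⟨h3, h4⟩
        have : q ≠ p + 1 := fun h' => h4 (h' ▸ h)
        exact ⟨by omega, h4⟩
    · refine ⟨List.pairwise_cons.2 ⟨fun q hq => ?_, h1⟩, fun q => ?_⟩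
      · have := (h2 q).1 hq; omega
      · rw [List.mem_cons, h2]
        constructor
        · rintro (rfl | ⟨h3, h4⟩)
          · exact ⟨by omega, h⟩
          · exact ⟨by omega, h4⟩
        · rintro ⟨h3, h4⟩
          by_cases hq : q = p + 1
          · exact Or.inl hq
          · exact Or.inr ⟨by omega, h4⟩

theorem complList_eq (lam : Finset ℕ) :
    complList lam n = List.ofFn fun j : Fin (length (dual n lam)) => part (dual n lam) j := by
  obtain ⟨h1, h2⟩ := pairwise_complList lam n
  have h3 : complList lam n = (dual n lam).sort (· ≥ ·) := by
    refine List.Perm.eq_of_pairwise' (r := (· ≥ ·)) (h1.imp fun h => le_of_lt h)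
      (Finset.pairwise_sort _ _) ?_
    refine (List.perm_ext_iff_of_nodup (h1.imp fun h => ne_of_gt h) (Finset.sort_nodup _ _)).2
      fun q => ?_
    rw [h2, Finset.mem_sort, dual, Finset.mem_sdiff, Finset.mem_Icc]
  rw [h3]
  refine List.ext_getElem (by simp [length]) fun i hi1 hi2 => ?_
  rw [List.getElem_ofFn, part, List.getD_eq_getElem]

theorem sum_part (lam : Finset ℕ) : ∑ i : Fin lam.card, part lam i = weight lam := by
  have h : StrictAnti (fun i : Fin lam.card => part lam i) := fun i j h => part_lt_part h j.2
  conv_rhs => rw [weight, ← image_part lam]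
  rw [Finset.sum_image h.injective.injOn]

/-- The sign (-1)^{b+q} of an entry splits into a row factor and a column factor. -/
theorem detList_eq_det_elemMatrix (be mu : Finset ℕ) (h : be.card = mu.card) :
    detList n (List.ofFn fun j : Fin (length mu) => part mu j) be =
      (-1) ^ (weight be + weight mu) * (elemMatrix n be mu).det := by
  have hanti : StrictAnti (fun i : Fin (length mu) => part be i) := fun i j hij =>
    part_lt_part hij (by rw [h]; exact j.2)
  have himg : Finset.univ.image (fun i : Fin (length mu) => part be i) = be := by
    rw [length, ← h, image_part]
  have h1 := detList_eq_det (n := n) _ (fun j : Fin (length mu) => part mu j) _ hanti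
  rw [himg] at h1
  rw [h1]
  have h2 : (Matrix.of fun i j : Fin (length mu) => yCoeff n (part mu j) (part be i)) =
      Matrix.of fun i j : Fin (length mu) => (-1) ^ part be i *
        (Matrix.of fun i j : Fin (length mu) => (-1) ^ part mu j * elemMatrix n be mu i j) i j := by
    ext1 i j
    simp only [Matrix.of_apply, yCoeff, elemMatrix, pow_add]
    ring
  have h3 : ∑ i : Fin (length mu), part be i = weight be := by
    rw [← sum_part be, length, h]
  have h4 : ∑ i : Fin (length mu), part mu i = weight mu := sum_part mu
  rw [h2, Matrix.det_mul_column, Matrix.det_mul_row, Finset.prod_pow_eq_pow_sum,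
    Finset.prod_pow_eq_pow_sum, h3, h4, pow_add, mul_assoc]

/-! ### Vanishing of determinants, the intertwining number and signs -/

theorem part_antitone (lam : Finset ℕ) {i j : ℕ} (h : i ≤ j) : part lam j ≤ part lam i := by
  by_cases hj : j < lam.card
  · rcases h.lt_or_eq with h | rfl
    · exact (part_lt_part h hj).le
    · exact le_rfl
  · rw [part_eq_zero (not_lt.1 hj)]; exact Nat.zero_le _

/-- If β_i < μ_i, all entries in rows ≥ i and columns ≤ i have negative index. This zero block is
large enough to meet every permutation. -/
theorem det_elemMatrix_eq_zero {be mu : Finset ℕ} (h : ¬ Contained mu be) :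
    (elemMatrix n be mu).det = 0 := by
  obtain ⟨i, hi⟩ := not_forall.1 h
  rw [not_le] at hi
  have hik : i < mu.card := by
    by_contra h'
    rw [part_eq_zero (not_lt.1 h')] at hi
    omega
  let i' : Fin (length mu) := ⟨i, hik⟩
  rw [Matrix.det_apply]
  refine Finset.sum_eq_zero fun σ _ => ?_
  -- Pigeonhole: σ cannot send the columns up to i' injectively into the strictly fewer rows before
  -- i'.
  have : ∃ c : Fin (length mu), c ≤ i' ∧ i' ≤ σ c := by
    by_contra! hall
    have := Finset.card_le_card_of_injOn σ (s := Finset.Iic i') (t := Finset.Iio i')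
      (fun c hc => Finset.mem_coe.2 (Finset.mem_Iio.2 (hall c (Finset.mem_Iic.1 hc))))
      σ.injective.injOn
    simp at this
  obtain ⟨c, hc1, hc2⟩ := this
  rw [Finset.prod_eq_zero (Finset.mem_univ c), smul_zero]
  have e1 : part be (σ c) ≤ part be i := part_antitone be hc2
  have e2 : part mu i ≤ part mu c := part_antitone mu hc1
  rw [elemMatrix, Matrix.of_apply, elemY, if_neg (by omega)]

theorem lt_part_iff (al : Finset ℕ) (b i : ℕ) :
    b < part al i ↔ i < (al.filter (b < ·)).card := by
  have hanti : StrictAnti (fun i : Fin al.card => part al i) := fun i j h => part_lt_part h j.2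
  by_cases hi : i < al.card
  swap
  · rw [part_eq_zero (not_lt.1 hi)]
    have := Finset.card_filter_le al (b < ·)
    omega
  constructor
  · intro h
    have hsub : (Finset.Iic (⟨i, hi⟩ : Fin al.card)).image (fun i : Fin al.card => part al i) ⊆
        al.filter (b < ·) := by
      intro c hc
      obtain ⟨j, hj, rfl⟩ := Finset.mem_image.1 hc
      have hji : j ≤ ⟨i, hi⟩ := Finset.mem_Iic.1 hj
      have hj' : part al i ≤ part al j := part_antitone al hji
      exact Finset.mem_filter.2 ⟨part_mem j.2, by omega⟩
    have := Finset.card_le_card hsub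
    rw [Finset.card_image_of_injective _ hanti.injective, Fin.card_Iic] at this
    simp only at this
    omega
  · intro h
    by_contra hb
    have hsub : al.filter (b < ·) ⊆
        (Finset.Iio (⟨i, hi⟩ : Fin al.card)).image (fun i : Fin al.card => part al i) := by
      intro c hc
      obtain ⟨hc1, hc2⟩ := Finset.mem_filter.1 hc
      rw [← image_part al] at hc1
      obtain ⟨j, -, rfl⟩ := Finset.mem_image.1 hc1
      refine Finset.mem_image.2 ⟨j, Finset.mem_Iio.2 ?_, rfl⟩
      by_contra hj
      have hj' : part al j ≤ part al i := part_antitone al (not_lt.1 hj)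
      omega
    have := Finset.card_le_card hsub
    rw [Finset.card_image_of_injective _ hanti.injective, Fin.card_Iio] at this
    simp only at this
    omega

/-- A part b lies strictly between the i-th and (i+1)-st parts of α exactly when i parts of α exceed
b. Disjointness and b ≠ 0 exclude equality with a part or with the padding zero; parts above all of
α count 0 on both sides. -/
theorem intertwining_eq {al be : Finset ℕ} (h : Disjoint al be) (h0 : 0 ∉ be) :
    intertwining al be = ∑ b ∈ be, (al.filter (b < ·)).card := by
  have h1 : ∀ i, ∀ b ∈ be, (b < part al i ∧ part al (i + 1) < b) ↔
      (al.filter (b < ·)).card = i + 1 := by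
    intro i b hb
    have hne : part al (i + 1) ≠ b := by
      intro he
      by_cases hi : i + 1 < al.card
      · exact Finset.disjoint_left.1 h (part_mem hi) (he ▸ hb)
      · rw [part_eq_zero (not_lt.1 hi)] at he
        exact h0 (he ▸ hb)
    have e : part al (i + 1) < b ↔ ¬ b < part al (i + 1) := by omega
    rw [e, lt_part_iff, lt_part_iff]
    omega
  have h2 : ∀ i, (i + 1) * intertwiningCount al be i =
      ∑ b ∈ be, if (al.filter (b < ·)).card = i + 1 then i + 1 else 0 := by
    intro i
    rw [intertwiningCount, Finset.filter_congr (h1 i), Finset.card_filter, Finset.mul_sum]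
    exact Finset.sum_congr rfl fun b _ => by rw [mul_ite, mul_one, mul_zero]
  rw [intertwining, Finset.sum_congr rfl fun i _ => h2 i, Finset.sum_comm]
  refine Finset.sum_congr rfl fun b _ => ?_
  have hle : (al.filter (b < ·)).card ≤ al.card := Finset.card_filter_le _ _
  set r := (al.filter (b < ·)).card
  rcases Nat.eq_zero_or_pos r with hr | hr
  · rw [hr]
    exact Finset.sum_eq_zero fun i _ => if_neg (by omega)
  · rw [Finset.sum_eq_single (r - 1)]
    · rw [if_pos (by omega)]; omega
    · intro i _ hi
      exact if_neg (by omega)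
    · intro hi
      rw [Finset.mem_range, length] at hi
      omega

theorem crossSign_eq {al be : Finset ℕ} (h : Disjoint al be) (h0 : 0 ∉ be) :
    crossSign n al be = (-1) ^ intertwining al be := by
  rw [intertwining_eq h h0, ← Finset.prod_pow_eq_pow_sum]
  rfl

/-- The three signs come from the definition of the Schubert polynomial, from the rows consumed by
letters of `lam`, and from reordering the deleted parts. -/
theorem sign_eq {lam : Finset ℕ} (h : lam ∈ strictPartitions n) :
    ((-1 : Poly n) ^ (n * (n - 1) / 2)) * ((-1) ^ (∑ q ∈ lam, (n - q)) *
      (-1) ^ (∑ i ∈ Finset.range (length (dual n lam)), i)) = (-1) ^ excess lam := by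
  have hcard := card_add_card_dual h
  have hexc := length_mul_le_weight h
  have hsum : ∑ q ∈ lam, (n - q) + weight lam = lam.card * n := by
    rw [weight, ← Finset.sum_add_distrib, Finset.sum_congr rfl fun q hq =>
      Nat.sub_add_cancel (Finset.mem_Icc.1 (Finset.mem_powerset.1 h hq)).2, Finset.sum_const,
      smul_eq_mul]
  have hg := Finset.sum_range_id_mul_two (length (dual n lam))
  have ha := Finset.sum_range_id_mul_two n
  have hl := Finset.sum_range_id_mul_two (lam.card + 1)
  have ha' : n * (n - 1) / 2 = ∑ i ∈ Finset.range n, i := by omega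
  have hl' : length lam * (length lam + 1) / 2 = ∑ i ∈ Finset.range (lam.card + 1), i := by
    rw [length, mul_comm]; rw [Nat.add_sub_cancel] at hl; omega
  have hexc' : excess lam + length lam * (length lam + 1) / 2 = weight lam := by
    unfold excess; omega
  rw [ha']
  rw [hl'] at hexc'
  rw [length] at *
  set a := ∑ i ∈ Finset.range n, i
  set b := ∑ q ∈ lam, (n - q)
  set c := ∑ i ∈ Finset.range (dual n lam).card, i
  set l := ∑ i ∈ Finset.range (lam.card + 1), i
  set w := weight lam
  set ℓ := lam.card
  set k := (dual n lam).card
  -- With n = ℓ + k one has a = ℓ(ℓ-1)/2 + c + ℓk and b = ℓn - w; adding even amounts on both sides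
  -- avoids truncated subtraction.
  have key : a + b + c + 2 * w = excess lam + 2 * (c + ℓ * k + ℓ * ℓ) := by
    have ha2 : a * 2 + n = n * n := by
      rw [ha, Nat.mul_sub_one]; exact Nat.sub_add_cancel (Nat.le_mul_self n)
    have hc2 : c * 2 + k = k * k := by
      rw [hg, Nat.mul_sub_one]; exact Nat.sub_add_cancel (Nat.le_mul_self k)
    rw [Nat.add_sub_cancel] at hl
    rw [← hcard] at ha2 hsum
    nlinarith
  have hp := congrArg ((-1 : Poly n) ^ ·) key
  simp only [pow_add, pow_mul, neg_one_sq, one_pow, mul_one] at hp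
  rw [← hp, mul_assoc]

theorem powersetCard_eq (al : Finset ℕ) (k : ℕ) :
    (Finset.Icc 1 n \ al).powersetCard k =
      (strictPartitions n).filter fun be => length be = k ∧ Disjoint al be := by
  ext be
  rw [Finset.mem_powersetCard, Finset.mem_filter, strictPartitions, Finset.mem_powerset,
    length, Finset.subset_sdiff, disjoint_comm]
  tauto

end SchubertB

end

/-! ### Assembly of the formula -/

theorem theorem3p1 (n : ℕ) (lam : Finset ℕ) (hlam : lam ∈ SchubertB.strictPartitions n) :
    SchubertB.schubertB (SchubertB.maxGrassmannian n lam hlam) =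
      (-1) ^ (SchubertB.excess lam + SchubertB.weight (SchubertB.dual n lam)) *
        ∑ al ∈ SchubertB.strictPartitions n, SchubertB.pTildeX n al *
          ∑ be ∈ (SchubertB.strictPartitions n).filter (fun be =>
              SchubertB.Contained (SchubertB.dual n lam) be ∧
              SchubertB.length be = SchubertB.length (SchubertB.dual n lam) ∧
              Disjoint al be),
            (-1) ^ (SchubertB.intertwining al be + SchubertB.weight be) *
              SchubertB.pTildeY n (SchubertB.dual n (al ∪ be)) *
              (SchubertB.elemMatrix n be (SchubertB.dual n lam)).det := by
  have hfilter : (Finset.Icc 1 n).filter (· ∈ lam) = lam := by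
    rw [Finset.filter_mem_eq_inter, Finset.inter_eq_right]
    exact Finset.mem_powerset.1 hlam
  have hlen : (SchubertB.complList lam n).length = SchubertB.length (SchubertB.dual n lam) := by
    rw [SchubertB.complList_eq, List.length_ofFn]
  -- After all n letters no rows of the staircase remain, so only the sign and the core are left.
  rw [SchubertB.schubertB, SchubertB.divDiffPerm_maxGrassmannian, SchubertB.delta_eq_stair,
    SchubertB.routeOp_stair_mul _ _ (SchubertB.symmX_coreOp_pKernel lam) n le_rfl, hfilter,
    show n - n - 1 = 0 by omega, SchubertB.stair, one_mul,
    SchubertB.coreOp_pKernel lam n le_rfl, pow_add, ← SchubertB.sign_eq hlam, mul_assoc, mul_assoc,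
    mul_assoc]
  congr 2
  rw [Finset.mul_sum, Finset.mul_sum]
  refine Finset.sum_congr rfl fun al _ => ?_
  rw [mul_left_comm _ (SchubertB.pTildeX n al), mul_left_comm _ (SchubertB.pTildeX n al)]
  congr 1
  have hmem : ∀ be ∈ SchubertB.strictPartitions n, 0 ∉ be := fun be hbe h0 =>
    absurd (Finset.mem_Icc.1 (Finset.mem_powerset.1 hbe h0)).1 (by omega)
  rw [SchubertB.listCoeff_eq, hlen, SchubertB.powersetCard_eq, Finset.mul_sum, Finset.mul_sum]
  -- The computed sum runs over all β of the right length disjoint from α; those not containing λ'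
  -- have zero determinant and can be dropped.
  refine (Finset.sum_subset_zero_on_sdiff (Finset.monotone_filter_right _ fun be _ h => h.2)
    (fun be hbe => ?_) fun be hbe => ?_).symm
  · rw [Finset.mem_sdiff, Finset.mem_filter, Finset.mem_filter] at hbe
    obtain ⟨⟨h1, h2, h3⟩, h4⟩ := hbe
    rw [SchubertB.complList_eq, SchubertB.detList_eq_det_elemMatrix _ _ h2,
      SchubertB.det_elemMatrix_eq_zero fun h => h4 ⟨h1, h, h2, h3⟩, mul_zero, mul_zero, zero_mul]
  · obtain ⟨h1, -, h2, h3⟩ := Finset.mem_filter.1 hbe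
    rw [SchubertB.complList_eq, SchubertB.detList_eq_det_elemMatrix _ _ h2,
      SchubertB.crossSign_eq h3 (hmem be h1), pow_add, pow_add]
    ring
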